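/- Conventions. A source schema $\mathcal S$ is a finite set of predicate symbols, each with an arity; an $\mathcal S$-database $D$ is a finite set of facts $s(c_1,\dots,c_p)$ with $s\in\mathcal S$ of arity $p$ and $c_1,\dots,c_p$ constants, and $\mathrm{dom}(D)$ is the set of constants occurring in $D$. A conjunctive query (CQ) of arity $n$ is $\{\vec x\mid\exists\vec y.\,\phi(\vec x,\vec y)\}$, where $\vec x$ is an $n$-tuple of variables and $\phi$ is a finite conjunction of atoms whose arguments are variables from $\vec x,\vec y$; a UCQ is a finite set of CQs of the same arity. A tuple is an answer to a CQ over $D$ (resp. over an interpretation $\mathcal I$) if it consists of constants in $\mathrm{dom}(D)$ (resp. elements of the domain of $\mathcal I$) and some assignment of the variables maps $\vec x$ to it and makes all atoms of $\phi$ true; the answers to a UCQ are those of its disjuncts. A $\textit{DL-Lite}_{\mathcal R}$ ontology $\mathcal O$ is a finite set of assertions $B_1\sqsubseteq B_2$, $R_1\sqsubseteq R_2$, $B_1\sqsubseteq\neg B_2$, $R_1\sqsubseteq\neg R_2$, where basic concepts $B_i$ have the form $A$, $\exists P$ or $\exists P^-$, basic roles $R_i$ have the form $P$ or $P^-$, $A$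 is an atomic concept (possibly $\top$ or $\bot$) and $P$ an atomic role. Queries over $\mathcal O$ use atomic concepts and roles as unary and binary predicates. An interpretation consists of a non-empty domain, a subset of it for each atomic concept ($\top$ is the whole domain, $\bot$ is empty), a binary relation on it for each atomic role, and an element $c^{\mathcal I}$ of it for each constant $c$; satisfaction of assertions is the usual first-order one. A GLAV mapping $\mathcal M$ is a finite set of assertions $q_{\mathcal S}\to q_{\mathcal O}$, where $q_{\mathcal S}$ and $q_{\mathcal O}$ are CQs over $\mathcal S$ and over $\mathcal O$ with the same target list. An OBDM system is $\Sigma=\langle\langle\mathcal O,\mathcal S,\mathcal M\rangle,D\rangle$ with $D$ an $\mathcal S$-database. An interpretation $\mathcal I$ is a model of $\Sigma$ if it satisfies $\mathcal O$ and, for every $q_{\mathcal S}\to q_{\mathcal O}$ in $\mathcal M$ and every answer $(c_1,\dots,c_n)$ to $q_{\mathcal S}$ over $D$, the tuple $(c_1^{\mathcal I},\dots,c_n^{\mathcal I})$ is an answer to $q_{\mathcal O}$ over $\mathcal I$. The certain answers to a UCQ $q$ of arity $n$ over $\mathcal O$ with respect to $\Sigma$ are the tuples $\vec c\in\mathrm{dom}(D)^n$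 such that $\vec c^{\,\mathcal I}$ is an answer to $q$ over $\mathcal I$ for every model $\mathcal I$ of $\Sigma$ (so all of $\mathrm{dom}(D)^n$ if $\Sigma$ has no model). The problem Sound-VQDEF($\textit{DL-Lite}_{\mathcal R}$, GLAV, UCQ) is: given an OBDM system $\Sigma=\langle\langle\mathcal O,\mathcal S,\mathcal M\rangle,D\rangle$ with $\mathcal O$ a $\textit{DL-Lite}_{\mathcal R}$ ontology and $\mathcal M$ a GLAV mapping, a UCQ $q$ over $\mathcal O$ of arity $n$, and a finite set $\lambda\subseteq\mathrm{dom}(D)^n$, decide whether every certain answer to $q$ with respect to $\Sigma$ belongs to $\lambda$. All components of the input are explicitly listed, with arities written in unary. Theorem. Sound-VQDEF($\textit{DL-Lite}_{\mathcal R}$, GLAV, UCQ) is in $\mathrm{coNP}$. -/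

import Mathlib

/-! ### The classes NP and coNP, over Mathlib's polynomial-time multi-stack Turing machines -/

namespace Complexity

/-- The word `x` over `Γ` followed by the certificate `w`; the two parts use disjoint copies of
their alphabets, so both can be read off. -/
def pairEncode {Γ : Type} (p : List Γ × List Bool) : List (Γ ⊕ Bool) :=
  p.1.map Sum.inl ++ p.2.map Sum.inr

/-- `L` is in NP: some Turing machine, running in polynomial time on all inputs, verifies
certificates of polynomial length for membership in `L`. -/
def InNP {Γ : Type} (L : Set (List Γ)) : Prop :=
  ∃ (p : Polynomial ℕ) (V : List Γ × List Bool → Bool),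
    Nonempty (Turing.TM2ComputableInPolyTime pairEncode Computability.encodeBool V) ∧
    ∀ x : List Γ, x ∈ L ↔ ∃ w : List Bool, w.length ≤ p.eval x.length ∧ V (x, w) = true

/-- `L` is in coNP: the complement of `L`, among all words over the alphabet, is in NP. -/
def InCoNP {Γ : Type} (L : Set (List Γ)) : Prop :=
  InNP Lᶜ

end Complexity

namespace OBDM

/-! ### Syntax -/

/-- Identifiers are bit strings. Those of different sorts (constants, variables, source predicates,
atomic concepts, atomic roles) never occur in the same syntactic position, so the sorts are
disjoint. -/
abbrev Name := List Bool

/-- The countably infinite set of constants. -/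
abbrev Const := Name

/-- The countably infinite set of variables. -/
abbrev Var := Name

/-- An expression `s(t₁,…,tₙ)`: a fact if the arguments are constants, an atom of a query over
the source schema if they are variables. Finite sets are presented by lists throughout. -/
structure RelAtom (T : Type) where
  pred : Name
  args : List T

abbrev Fact := RelAtom Const

abbrev SourceAtom := RelAtom Var

/-- The image of an atom under a map of its arguments. -/
def RelAtom.map {T U : Type} (h : T → U) (α : RelAtom T) : RelAtom U :=
  ⟨α.pred, α.args.map h⟩

/-- A relational schema: finitely many predicate symbols, each with its arity. -/
abbrev Schema := List (Name × ℕ)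

abbrev Database := List Fact

/-- Atomic concepts, which include the universal and the bottom one. -/
inductive AtomicConcept where
  | top
  | bot
  | name (A : Name)

/-- Basic roles `P` and `P⁻`. -/
inductive BasicRole where
  | atomic (P : Name)
  | inv (P : Name)

/-- Basic concepts `A`, `∃P` and `∃P⁻`. -/
inductive BasicConcept where
  | atomic (A : AtomicConcept)
  | some (R : BasicRole)

/-- The assertions of `DL-Lite_R`. -/
inductive Assertion where
  | conceptIncl (B₁ B₂ : BasicConcept)
  | roleIncl (R₁ R₂ : BasicRole)
  | conceptDisj (B₁ B₂ : BasicConcept)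
  | roleDisj (R₁ R₂ : BasicRole)

/-- A `DL-Lite_R` ontology. -/
abbrev Ontology := List Assertion

/-- Atoms `A(v)` and `P(v,w)` of queries over an ontology. -/
inductive OntologyAtom where
  | concept (A : AtomicConcept) (v : Var)
  | role (P : Name) (v w : Var)

/-- A conjunctive query `{x⃗ | ∃ y⃗. φ(x⃗,y⃗)}` with the given kind of atoms: the target list `x⃗`
and the body `φ`. The existential variables `y⃗` are the variables of the body outside `x⃗`. -/
structure CQ (Atom : Type) where
  target : List Var
  body : List Atom

/-- A union of conjunctive queries over an ontology, with its arity. -/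
structure UCQ where
  arity : ℕ
  disjuncts : List (CQ OntologyAtom)

/-- A GLAV assertion `{x⃗ | ∃ y⃗. φ(x⃗,y⃗)} → {x⃗ | ∃ z⃗. ψ(x⃗,z⃗)}`, with a common target list `x⃗`. -/
structure GLAVAssertion where
  target : List Var
  sourceBody : List SourceAtom
  ontologyBody : List OntologyAtom

/-- The query over the source schema in a GLAV assertion. -/
def GLAVAssertion.sourceQuery (m : GLAVAssertion) : CQ SourceAtom :=
  ⟨m.target, m.sourceBody⟩

/-- The query over the ontology in a GLAV assertion. -/
def GLAVAssertion.ontologyQuery (m : GLAVAssertion) : CQ OntologyAtom :=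
  ⟨m.target, m.ontologyBody⟩

abbrev Mapping := List GLAVAssertion

/-- An OBDM specification `J = ⟨O, S, M⟩`. -/
structure Specification where
  ontology : Ontology
  schema : Schema
  mapping : Mapping

/-- An OBDM system `Σ = ⟨J, D⟩`. -/
structure System where
  spec : Specification
  database : Database

/-! ### Well-formedness -/

/-- `dom(D)`: the constants that occur in the database. -/
def Database.dom (D : Database) : Set Const :=
  {c | ∃ α ∈ D, c ∈ α.args}

/-- The predicate of the atom belongs to the schema and is used with its arity. -/
def RelAtom.IsOver {T : Type} (α : RelAtom T) (S : Schema) : Prop :=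
  (α.pred, α.args.length) ∈ S

/-- Each predicate symbol has only one arity. -/
def Schema.WellFormed (S : Schema) : Prop :=
  ∀ s m n, (s, m) ∈ S → (s, n) ∈ S → m = n

/-- The database and the source queries of the mapping are over the schema. -/
def System.WellFormed (Sys : System) : Prop :=
  Schema.WellFormed Sys.spec.schema ∧
  (∀ α ∈ Sys.database, α.IsOver Sys.spec.schema) ∧
  (∀ m ∈ Sys.spec.mapping, ∀ α ∈ m.sourceBody, α.IsOver Sys.spec.schema)

/-- All disjuncts have the arity of the union. -/
def UCQ.WellFormed (q : UCQ) : Prop :=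
  ∀ d ∈ q.disjuncts, d.target.length = q.arity

/-- `lam` is a `D`-dataset of arity `n`. -/
def IsDataset (D : Database) (n : ℕ) (lam : List (List Const)) : Prop :=
  ∀ c ∈ lam, c.length = n ∧ ∀ a ∈ c, a ∈ Database.dom D

/-! ### Semantics -/

/-- The answers to a conjunctive query over a database. -/
def sourceAnswers (q : CQ SourceAtom) (D : Database) : Set (List Const) :=
  {c | (∀ a ∈ c, a ∈ Database.dom D) ∧
    ∃ h : Var → Const, q.target.map h = c ∧ ∀ α ∈ q.body, α.map h ∈ D}

/-- An interpretation: a non-empty domain, a set for each atomic concept name, a binary relation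
for each atomic role name, and a domain object for each constant. Distinct constants may denote
the same object. -/
structure Interpretation where
  Domain : Type
  nonempty : Nonempty Domain
  concept : Name → Set Domain
  role : Name → Set (Domain × Domain)
  const : Const → Domain

namespace Interpretation

variable (I : Interpretation)

def atomicConcept : AtomicConcept → Set I.Domain
  | .top => Set.univ
  | .bot => ∅
  | .name A => I.concept A

def basicRole : BasicRole → Set (I.Domain × I.Domain)
  | .atomic P => I.role P
  | .inv P => {o | (o.2, o.1) ∈ I.role P}

def basicConcept : BasicConcept → Set I.Domain
  | .atomic A => I.atomicConcept A
  | .some R => {o | ∃ o', (o, o') ∈ I.basicRole R}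

def SatAssertion : Assertion → Prop
  | .conceptIncl B₁ B₂ => I.basicConcept B₁ ⊆ I.basicConcept B₂
  | .roleIncl R₁ R₂ => I.basicRole R₁ ⊆ I.basicRole R₂
  | .conceptDisj B₁ B₂ => I.basicConcept B₁ ∩ I.basicConcept B₂ = ∅
  | .roleDisj R₁ R₂ => I.basicRole R₁ ∩ I.basicRole R₂ = ∅

def SatOntology (O : Ontology) : Prop :=
  ∀ a ∈ O, I.SatAssertion a

/-- The atom holds under the assignment `h` of domain objects to variables. -/
def SatAtom (h : Var → I.Domain) : OntologyAtom → Prop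
  | .concept A v => h v ∈ I.atomicConcept A
  | .role P v w => (h v, h w) ∈ I.role P

/-- The answers to a conjunctive query over the interpretation. -/
def cqAnswers (q : CQ OntologyAtom) : Set (List I.Domain) :=
  {o | ∃ h : Var → I.Domain, q.target.map h = o ∧ ∀ α ∈ q.body, I.SatAtom h α}

/-- The answers to a union of conjunctive queries over the interpretation. -/
def ucqAnswers (q : UCQ) : Set (List I.Domain) :=
  {o | ∃ d ∈ q.disjuncts, o ∈ I.cqAnswers d}

/-- The interpretation and the database satisfy the mapping. -/
def SatMapping (D : Database) (M : Mapping) : Prop :=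
  ∀ m ∈ M, ∀ c ∈ sourceAnswers m.sourceQuery D, c.map I.const ∈ I.cqAnswers m.ontologyQuery

def IsModel (Sys : System) : Prop :=
  I.SatOntology Sys.spec.ontology ∧ I.SatMapping Sys.database Sys.spec.mapping

end Interpretation

/-- The certain answers to a UCQ with respect to an OBDM system: tuples of constants of the
database, of the arity of the query, that are answers in every model. If the system is
inconsistent, these are all such tuples. -/
def certainAnswers (q : UCQ) (Sys : System) : Set (List Const) :=
  {c | c.length = q.arity ∧ (∀ a ∈ c, a ∈ Database.dom Sys.database) ∧
    ∀ I : Interpretation, I.IsModel Sys → c.map I.const ∈ I.ucqAnswers q}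

/-- `q` is a sound characterization of the dataset with respect to the OBDM system. -/
def IsSoundCharacterization (Sys : System) (lam : List (List Const)) (q : UCQ) : Prop :=
  ∀ c ∈ certainAnswers q Sys, c ∈ lam

/-! ### The verification problem -/

/-- The syntactic data of an input to the verification problem. -/
structure Input where
  system : System
  dataset : List (List Const)
  query : UCQ

/-- The data form an OBDM system, a dataset for its database, and a UCQ of the same arity. -/
def Input.WellFormed (x : Input) : Prop :=
  x.system.WellFormed ∧ x.query.WellFormed ∧
    IsDataset x.system.database x.query.arity x.dataset

/-! ### Encoding of inputs as words -/

/-- The alphabet in which inputs are written. -/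
inductive Sym where
  | zero
  | one
  | item
  | close

def encodeBit : Bool → Sym
  | false => .zero
  | true => .one

/-- An identifier is written as its bits and a terminator. -/
def encodeName (w : Name) : List Sym :=
  w.map encodeBit ++ [.close]

/-- Arities are written in unary. -/
def encodeNat (n : ℕ) : List Sym :=
  List.replicate n .one ++ [.close]

/-- A list is written entry by entry, with a mark before each entry and a terminator. -/
def encodeList {α : Type} (f : α → List Sym) : List α → List Sym
  | [] => [.close]
  | a :: l => .item :: (f a ++ encodeList f l)

def encodeRelAtom (α : RelAtom Name) : List Sym :=
  encodeName α.pred ++ encodeList encodeName α.args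

def encodeSchemaEntry (p : Name × ℕ) : List Sym :=
  encodeName p.1 ++ encodeNat p.2

def encodeAtomicConcept : AtomicConcept → List Sym
  | .top => [.zero]
  | .bot => [.close]
  | .name A => .one :: encodeName A

def encodeBasicRole : BasicRole → List Sym
  | .atomic P => .zero :: encodeName P
  | .inv P => .one :: encodeName P

def encodeBasicConcept : BasicConcept → List Sym
  | .atomic A => .zero :: encodeAtomicConcept A
  | .some R => .one :: encodeBasicRole R

def encodeAssertion : Assertion → List Sym
  | .conceptIncl B₁ B₂ => .zero :: (encodeBasicConcept B₁ ++ encodeBasicConcept B₂)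
  | .roleIncl R₁ R₂ => .one :: (encodeBasicRole R₁ ++ encodeBasicRole R₂)
  | .conceptDisj B₁ B₂ => .item :: (encodeBasicConcept B₁ ++ encodeBasicConcept B₂)
  | .roleDisj R₁ R₂ => .close :: (encodeBasicRole R₁ ++ encodeBasicRole R₂)

def encodeOntologyAtom : OntologyAtom → List Sym
  | .concept A v => .zero :: (encodeAtomicConcept A ++ encodeName v)
  | .role P v w => .one :: (encodeName P ++ (encodeName v ++ encodeName w))

def encodeCQ (q : CQ OntologyAtom) : List Sym :=
  encodeList encodeName q.target ++ encodeList encodeOntologyAtom q.body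

def encodeUCQ (q : UCQ) : List Sym :=
  encodeNat q.arity ++ encodeList encodeCQ q.disjuncts

def encodeGLAV (m : GLAVAssertion) : List Sym :=
  encodeList encodeName m.target ++
    (encodeList encodeRelAtom m.sourceBody ++ encodeList encodeOntologyAtom m.ontologyBody)

def encodeSpecification (J : Specification) : List Sym :=
  encodeList encodeAssertion J.ontology ++
    (encodeList encodeSchemaEntry J.schema ++ encodeList encodeGLAV J.mapping)

def encodeSystem (Sys : System) : List Sym :=
  encodeSpecification Sys.spec ++ encodeList encodeRelAtom Sys.database

/-- The word that presents an input. -/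
def Input.encode (x : Input) : List Sym :=
  encodeSystem x.system ++
    (encodeList (encodeList encodeName) x.dataset ++ encodeUCQ x.query)

/-- Sound-VQDEF(DL-Lite_R, GLAV, UCQ), as a set of words: the inputs whose query is a sound
characterization of the dataset. -/
def soundVQDEF : Set (List Sym) :=
  {s | ∃ x : Input, x.WellFormed ∧ x.encode = s ∧
    IsSoundCharacterization x.system x.dataset x.query}

/-! ### The encoding is injective -/

/-- No code word is a proper prefix of another, and code words determine what they encode. -/
def PrefixCode {α : Type} (f : α → List Sym) : Prop :=
  ∀ a b s t, f a ++ s = f b ++ t → a = b ∧ s = t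

theorem prefixCode_name : PrefixCode encodeName := by
  intro a
  induction a with
  | nil =>
    intro b s t h
    cases b with
    | nil => simpa [encodeName] using h
    | cons y b => cases y <;> simp [encodeName, encodeBit] at h
  | cons x a ih =>
    intro b s t h
    cases b with
    | nil => cases x <;> simp [encodeName, encodeBit] at h
    | cons y b =>
      have h' : encodeBit x = encodeBit y ∧ encodeName a ++ s = encodeName b ++ t := by
        simpa [encodeName] using h
      obtain ⟨rfl, rfl⟩ := ih b s t h'.2
      cases x <;> cases y <;> simp_all [encodeBit]

theorem prefixCode_nat : PrefixCode encodeNat := by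
  intro a
  induction a with
  | zero =>
    intro b s t h
    cases b with
    | zero => simpa [encodeNat] using h
    | succ b => simp [encodeNat, List.replicate_succ] at h
  | succ a ih =>
    intro b s t h
    cases b with
    | zero => simp [encodeNat, List.replicate_succ] at h
    | succ b =>
      have h' : encodeNat a ++ s = encodeNat b ++ t := by
        simpa [encodeNat, List.replicate_succ] using h
      obtain ⟨rfl, rfl⟩ := ih b s t h'
      exact ⟨rfl, rfl⟩

theorem prefixCode_list {α : Type} {f : α → List Sym} (hf : PrefixCode f) :
    PrefixCode (encodeList f) := by
  intro a
  induction a with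
  | nil =>
    intro b s t h
    cases b with
    | nil => simpa [encodeList] using h
    | cons y b => simp [encodeList] at h
  | cons x a ih =>
    intro b s t h
    cases b with
    | nil => simp [encodeList] at h
    | cons y b =>
      simp only [encodeList, List.cons_append, List.append_assoc, List.cons.injEq,
        true_and] at h
      obtain ⟨rfl, h'⟩ := hf _ _ _ _ h
      obtain ⟨rfl, rfl⟩ := ih _ _ _ h'
      exact ⟨rfl, rfl⟩

theorem prefixCode_append {α β γ : Type} {f : α → List Sym} {g : β → List Sym}
    (hf : PrefixCode f) (hg : PrefixCode g) (u : γ → α) (v : γ → β)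
    (huv : ∀ x y, u x = u y → v x = v y → x = y) :
    PrefixCode (fun x => f (u x) ++ g (v x)) := by
  intro a b s t h
  simp only [List.append_assoc] at h
  obtain ⟨h₁, h⟩ := hf _ _ _ _ h
  obtain ⟨h₂, h⟩ := hg _ _ _ _ h
  exact ⟨huv _ _ h₁ h₂, h⟩

theorem prefixCode_pair {α β : Type} {f : α → List Sym} {g : β → List Sym}
    (hf : PrefixCode f) (hg : PrefixCode g) :
    PrefixCode (fun x : α × β => f x.1 ++ g x.2) :=
  prefixCode_append hf hg Prod.fst Prod.snd (fun _ _ h₁ h₂ => Prod.ext h₁ h₂)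

theorem prefixCode_relAtom : PrefixCode encodeRelAtom :=
  prefixCode_append prefixCode_name (prefixCode_list prefixCode_name)
    RelAtom.pred RelAtom.args (by rintro ⟨⟩ ⟨⟩; simp_all)

theorem prefixCode_schemaEntry : PrefixCode encodeSchemaEntry :=
  prefixCode_pair prefixCode_name prefixCode_nat

theorem prefixCode_atomicConcept : PrefixCode encodeAtomicConcept := by
  intro a b s t h
  cases a <;> cases b <;> simp [encodeAtomicConcept] at h ⊢ <;>
    first | exact h | exact prefixCode_name _ _ _ _ h

theorem prefixCode_basicRole : PrefixCode encodeBasicRole := by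
  intro a b s t h
  cases a <;> cases b <;> simp [encodeBasicRole] at h ⊢ <;>
    exact prefixCode_name _ _ _ _ h

theorem prefixCode_basicConcept : PrefixCode encodeBasicConcept := by
  intro a b s t h
  cases a <;> cases b <;> simp [encodeBasicConcept] at h ⊢ <;>
    first | exact prefixCode_atomicConcept _ _ _ _ h | exact prefixCode_basicRole _ _ _ _ h

theorem prefixCode_assertion : PrefixCode encodeAssertion := by
  have hc := prefixCode_pair prefixCode_basicConcept prefixCode_basicConcept
  have hr := prefixCode_pair prefixCode_basicRole prefixCode_basicRole
  intro a b s t h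
  cases a <;> cases b <;>
    simp only [encodeAssertion, List.cons_append, List.cons.injEq, reduceCtorEq, false_and,
      true_and] at h <;>
    first
    | (obtain ⟨h₁, h₂⟩ := hc (_, _) (_, _) _ _ h; simp_all)
    | (obtain ⟨h₁, h₂⟩ := hr (_, _) (_, _) _ _ h; simp_all)

theorem prefixCode_ontologyAtom : PrefixCode encodeOntologyAtom := by
  have hc := prefixCode_pair prefixCode_atomicConcept prefixCode_name
  have hr := prefixCode_pair prefixCode_name (prefixCode_pair prefixCode_name prefixCode_name)
  intro a b s t h
  cases a <;> cases b <;>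
    simp only [encodeOntologyAtom, List.cons_append, List.cons.injEq, reduceCtorEq, false_and,
      true_and] at h
  · obtain ⟨h₁, h₂⟩ := hc (_, _) (_, _) _ _ h
    simp_all
  · obtain ⟨h₁, h₂⟩ := hr (_, _, _) (_, _, _) _ _ h
    simp_all

theorem prefixCode_cq : PrefixCode encodeCQ :=
  prefixCode_append (prefixCode_list prefixCode_name) (prefixCode_list prefixCode_ontologyAtom)
    CQ.target CQ.body (by rintro ⟨⟩ ⟨⟩; simp_all)

theorem prefixCode_ucq : PrefixCode encodeUCQ :=
  prefixCode_append prefixCode_nat (prefixCode_list prefixCode_cq)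
    UCQ.arity UCQ.disjuncts (by rintro ⟨⟩ ⟨⟩; simp_all)

theorem prefixCode_glav : PrefixCode encodeGLAV :=
  prefixCode_append (prefixCode_list prefixCode_name)
    (prefixCode_pair (prefixCode_list prefixCode_relAtom)
      (prefixCode_list prefixCode_ontologyAtom))
    GLAVAssertion.target (fun m => (m.sourceBody, m.ontologyBody))
    (by rintro ⟨⟩ ⟨⟩; simp_all)

theorem prefixCode_specification : PrefixCode encodeSpecification :=
  prefixCode_append (prefixCode_list prefixCode_assertion)
    (prefixCode_pair (prefixCode_list prefixCode_schemaEntry) (prefixCode_list prefixCode_glav))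
    Specification.ontology (fun J => (J.schema, J.mapping)) (by rintro ⟨⟩ ⟨⟩; simp_all)

theorem prefixCode_system : PrefixCode encodeSystem :=
  prefixCode_append prefixCode_specification (prefixCode_list prefixCode_relAtom)
    System.spec System.database (by rintro ⟨⟩ ⟨⟩; simp_all)

theorem prefixCode_input : PrefixCode Input.encode :=
  prefixCode_append prefixCode_system
    (prefixCode_pair (prefixCode_list (prefixCode_list prefixCode_name)) prefixCode_ucq)
    Input.system (fun x => (x.dataset, x.query)) (by rintro ⟨⟩ ⟨⟩; simp_all)

/-- Distinct inputs are presented by distinct words. -/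
theorem Input.encode_injective : Function.Injective Input.encode := by
  intro x y h
  exact (prefixCode_input x y [] [] (by rw [h])).1

end OBDM

/-! A word lies outside the language if it codes no input, or codes an ill-formed one, or if some
tuple over `dom(D)` of the right arity is a certain answer but is not in the dataset. The first two
cases are easy to certify. The substance is a polynomial certificate for being a certain answer,
uniformly in ontology, mapping, database and query.

Such a certificate is a match of a disjunct in a canonical model (or a proof that the system has no
model). The elements of the canonical model are terms: constants, nulls named after an instance of a
mapping assertion and a variable, successors `child R t`, and a representative `root B` for every
non-empty basic concept `B`. The model may be infinite, but the type of a successor depends only on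
the role that leads to it. Hence, if a match leaves some level unoccupied, everything beyond that
level can be moved to representatives, and by the pigeonhole principle some match has depth less
than the number of its variables (`exists_shallow_match`). For the same reason an inconsistency
already shows at depth at most one (`Violation.shallow`). Only linearly many concepts and roles can
be reached along the inclusions of the ontology, so membership of an element in a concept has a
short proof without repetitions (`propagate`, `typ_deg`, `rol_deg`).

The certificates are organised as derivations from a fixed finite set of Horn clauses over words,
`clauses`. Soundness (`clauses_sound`) gives each predicate a meaning that the clauses preserve;
terms are evaluated in an arbitrary model by choosing witnesses (`Interpretation.value`), so a
derived fact holds in all models and no homomorphism theorem is needed. Completeness (`top_deg`)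
builds derivations of polynomially many steps in which all words are polynomially long; the
canonical model is used only here.

It remains that languages with such derivations are in NP (`Horn.inNP`). A nondeterministic machine
keeps the open goals on a stack, guesses the substitution of a rule, pops its head and pushes its
body. A nondeterministic machine with polynomially long runs is simulated by a deterministic one
that reads the sequence of transitions from the certificate (`StackMachine.inNP`). -/

/-! ### Nondeterministic multi-stack machines -/

namespace Complexity

open Turing Function

/-- Elementary operations on a family of stacks. -/
inductive StackOp (K A : Type) where
  | push (k : K) (a : A)
  | pop (k : K) (a : A)
  | empty (k : K)

/-- A transition of a nondeterministic machine. -/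
structure Transition (K A Q : Type) where
  src : Q
  ops : List (StackOp K A)
  dst : Q

/-- A nondeterministic multi-stack machine, given by its finite list of transitions. -/
structure StackMachine (Γ K A Q : Type) where
  edges : List (Transition K A Q)
  start : Q
  final : Q
  inStack : K
  letter : Γ → A

section

variable {Γ K A Q : Type}

open Classical in
/-- The effect of an operation on the stacks; the flag is cleared if it is not applicable. -/
noncomputable def StackOp.exec : StackOp K A → Bool × (K → List A) → Bool × (K → List A)
  | .push k a, (b, S) => (b, update S k (a :: S k))
  | .pop k a, (b, S) => (b && decide ((S k).head? = some a), update S k (S k).tail)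
  | .empty k, (b, S) => (b && decide ((S k).head? = none), S)

/-- Execution goes on after an operation that does not apply; only the flag remembers the failure. A
deterministic machine can thus follow any guess to the end and reject there. -/
noncomputable def execOps : List (StackOp K A) → Bool × (K → List A) → Bool × (K → List A)
  | [], c => c
  | o :: l, c => execOps l (o.exec c)

theorem execOps_false (l : List (StackOp K A)) (S : K → List A) :
    (execOps l (false, S)).1 = false := by
  induction l generalizing S with
  | nil => rfl
  | cons o l ih => cases o <;> simp [execOps, StackOp.exec, ih]

/-- The growth of the stacks in a transition is bounded by its number of operations. This bounds the
time needed to empty the stacks before halting. -/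
theorem execOps_length (l : List (StackOp K A)) (b : Bool) (S : K → List A) (k : K) :
    ((execOps l (b, S)).2 k).length ≤ (S k).length + l.length := by
  classical
  induction l generalizing b S with
  | nil => simp [execOps]
  | cons o l ih =>
    have h : ((o.exec (b, S)).2 k).length ≤ (S k).length + 1 := by
      cases o <;> simp only [StackOp.exec, update_apply]
      · split
        · simp_all
        · omega
      · split
        · subst_vars; simp; omega
        · omega
      · omega
    have := ih (o.exec (b, S)).1 (o.exec (b, S)).2
    simp only [execOps, List.length_cons]
    simp only [Prod.mk.eta] at this
    omega

namespace StackMachine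

variable (M : StackMachine Γ K A Q)

/-- The machine can pass from one configuration to another by one transition. -/
def Step (c c' : Q × (K → List A)) : Prop :=
  ∃ e ∈ M.edges, e.src = c.1 ∧ e.dst = c'.1 ∧ execOps e.ops (true, c.2) = (true, c'.2)

/-- The machine can pass from one configuration to another by the given number of transitions. -/
inductive Run : ℕ → Q × (K → List A) → Q × (K → List A) → Prop
  | refl (c) : Run 0 c c
  | head {n c c' c''} : M.Step c c' → Run n c' c'' → Run (n + 1) c c''

variable {M}

theorem Run.trans {m n : ℕ} {a b c : Q × (K → List A)} (h : M.Run m a b) (h' : M.Run n b c) :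
    M.Run (m + n) a c := by
  induction h with
  | refl => simpa using h'
  | head s _ ih => rw [Nat.add_right_comm]; exact .head s (ih h')

theorem Run.single {a b : Q × (K → List A)} (h : M.Step a b) : M.Run 1 a b :=
  .head h (.refl _)

variable (M)

open Classical in
/-- The initial stacks: the input, reversed, lies on the input stack. -/
noncomputable def initStacks (x : List Γ) : K → List A :=
  update (fun _ => []) M.inStack (x.reverse.map M.letter)

/-- There is an accepting run of the given length. -/
def AcceptsIn (x : List Γ) (n : ℕ) : Prop :=
  ∃ S, M.Run n (M.start, M.initStacks x) (M.final, S)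

/-! ### Deterministic simulation guided by a certificate -/

/-- The control state of the simulation: the number of ones read since the last transition, the
last transition, whether all transitions were applicable, the last symbol read from the input,
and a flag used for clearing the stacks. -/
structure Ctl where
  count : Fin (M.edges.length + 1)
  last : Option (Fin M.edges.length)
  ok : Bool
  sym : Option (Γ ⊕ Bool)
  dirty : Bool

variable {M}

def Ctl.equiv : M.Ctl ≃ Fin (M.edges.length + 1) × Option (Fin M.edges.length) × Bool ×
    Option (Γ ⊕ Bool) × Bool where
  toFun s := (s.count, s.last, s.ok, s.sym, s.dirty)
  invFun s := ⟨s.1, s.2.1, s.2.2.1, s.2.2.2.1, s.2.2.2.2⟩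
  left_inv _ := rfl
  right_inv _ := rfl

instance [Fintype Γ] : Fintype M.Ctl := Fintype.ofEquiv _ Ctl.equiv.symm

/-- The state of the simulated machine. -/
def Ctl.cur (s : M.Ctl) : Q :=
  match s.last with
  | none => M.start
  | some i => M.edges[i].dst

variable (M)

def initCtl : M.Ctl := ⟨0, none, true, none, false⟩

/-! ### The stacks and the program of the simulation -/

inductive SimStack (K : Type) where
  | input
  | output
  | work (k : K)

open Classical in
noncomputable instance : DecidableEq (SimStack K) := inferInstance

def SimStack.equiv : SimStack K ≃ Bool ⊕ K where
  toFun
    | .input => .inl false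
    | .output => .inl true
    | .work k => .inr k
  invFun
    | .inl false => .input
    | .inl true => .output
    | .inr k => .work k
  left_inv s := by cases s <;> rfl
  right_inv s := by rcases s with (_ | _) | _ <;> rfl

noncomputable instance [Fintype K] : Fintype (SimStack K) := Fintype.ofEquiv _ SimStack.equiv.symm

/-- The stack alphabets of the simulation. -/
abbrev SimAlphabet (Γ A : Type) : SimStack K → Type
  | .input => Γ ⊕ Bool
  | .output => Bool
  | .work _ => A

open TM2.Stmt

/-- Statements of the simulation; the label `true` reads the input, `false` clears the stacks. -/
abbrev SimStmt := TM2.Stmt (SimAlphabet (K := K) Γ A) Bool M.Ctl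

variable {M}

open Classical in
noncomputable def opStmt : StackOp K A → M.SimStmt → M.SimStmt
  | .push k a, q => push (.work k) (fun _ => a) q
  | .pop k a, q => pop (.work k) (fun s o => { s with ok := s.ok && decide (o = some a) }) q
  | .empty k, q => peek (.work k) (fun s o => { s with ok := s.ok && decide (o = none) }) q

-- The field `last` is overwritten only after the source has been compared with `cur`, which is read
-- off from the previous transition. A wrong source clears the flag like an inapplicable operation.
open Classical in
noncomputable def edgeStmt (i : Fin M.edges.length) : M.SimStmt :=
  load (fun s => { s with count := 0, ok := s.ok && decide (M.edges[i].src = s.cur) }) <|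
    M.edges[i].ops.foldr opStmt <|
      load (fun s => { s with last := some i }) <| goto fun _ => true

-- In a certificate, a block of `i` ones followed by a zero calls for transition `i`. For the full
-- list of indices, the end is reached only if the count is the last value of `Fin (M.edges.length +
-- 1)`, which numbers no transition; the flag is then cleared.
open Classical in
noncomputable def dispatchStmt : List (Fin M.edges.length) → M.SimStmt
  | [] => load (fun s => { s with count := 0, ok := false }) <| goto fun _ => true
  | i :: l => branch (fun s => decide (s.count = i.castSucc)) (edgeStmt i) (dispatchStmt l)

variable (M)

-- Letters of the input go to the input stack of the simulated machine, bits of the certificate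
-- select transitions. The count wraps around on overlong blocks of ones; this is harmless, since
-- every block still selects a genuine transition or clears the flag. The value `default` is for
-- symbols that the preceding branches exclude.
open Classical in
noncomputable def readStmt [Inhabited A] : M.SimStmt :=
  pop .input (fun s o => { s with sym := o }) <|
    branch (fun s => decide (s.sym = none)) (goto fun _ => false) <|
      branch (fun s => decide (s.sym = some (.inr true)))
        (load (fun s => { s with count := s.count + 1 }) <| goto fun _ => true) <|
        branch (fun s => decide (s.sym = some (.inr false))) (dispatchStmt (List.finRange _)) <|
          push (.work M.inStack)
            (fun s => match s.sym with | some (.inl a) => M.letter a | _ => default) <|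
            goto fun _ => true

variable {M} in
noncomputable def popAllStmt (l : List K) (q : M.SimStmt) : M.SimStmt :=
  l.foldr (fun k q => pop (.work k) (fun s o => { s with dirty := s.dirty || o.isSome }) q) q

-- A halting configuration must have empty stacks apart from the output, and the initial control
-- state. A pass pops every work stack once and is repeated as long as it removes something; the
-- verdict is written before the control state is reset.
open Classical in
noncomputable def clearStmt [Fintype K] : M.SimStmt :=
  load (fun s => { s with dirty := false }) <|
    popAllStmt (Finset.univ.toList) <|
      branch (fun s => s.dirty) (goto fun _ => false) <|
        push .output (fun s => s.ok && decide (s.cur = M.final)) <|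
          load (fun _ => M.initCtl) halt

/-- The program of the simulation. -/
noncomputable def simProgram [Fintype K] [Inhabited A] (b : Bool) : M.SimStmt :=
  if b then M.readStmt else M.clearStmt

noncomputable def simulator [Fintype Γ] [Fintype K] [Inhabited A] : FinTM2 where
  K := SimStack K
  k₀ := .input
  k₁ := .output
  Γ := SimAlphabet Γ A
  Λ := Bool
  main := true
  σ := M.Ctl
  initialState := M.initCtl
  Γk₀Fin := inferInstanceAs (Fintype (Γ ⊕ Bool))
  m := M.simProgram

/-- The contents of the stacks of the simulation. -/
def simStacks (inp : List (Γ ⊕ Bool)) (S : K → List A) : ∀ k : SimStack K, List (SimAlphabet Γ A k)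
  | .input => inp
  | .output => []
  | .work k => S k

/-- The final stacks of the simulation. -/
def outStacks (b : Bool) : ∀ k : SimStack K, List (SimAlphabet Γ A k)
  | .input => []
  | .output => [b]
  | .work _ => []

variable {M}

/-! ### Single steps of the simulation -/

theorem update_simStacks_output (b : Bool) :
    update (simStacks (Γ := Γ) [] fun _ : K => ([] : List A)) .output [b] = outStacks b := by
  funext j
  rcases j with _ | _ | j <;> simp [simStacks, outStacks]

theorem update_simStacks_work (inp : List (Γ ⊕ Bool)) (S : K → List A) (k : K) (l : List A)
    [DecidableEq K] :
    update (simStacks inp S) (.work k) l = simStacks inp (update S k l) := by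
  funext j
  rcases j with _ | _ | j
  · simp [simStacks]
  · simp [simStacks]
  · by_cases h : j = k
    · subst h; simp [simStacks]
    · rw [update_of_ne (by simpa using h)]; simp [simStacks, h]

theorem update_simStacks_input (inp l : List (Γ ⊕ Bool)) (S : K → List A) :
    update (simStacks inp S) .input l = simStacks l S := by
  funext j
  rcases j with _ | _ | j <;> simp [simStacks]

-- The operations of a transition are chained in one statement, so that a whole transition costs a
-- single step.
open Classical in
theorem stepAux_ops (ops : List (StackOp K A)) (q : M.SimStmt) (s : M.Ctl)
    (inp : List (Γ ⊕ Bool)) (S : K → List A) :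
    TM2.stepAux (ops.foldr opStmt q) s (simStacks inp S) =
      TM2.stepAux q { s with ok := (execOps ops (s.ok, S)).1 }
        (simStacks inp (execOps ops (s.ok, S)).2) := by
  induction ops generalizing s S with
  | nil => rfl
  | cons o l ih =>
    cases o <;> simp only [List.foldr_cons, opStmt, TM2.stepAux, execOps, StackOp.exec,
      update_simStacks_work, ih] <;> rfl

/-- The data of the simulation between two readings. -/
structure Sim (M : StackMachine Γ K A Q) where
  ctl : M.Ctl
  stk : K → List A

open Classical in
/-- The effect of a transition. -/
noncomputable def Sim.exec (c : M.Sim) (i : Fin M.edges.length) : M.Sim :=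
  let r := execOps M.edges[i].ops (c.ctl.ok && decide (M.edges[i].src = c.ctl.cur), c.stk)
  ⟨{ c.ctl with count := 0, ok := r.1, last := some i }, r.2⟩

open Classical in
/-- The effect of reading a symbol. -/
noncomputable def Sim.read (c : M.Sim) : Γ ⊕ Bool → M.Sim
  | .inl a => ⟨{ c.ctl with sym := some (.inl a) },
      update c.stk M.inStack (M.letter a :: c.stk M.inStack)⟩
  | .inr true => ⟨{ c.ctl with count := c.ctl.count + 1, sym := some (.inr true) }, c.stk⟩
  | .inr false =>
    if h : c.ctl.count.val < M.edges.length then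
      Sim.exec ⟨{ c.ctl with sym := some (.inr false) }, c.stk⟩ ⟨_, h⟩
    else ⟨{ c.ctl with count := 0, ok := false, sym := some (.inr false) }, c.stk⟩

theorem stepAux_dispatch_of_mem {l : List (Fin M.edges.length)} {s : M.Ctl}
    {i : Fin M.edges.length} (hi : i ∈ l) (hs : s.count = i.castSucc) (inp : List (Γ ⊕ Bool))
    (S : K → List A) :
    TM2.stepAux (dispatchStmt l) s (simStacks inp S) =
      ⟨some true, (Sim.exec ⟨s, S⟩ i).ctl, simStacks inp (Sim.exec ⟨s, S⟩ i).stk⟩ := by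
  classical
  induction l with
  | nil => simp at hi
  | cons j l ih =>
    simp only [dispatchStmt, TM2.stepAux]
    by_cases hj : s.count = j.castSucc
    · obtain rfl : i = j := Fin.castSucc_injective _ (hs.symm.trans hj)
      simp only [hj, decide_true, cond_true, edgeStmt, TM2.stepAux, stepAux_ops]
      rfl
    · simp only [hj, decide_false, cond_false]
      rcases List.mem_cons.1 hi with rfl | hi
      · exact absurd hs hj
      · exact ih hi

theorem stepAux_dispatch_of_notMem {l : List (Fin M.edges.length)} {s : M.Ctl}
    (hs : ∀ i ∈ l, s.count ≠ i.castSucc) (inp : List (Γ ⊕ Bool)) (S : K → List A) :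
    TM2.stepAux (dispatchStmt l) s (simStacks inp S) =
      ⟨some true, { s with count := 0, ok := false }, simStacks inp S⟩ := by
  classical
  induction l with
  | nil => simp [dispatchStmt]
  | cons j l ih =>
    simp only [List.mem_cons, forall_eq_or_imp] at hs
    simp only [dispatchStmt, TM2.stepAux, hs.1, decide_false, cond_false, ih hs.2]

theorem step_read [Fintype K] [Inhabited A] (c : M.Sim) (a : Γ ⊕ Bool)
    (inp : List (Γ ⊕ Bool)) :
    TM2.step M.simProgram ⟨some true, c.ctl, simStacks (a :: inp) c.stk⟩ =
      some ⟨some true, (c.read a).ctl, simStacks inp (c.read a).stk⟩ := by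
  classical
  rcases a with a | b
  · simp only [TM2.step, simProgram, if_true, readStmt, TM2.stepAux, update_simStacks_input]
    simp [simStacks, Sim.read, update_simStacks_work]
  · cases b
    · simp only [TM2.step, simProgram, if_true, readStmt, TM2.stepAux, update_simStacks_input]
      simp only [simStacks, List.head?_cons, List.tail_cons, Sim.read]
      simp only [reduceCtorEq, decide_false, cond_false, Option.some.injEq, Sum.inr.injEq,
        Bool.false_eq_true, decide_true, cond_true]
      split
      next h =>
        rw [stepAux_dispatch_of_mem (i := ⟨_, h⟩) (List.mem_finRange _) (by ext; rfl)]
      next h =>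
        rw [stepAux_dispatch_of_notMem]
        intro i _ e
        simp only [] at e
        exact h (by rw [e]; exact i.2)
    · simp only [TM2.step, simProgram, if_true, readStmt, TM2.stepAux, update_simStacks_input]
      simp [simStacks, Sim.read]

theorem step_read_nil [Fintype K] [Inhabited A] (c : M.Sim) :
    TM2.step M.simProgram ⟨some true, c.ctl, simStacks [] c.stk⟩ =
      some ⟨some false, { c.ctl with sym := none }, simStacks [] c.stk⟩ := by
  classical
  simp only [TM2.step, simProgram, if_true, readStmt, TM2.stepAux, update_simStacks_input]
  simp [simStacks]

/-- As the list has no repetitions, no stack is popped twice, and the flag can be read off from the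
stacks before the pass. -/
theorem stepAux_popAll (l : List K) (hl : l.Nodup) (q : M.SimStmt) (s : M.Ctl)
    (inp : List (Γ ⊕ Bool)) (S : K → List A) [DecidableEq K] :
    TM2.stepAux (popAllStmt l q) s (simStacks inp S) =
      TM2.stepAux q { s with dirty := s.dirty || l.any fun k => (S k).head?.isSome }
        (simStacks inp fun k => if k ∈ l then (S k).tail else S k) := by
  induction l generalizing s S with
  | nil => simp [popAllStmt]
  | cons k l ih =>
    rw [List.nodup_cons] at hl
    have ih' := ih hl.2
    simp only [popAllStmt] at ih'
    simp only [popAllStmt, List.foldr_cons, TM2.stepAux, update_simStacks_work, ih']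
    have h1 : (l.any fun j => (update S k (S k).tail j).head?.isSome) =
        l.any fun j => (S j).head?.isSome := by
      rw [Bool.eq_iff_iff]
      simp only [List.any_eq_true]
      refine exists_congr fun j => and_congr_right fun hj => ?_
      rw [update_of_ne]
      rintro rfl
      exact hl.1 hj
    have h2 : (fun j => if j ∈ l then (update S k (S k).tail j).tail else update S k (S k).tail j)
        = fun j => if j ∈ k :: l then (S j).tail else S j := by
      funext j
      by_cases hj : j = k
      · subst hj; simp [hl.1]
      · simp [hj]
    simp only [simStacks]
    rw [h1, h2]
    simp [Bool.or_assoc]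

theorem step_clear [Fintype K] [Inhabited A] (s : M.Ctl) (S : K → List A)
    (h : ∃ k, S k ≠ []) :
    TM2.step M.simProgram ⟨some false, s, simStacks [] S⟩ =
      some ⟨some false, { s with dirty := true }, simStacks [] fun k => (S k).tail⟩ := by
  classical
  simp only [TM2.step, simProgram, Bool.false_eq_true, if_false, clearStmt, TM2.stepAux]
  rw [stepAux_popAll _ (Finset.nodup_toList _)]
  have : ((Finset.univ : Finset K).toList.any fun k => (S k).head?.isSome) = true := by
    obtain ⟨k, hk⟩ := h
    rw [List.any_eq_true]
    refine ⟨k, by simp, ?_⟩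
    cases e : S k <;> simp_all
  simp [this, TM2.stepAux]

open Classical in
noncomputable def Ctl.output (s : M.Ctl) : Bool := s.ok && decide (s.cur = M.final)

theorem step_clear_nil [Fintype K] [Inhabited A] (s : M.Ctl) :
    TM2.step M.simProgram ⟨some false, s, simStacks [] fun _ => []⟩ =
      some ⟨none, M.initCtl, outStacks s.output⟩ := by
  classical
  simp only [TM2.step, simProgram, Bool.false_eq_true, if_false, clearStmt, TM2.stepAux]
  rw [stepAux_popAll _ (Finset.nodup_toList _)]
  have : ((Finset.univ : Finset K).toList.any fun _ => false) = false := by simp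
  simp only [TM2.stepAux, List.tail_nil, ite_self, List.head?_nil, Option.isSome_none, this,
    Bool.or_false, cond_false]
  rw [← update_simStacks_output]
  rfl

/-- Iterated steps of a deterministic machine. -/
def ReachesIn {C : Type} (f : C → Option C) (n : ℕ) (a b : C) : Prop :=
  (flip bind f)^[n] (some a) = some b

theorem ReachesIn.trans {C : Type} {f : C → Option C} {m n : ℕ} {a b c : C}
    (h : ReachesIn f m a b) (h' : ReachesIn f n b c) : ReachesIn f (n + m) a c := by
  unfold ReachesIn at *
  rw [Function.iterate_add_apply, h, h']

theorem ReachesIn.single {C : Type} {f : C → Option C} {a b : C} (h : f a = some b) :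
    ReachesIn f 1 a b := h

/-- A pass lowers all non-empty stacks together, so the maximal height bounds the number of passes;
one further pass finds the stacks empty and halts. -/
theorem reachesIn_clear [Fintype K] [Inhabited A] (n : ℕ) (s : M.Ctl) (S : K → List A)
    (hS : ∀ k, (S k).length ≤ n) :
    ∃ m ≤ n + 1, ReachesIn (TM2.step M.simProgram) m ⟨some false, s, simStacks [] S⟩
      ⟨none, M.initCtl, outStacks s.output⟩ := by
  induction n generalizing s S with
  | zero =>
    obtain rfl : S = fun _ => [] := by
      funext k
      simpa using hS k
    exact ⟨1, le_rfl, .single (step_clear_nil s)⟩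
  | succ n ih =>
    by_cases h : ∃ k, S k ≠ []
    · obtain ⟨m, hm, hr⟩ := ih { s with dirty := true } (fun k => (S k).tail) (fun k => by
        have := hS k
        simp; omega)
      exact ⟨m + 1, by omega, (ReachesIn.single (step_clear s S h)).trans hr⟩
    · obtain rfl : S = fun _ => [] := by
        funext k
        simpa using not_exists.1 h k
      exact ⟨1, by omega, .single (step_clear_nil s)⟩

theorem reachesIn_read [Fintype K] [Inhabited A] (inp : List (Γ ⊕ Bool)) (c : M.Sim) :
    ReachesIn (TM2.step M.simProgram) inp.length ⟨some true, c.ctl, simStacks inp c.stk⟩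
      ⟨some true, (inp.foldl Sim.read c).ctl, simStacks [] (inp.foldl Sim.read c).stk⟩ := by
  induction inp generalizing c with
  | nil => rfl
  | cons a l ih => exact (ReachesIn.single (step_read c a l)).trans (ih _)

variable (M) in
/-- A bound for the growth of the stacks in one transition. -/
def opBound : ℕ := (M.edges.map fun e => e.ops.length).sum + 1

theorem ops_length_le (i : Fin M.edges.length) : M.edges[i].ops.length + 1 ≤ M.opBound := by
  unfold opBound
  have : M.edges[i].ops.length ∈ M.edges.map fun e => e.ops.length :=
    List.mem_map.2 ⟨_, List.getElem_mem _, rfl⟩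
  have := List.single_le_sum (fun _ _ => Nat.zero_le _) _ this
  omega

theorem Sim.read_length (c : M.Sim) (a : Γ ⊕ Bool) (k : K) :
    ((c.read a).stk k).length ≤ (c.stk k).length + M.opBound := by
  classical
  rcases a with a | _ | _
  · simp only [Sim.read, update_apply]
    have : 1 ≤ M.opBound := by unfold opBound; omega
    split
    · subst_vars; simp; omega
    · omega
  · simp only [Sim.read]
    split
    next h =>
      have := execOps_length M.edges[c.ctl.count.val].ops
        (c.ctl.ok && decide (M.edges[c.ctl.count.val].src = c.ctl.cur)) c.stk k
      have h2 := ops_length_le ⟨_, h⟩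
      simp only [Fin.getElem_fin] at h2
      exact this.trans (by omega)
    · simp
  · simp [Sim.read]

theorem Sim.foldl_read_length (inp : List (Γ ⊕ Bool)) (c : M.Sim) (k : K) :
    ((inp.foldl Sim.read c).stk k).length ≤ (c.stk k).length + inp.length * M.opBound := by
  induction inp generalizing c with
  | nil => simp
  | cons a l ih =>
    have h1 := ih (c.read a)
    have h2 := c.read_length a k
    simp only [List.foldl_cons, List.length_cons]
    rw [Nat.add_mul]
    omega

variable (M) in
noncomputable def initSim : M.Sim := ⟨M.initCtl, fun _ => []⟩

variable (M) in
/-- The outcome of the simulation. -/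
noncomputable def verify (p : List Γ × List Bool) : Bool :=
  ((pairEncode p).foldl Sim.read M.initSim).ctl.output

theorem initList_simulator [Fintype Γ] [Fintype K] [Inhabited A] (inp : List (Γ ⊕ Bool)) :
    initList M.simulator inp = ⟨some true, M.initCtl, simStacks inp fun _ => []⟩ := by
  simp only [initList]
  congr 1
  funext k
  rcases k with _ | _ | k
  · exact dif_pos rfl
  · exact dif_neg (by rintro ⟨⟩)
  · exact dif_neg (by rintro ⟨⟩)

theorem haltList_simulator [Fintype Γ] [Fintype K] [Inhabited A] (b : Bool) :
    haltList M.simulator [b] = ⟨none, M.initCtl, outStacks b⟩ := by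
  simp only [haltList]
  congr 1
  funext k
  rcases k with _ | _ | k
  · exact dif_neg (by rintro ⟨⟩)
  · exact dif_pos rfl
  · exact dif_neg (by rintro ⟨⟩)

/-- For `N` input symbols, reading takes `N` steps, the change to clearing one step, and clearing at
most `N * M.opBound + 1`. The time is linear in `N`. -/
theorem verify_polyTime [Fintype Γ] [Fintype K] [Inhabited A] :
    Nonempty (TM2ComputableInPolyTime pairEncode Computability.encodeBool M.verify) := by
  have key : ∀ p : List Γ × List Bool, ∃ m ≤ (pairEncode p).length * (M.opBound + 1) + 2,
      ReachesIn (TM2.step M.simProgram)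
        m ⟨some true, M.initCtl, simStacks (pairEncode p) fun _ => []⟩
        ⟨none, M.initCtl, outStacks (M.verify p)⟩ := by
    intro p
    obtain ⟨m, hm, h⟩ := reachesIn_clear ((pairEncode p).length * M.opBound)
      { ((pairEncode p).foldl Sim.read M.initSim).ctl with sym := none }
      ((pairEncode p).foldl Sim.read M.initSim).stk
      (fun k => by simpa [initSim] using Sim.foldl_read_length (pairEncode p) M.initSim k)
    refine ⟨m + (1 + (pairEncode p).length), by rw [Nat.mul_add]; omega, ?_⟩
    exact ((reachesIn_read (pairEncode p) M.initSim).trans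
      (ReachesIn.single (step_read_nil _))).trans h
  choose m hm h using key
  exact ⟨{
    tm := M.simulator
    inputAlphabet := Equiv.refl _
    outputAlphabet := Equiv.refl _
    time := Polynomial.X * Polynomial.C (M.opBound + 1) + Polynomial.C 2
    outputsFun := fun p =>
      { steps := m p
        evals_in_steps := by
          have h1 : List.map (Equiv.refl (Γ ⊕ Bool)).invFun (pairEncode p) = pairEncode p :=
            List.map_id _
          erw [h1, initList_simulator, Option.map_some, haltList_simulator]
          exact h p
        steps_le_m := by simpa using hm p } }⟩

/-! ### Correctness of the simulation -/

/-- Pushing reverses the word, which is why the initial stacks hold it reversed. The last symbol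
read is left unspecified because every further reading overwrites it. -/
theorem foldl_read_input (x : List Γ) (c : M.Sim) :
    ∃ sym, (x.map Sum.inl).foldl Sim.read c =
      ⟨{ c.ctl with sym := sym }, by
        classical exact update c.stk M.inStack (x.reverse.map M.letter ++ c.stk M.inStack)⟩ := by
  classical
  induction x generalizing c with
  | nil => exact ⟨c.ctl.sym, by simp⟩
  | cons a x ih =>
    obtain ⟨sym, h⟩ := ih (c.read (.inl a))
    refine ⟨sym, ?_⟩
    rw [List.map_cons, List.foldl_cons, h]
    simp [Sim.read]

theorem verify_eq (x : List Γ) (w : List Bool) :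
    ∃ sym, M.verify (x, w) = ((w.map Sum.inr).foldl Sim.read
      (⟨{ M.initCtl with sym := sym }, M.initStacks x⟩ : M.Sim)).ctl.output := by
  obtain ⟨sym, h⟩ := foldl_read_input x M.initSim
  refine ⟨sym, ?_⟩
  simp only [verify, pairEncode, List.foldl_append, h]
  simp [initSim, initStacks]

theorem Run.snoc {n : ℕ} {a b c : Q × (K → List A)} (h : M.Run n a b) (h' : M.Step b c) :
    M.Run (n + 1) a c := h.trans (.single h')

/-- The certificate is arbitrary here. As long as the flag is set, the stored configuration is
reachable; a cleared flag stays cleared. Acceptance therefore yields a genuine run. -/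
theorem exists_run_of_foldl_read (x : List Γ) (w : List Bool) (c : M.Sim)
    (hc : c.ctl.ok = true → ∃ n, M.Run n (M.start, M.initStacks x) (c.ctl.cur, c.stk))
    (h : ((w.map Sum.inr).foldl Sim.read c).ctl.output = true) : ∃ n, M.AcceptsIn x n := by
  classical
  induction w generalizing c with
  | nil =>
    simp only [List.map_nil, List.foldl_nil, Ctl.output, Bool.and_eq_true, decide_eq_true_eq] at h
    obtain ⟨n, hn⟩ := hc h.1
    exact ⟨n, c.stk, h.2 ▸ hn⟩
  | cons b w ih =>
    refine ih (c.read (.inr b)) ?_ (by simpa using h)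
    cases b
    · intro hok
      simp only [Sim.read] at hok ⊢
      split at hok
      next hlt =>
        rw [dif_pos hlt]
        simp only [Sim.exec] at hok ⊢
        cases hb : (c.ctl.ok && decide (M.edges[(⟨_, hlt⟩ : Fin M.edges.length)].src =
            Ctl.cur ({ c.ctl with sym := some (.inr false) } : M.Ctl)))
        · rw [hb, execOps_false] at hok
          cases hok
        · rw [hb] at hok
          simp only [Bool.and_eq_true, decide_eq_true_eq] at hb
          obtain ⟨n, hn⟩ := hc hb.1
          refine ⟨n + 1, hn.snoc ⟨M.edges[c.ctl.count.val], List.getElem_mem _, hb.2, rfl, ?_⟩⟩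
          simp only [Fin.getElem_fin] at hok ⊢
          simp only [Fin.getElem_fin] at hb
          rw [Prod.ext_iff]
          exact ⟨hok, rfl⟩
      · simp at hok
    · exact hc

theorem Sim.foldl_ones (n : ℕ) (hn : n < M.edges.length + 1) (c : M.Sim) (h0 : c.ctl.count = 0) :
    ∃ sym, ((List.replicate n true).map Sum.inr).foldl Sim.read c =
      ⟨{ c.ctl with count := ⟨n, hn⟩, sym := sym }, c.stk⟩ := by
  induction n with
  | zero => exact ⟨c.ctl.sym, by rw [← Fin.zero_eta] at h0; rw [← h0]; simp⟩
  | succ n ih =>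
    obtain ⟨sym, h⟩ := ih (by omega)
    refine ⟨some (.inr true), ?_⟩
    rw [List.replicate_succ', List.map_append, List.foldl_append, h]
    simp only [List.map_cons, List.map_nil, List.foldl_cons, List.foldl_nil, Sim.read]
    congr 2
    ext
    simp [Fin.val_add, Nat.mod_eq_of_lt hn]

theorem Sim.read_zero (c : M.Sim) (i : Fin M.edges.length) (h : c.ctl.count = i.castSucc) :
    c.read (.inr false) = Sim.exec ⟨{ c.ctl with sym := some (.inr false) }, c.stk⟩ i := by
  have h' : c.ctl.count.val < M.edges.length := by rw [h]; exact i.2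
  have hi : (⟨_, h'⟩ : Fin M.edges.length) = i := by ext; simp [h]
  simp only [Sim.read]
  rw [dif_pos h', hi]

/-- Each transition of the run is written as its index in unary followed by a zero, which takes at
most `M.edges.length` bits. -/
theorem exists_certificate_of_run {n : ℕ} {a b : Q × (K → List A)} (h : M.Run n a b)
    (hb : b.1 = M.final) (c : M.Sim) (hc : c.ctl.ok = true) (h0 : c.ctl.count = 0)
    (ha : a = (c.ctl.cur, c.stk)) :
    ∃ w : List Bool, w.length ≤ n * (M.edges.length + 1) ∧
      ((w.map Sum.inr).foldl Sim.read c).ctl.output = true := by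
  classical
  induction h generalizing c with
  | refl d =>
    subst ha
    exact ⟨[], by simp, by simpa [Ctl.output, hc] using hb⟩
  | @head n d d' d'' hs _ ih =>
    subst ha
    obtain ⟨e, he, h1, h2, h3⟩ := hs
    obtain ⟨i, hi, rfl⟩ := List.mem_iff_getElem.1 he
    obtain ⟨sym, hr⟩ := Sim.foldl_ones i (by omega) c h0
    obtain ⟨c', hc'⟩ : ∃ c' : M.Sim,
        c' = ⟨{ c.ctl with count := ⟨i, by omega⟩, sym := sym }, c.stk⟩ := ⟨_, rfl⟩
    have hx : c'.read (.inr false) =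
        ⟨{ c'.ctl with count := 0, ok := true, last := some ⟨i, hi⟩, sym := some (.inr false) },
          d'.2⟩ := by
      rw [Sim.read_zero c' ⟨i, hi⟩ (by rw [hc']; rfl)]
      have hs : decide (M.edges[(⟨i, hi⟩ : Fin M.edges.length)].src =
          Ctl.cur ({ c'.ctl with sym := some (.inr false) } : M.Ctl)) = true := by
        rw [hc']
        exact decide_eq_true h1
      have hk : c'.ctl.ok = true := by rw [hc']; exact hc
      have h3' : execOps M.edges[(⟨i, hi⟩ : Fin M.edges.length)].ops (true, c'.stk) =
          (true, d'.2) := by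
        rw [hc']
        exact h3
      have hx : execOps M.edges[(⟨i, hi⟩ : Fin M.edges.length)].ops
          (c'.ctl.ok && decide (M.edges[(⟨i, hi⟩ : Fin M.edges.length)].src =
            Ctl.cur ({ c'.ctl with sym := some (.inr false) } : M.Ctl)), c'.stk) =
          (true, d'.2) := by
        rw [hs, hk, Bool.and_true, h3']
      unfold Sim.exec
      dsimp only at hx ⊢
      rw [hx]
    obtain ⟨w, hw, hw'⟩ := ih hb (c'.read (.inr false)) (by rw [hx]) (by rw [hx])
      (by rw [hx]; exact Prod.ext h2.symm rfl)
    refine ⟨List.replicate i true ++ false :: w, ?_, ?_⟩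
    · simp only [List.length_append, List.length_replicate, List.length_cons]
      rw [Nat.add_mul]
      omega
    · rw [List.map_append, List.foldl_append, hr, ← hc']
      exact hw'

variable (M) in
/-- A language accepted by a nondeterministic multi-stack machine with runs of polynomial length
is in NP. -/
theorem inNP [Fintype Γ] [Fintype K] [Inhabited A] (L : Set (List Γ)) (p : Polynomial ℕ)
    (sound : ∀ x n, M.AcceptsIn x n → x ∈ L)
    (complete : ∀ x ∈ L, ∃ n ≤ p.eval x.length, M.AcceptsIn x n) : InNP L := by
  refine ⟨p * Polynomial.C (M.edges.length + 1), M.verify, verify_polyTime, fun x => ⟨?_, ?_⟩⟩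
  · intro hx
    obtain ⟨n, hn, S, hS⟩ := complete x hx
    obtain ⟨sym, hv⟩ := foldl_read_input x M.initSim
    obtain ⟨w, hw, hw'⟩ := exists_certificate_of_run hS rfl
      (⟨{ M.initCtl with sym := sym }, M.initStacks x⟩ : M.Sim) rfl rfl rfl
    refine ⟨w, ?_, ?_⟩
    · simp only [Polynomial.eval_mul, Polynomial.eval_C]
      exact hw.trans (Nat.mul_le_mul_right _ hn)
    · simp only [verify, pairEncode, List.foldl_append, hv]
      simpa [initSim, initStacks] using hw'
  · rintro ⟨w, -, hw⟩
    obtain ⟨sym, h⟩ := verify_eq (M := M) x w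
    rw [h] at hw
    obtain ⟨n, hn⟩ := exists_run_of_foldl_read x w _ (fun _ => ⟨0, .refl _⟩) hw
    exact sound x n hn

end StackMachine

end

end Complexity

/-! ### Horn clauses over words -/

namespace Horn

open Complexity Function

/-- A symbol of a word pattern. -/
inductive PSym (Γ : Type) (v : ℕ) where
  | ch (a : Γ)
  | var (i : Fin v)

/-- A pattern for the arguments of a predicate. -/
structure Atom (P Γ : Type) (v : ℕ) where
  pred : P
  args : List (List (PSym Γ v))

/-- A Horn clause. -/
structure Rule (P Γ : Type) (v : ℕ) where
  head : Atom P Γ v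
  body : List (Atom P Γ v)

/-- A predicate applied to words. -/
abbrev Fact (P Γ : Type) := P × List (List Γ)

section

variable {P Γ : Type} {v : ℕ}

def PSym.inst (σ : Fin v → List Γ) : PSym Γ v → List Γ
  | .ch a => [a]
  | .var i => σ i

/-- The separate case of a single symbol avoids a trailing `++ []`. Instances of concrete clauses
are then definitionally the intended words, on which many soundness and completeness proofs rely. -/
def instPat (σ : Fin v → List Γ) : List (PSym Γ v) → List Γ
  | [] => []
  | [s] => s.inst σ
  | s :: t :: p => s.inst σ ++ instPat σ (t :: p)

theorem instPat_cons (σ : Fin v → List Γ) (s : PSym Γ v) (p : List (PSym Γ v)) :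
    instPat σ (s :: p) = s.inst σ ++ instPat σ p := by
  cases p <;> simp [instPat]

def Atom.inst (σ : Fin v → List Γ) (a : Atom P Γ v) : Fact P Γ :=
  (a.pred, a.args.map (instPat σ))

/-- The goals can be reduced to nothing by `n` applications of the rules, under substitutions by
words of length at most `ℓ`. -/
inductive Ders (rules : List (Rule P Γ v)) (ℓ : ℕ) : ℕ → List (Fact P Γ) → Prop
  | nil : Ders rules ℓ 0 []
  | cons {n : ℕ} {r : Rule P Γ v} {gs : List (Fact P Γ)} (hr : r ∈ rules) (σ : Fin v → List Γ)
      (hσ : ∀ i, (σ i).length ≤ ℓ) (h : Ders rules ℓ n (r.body.map (Atom.inst σ) ++ gs)) :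
      Ders rules ℓ (n + 1) (r.head.inst σ :: gs)

variable {rules : List (Rule P Γ v)}

/-- Goals are processed in order, as on a stack, so the derivations of two lists run one after the
other and their step counts add up. -/
theorem Ders.append {ℓ m n : ℕ} {as bs : List (Fact P Γ)} (ha : Ders rules ℓ m as)
    (hb : Ders rules ℓ n bs) : Ders rules ℓ (m + n) (as ++ bs) := by
  induction ha with
  | nil => simpa using hb
  | cons hr σ hσ _ ih =>
    rw [Nat.add_right_comm, List.cons_append]
    exact .cons hr σ hσ (by simpa using ih)

theorem Ders.mono {ℓ ℓ' n : ℕ} {as : List (Fact P Γ)} (h : Ders rules ℓ n as) (hl : ℓ ≤ ℓ') :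
    Ders rules ℓ' n as := by
  induction h with
  | nil => exact .nil
  | cons hr σ hσ _ ih => exact .cons hr σ (fun i => (hσ i).trans hl) ih

/-- A property of facts that all rules preserve holds for all derivable facts. -/
theorem Ders.sound {I : Fact P Γ → Prop}
    (hI : ∀ r ∈ rules, ∀ σ, (∀ a ∈ r.body, I (a.inst σ)) → I (r.head.inst σ)) {ℓ n : ℕ}
    {gs : List (Fact P Γ)} (h : Ders rules ℓ n gs) : ∀ g ∈ gs, I g := by
  induction h with
  | nil => simp
  | @cons n r gs hr σ hσ _ ih =>
    intro g hg
    rcases List.mem_cons.1 hg with rfl | hg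
    · exact hI r hr σ fun a ha => ih _ (List.mem_append_left _ (List.mem_map_of_mem ha))
    · exact ih _ (List.mem_append_right _ hg)

/-! ### Goals as words -/

/-- The alphabet of the goal stack. -/
inductive GoalSym (P Γ : Type) where
  | pred (p : P)
  | letter (a : Γ)
  | sep
  | bottom

def encArgs : List (List Γ) → List (GoalSym P Γ)
  | [] => [.bottom]
  | w :: l => w.map .letter ++ .sep :: encArgs l

def encFact (f : Fact P Γ) : List (GoalSym P Γ) := .pred f.1 :: encArgs f.2

def encFacts : List (Fact P Γ) → List (GoalSym P Γ)
  | [] => []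
  | f :: l => encFact f ++ encFacts l

theorem map_letter_sep_inj {w w' : List Γ} {s t : List (GoalSym P Γ)}
    (h : w.map .letter ++ .sep :: s = w'.map .letter ++ .sep :: t) : w = w' ∧ s = t := by
  induction w generalizing w' with
  | nil => cases w' <;> simp_all
  | cons a w ih =>
    cases w' with
    | nil => simp at h
    | cons b w' =>
      simp only [List.map_cons, List.cons_append, List.cons.injEq, GoalSym.letter.injEq] at h
      obtain ⟨rfl, rfl⟩ := ih h.2
      simp [h.1]

theorem encArgs_inj {as bs : List (List Γ)} {s t : List (GoalSym P Γ)}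
    (h : encArgs as ++ s = encArgs bs ++ t) : as = bs ∧ s = t := by
  induction as generalizing bs with
  | nil =>
    rcases bs with _ | ⟨w, bs⟩
    · simpa [encArgs] using h
    · cases w <;> simp [encArgs] at h
  | cons u as ih =>
    rcases bs with _ | ⟨w, bs⟩
    · cases u <;> simp [encArgs] at h
    · simp only [encArgs, List.append_assoc, List.cons_append] at h
      obtain ⟨rfl, h'⟩ := map_letter_sep_inj h
      obtain ⟨rfl, rfl⟩ := ih h'
      exact ⟨rfl, rfl⟩

theorem encFact_inj {f g : Fact P Γ} {s t : List (GoalSym P Γ)}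
    (h : encFact f ++ s = encFact g ++ t) : f = g ∧ s = t := by
  simp only [encFact, List.cons_append, List.cons.injEq, GoalSym.pred.injEq] at h
  obtain ⟨h', rfl⟩ := encArgs_inj h.2
  exact ⟨Prod.ext h.1 h', rfl⟩

/-- Facts delimit themselves on the goal stack: a prefix that codes whole facts ends where a fact of
the stack ends. This recovers the remaining goals after the body of a rule. -/
theorem exists_of_encFacts_append {as gs : List (Fact P Γ)} {G : List (GoalSym P Γ)}
    (h : encFacts as ++ G = encFacts gs) : ∃ bs, G = encFacts bs ∧ gs = as ++ bs := by
  induction as generalizing gs with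
  | nil => exact ⟨gs, h, rfl⟩
  | cons a as ih =>
    rcases gs with _ | ⟨g, gs⟩
    · simp [encFacts, encFact] at h
    · simp only [encFacts, List.append_assoc] at h
      obtain ⟨rfl, h'⟩ := encFact_inj h
      obtain ⟨bs, rfl, rfl⟩ := ih h'
      exact ⟨bs, rfl, rfl⟩

theorem encFacts_eq_single {gs : List (Fact P Γ)} {g : Fact P Γ}
    (h : encFacts gs = encFact g) : gs = [g] := by
  obtain ⟨bs, h, rfl⟩ := exists_of_encFacts_append (as := [g]) (G := []) (gs := gs)
    (by simpa [encFacts] using h.symm)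
  rcases bs with _ | ⟨b, bs⟩
  · rfl
  · simp [encFacts, encFact] at h

/-- A symbol of a goal pattern: a symbol of the goal stack or a variable. -/
abbrev GPat (P Γ : Type) (v : ℕ) := List (GoalSym P Γ ⊕ Fin v)

def patSym : PSym Γ v → GoalSym P Γ ⊕ Fin v
  | .ch a => .inl (.letter a)
  | .var i => .inr i

def patArgs : List (List (PSym Γ v)) → GPat P Γ v
  | [] => [.inl .bottom]
  | p :: l => p.map patSym ++ .inl .sep :: patArgs l

def patAtom (a : Atom P Γ v) : GPat P Γ v := .inl (.pred a.pred) :: patArgs a.args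

def patAtoms : List (Atom P Γ v) → GPat P Γ v
  | [] => []
  | a :: l => patAtom a ++ patAtoms l

def instG (σ : Fin v → List Γ) : GPat P Γ v → List (GoalSym P Γ)
  | [] => []
  | .inl s :: p => s :: instG σ p
  | .inr i :: p => (σ i).map .letter ++ instG σ p

theorem instG_append (σ : Fin v → List Γ) (p q : GPat P Γ v) :
    instG σ (p ++ q) = instG σ p ++ instG σ q := by
  induction p with
  | nil => rfl
  | cons s p ih => rcases s with s | i <;> simp [instG, ih]

theorem instG_map_patSym (σ : Fin v → List Γ) (p : List (PSym Γ v)) :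
    instG (P := P) σ (p.map patSym) = (instPat σ p).map .letter := by
  induction p with
  | nil => rfl
  | cons s p ih => cases s <;> simp [patSym, instG, instPat_cons, PSym.inst, ih]

theorem instG_patArgs (σ : Fin v → List Γ) (l : List (List (PSym Γ v))) :
    instG (P := P) σ (patArgs l) = encArgs (l.map (instPat σ)) := by
  induction l with
  | nil => rfl
  | cons p l ih => simp [patArgs, instG_append, instG_map_patSym, instG, encArgs, ih]

theorem instG_patAtom (σ : Fin v → List Γ) (a : Atom P Γ v) :
    instG σ (patAtom a) = encFact (a.inst σ) := by
  simp [patAtom, instG, instG_patArgs, encFact, Atom.inst]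

theorem instG_patAtoms (σ : Fin v → List Γ) (l : List (Atom P Γ v)) :
    instG σ (patAtoms l) = encFacts (l.map (Atom.inst σ)) := by
  induction l with
  | nil => rfl
  | cons a l ih => simp [patAtoms, instG_append, instG_patAtom, encFacts, ih]

theorem encFacts_append (as bs : List (Fact P Γ)) :
    encFacts (as ++ bs) = encFacts as ++ encFacts bs := by
  induction as with
  | nil => rfl
  | cons a as ih => simp [encFacts, ih]

/-! ### Programs that apply a rule to the goal stack -/

/-- Instructions: guess a variable, match or produce a symbol or a variable on the goal stack. -/
inductive Instr (P Γ : Type) (v : ℕ) where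
  | guess (i : Fin v)
  | popSym (s : GoalSym P Γ)
  | popVar (i : Fin v)
  | pushSym (s : GoalSym P Γ)
  | pushVar (i : Fin v)

def popInstr : GoalSym P Γ ⊕ Fin v → Instr P Γ v
  | .inl s => .popSym s
  | .inr i => .popVar i

def pushInstr : GoalSym P Γ ⊕ Fin v → Instr P Γ v
  | .inl s => .pushSym s
  | .inr i => .pushVar i

/-- The program that applies a rule. -/
def ruleProg (r : Rule P Γ v) : List (Instr P Γ v) :=
  (List.finRange v).map .guess ++
    ((patAtom r.head).map popInstr ++ (patAtoms r.body).reverse.map pushInstr)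

/-- The program can end with a goal stack in `R`. -/
def Ends (R : List (GoalSym P Γ) → Prop) : List (Instr P Γ v) → (Fin v → List Γ) →
    List (GoalSym P Γ) → Prop
  | [], _, G => R G
  | .guess i :: p, σ, G => ∃ w, Ends R p (update σ i w) G
  | .popSym s :: p, σ, G => ∃ G', G = s :: G' ∧ Ends R p σ G'
  | .popVar i :: p, σ, G => ∃ G', G = (σ i).map .letter ++ G' ∧ Ends R p σ G'
  | .pushSym s :: p, σ, G => Ends R p σ (s :: G)
  | .pushVar i :: p, σ, G => Ends R p σ ((σ i).map .letter ++ G)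

variable {R : List (GoalSym P Γ) → Prop}

theorem Ends.of_guess {l : List (Fin v)} {p : List (Instr P Γ v)} {σ : Fin v → List Γ}
    {G : List (GoalSym P Γ)} (h : Ends R (l.map .guess ++ p) σ G) : ∃ σ', Ends R p σ' G := by
  induction l generalizing σ with
  | nil => exact ⟨σ, h⟩
  | cons i l ih =>
    obtain ⟨w, h⟩ := h
    exact ih h

theorem Ends.of_pop {q : GPat P Γ v} {p : List (Instr P Γ v)} {σ : Fin v → List Γ}
    {G : List (GoalSym P Γ)} (h : Ends R (q.map popInstr ++ p) σ G) :
    ∃ G', G = instG σ q ++ G' ∧ Ends R p σ G' := by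
  induction q generalizing G with
  | nil => exact ⟨G, rfl, h⟩
  | cons s q ih =>
    rcases s with s | i
    · obtain ⟨G₁, rfl, h₁⟩ := h
      obtain ⟨G₂, rfl, h₂⟩ := ih h₁
      exact ⟨G₂, rfl, h₂⟩
    · obtain ⟨G₁, rfl, h₁⟩ := h
      obtain ⟨G₂, rfl, h₂⟩ := ih h₁
      exact ⟨G₂, by simp [instG], h₂⟩

/-- The pattern is pushed from its last symbol on, so it appears in its own order on top of the
stack. -/
theorem Ends.of_push {q : GPat P Γ v} {p : List (Instr P Γ v)} {σ : Fin v → List Γ}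
    {G : List (GoalSym P Γ)} (h : Ends R (q.reverse.map pushInstr ++ p) σ G) :
    Ends R p σ (instG σ q ++ G) := by
  induction q generalizing p with
  | nil => exact h
  | cons s q ih =>
    rw [List.reverse_cons, List.map_append, List.append_assoc] at h
    have := ih h
    rcases s with s | i
    · exact this
    · simpa [instG, Ends, pushInstr] using this

/-- A complete run of the program is a resolution step whose substitution consists of the guessed
values. -/
theorem Ends.of_ruleProg {r : Rule P Γ v} {σ : Fin v → List Γ} {G : List (GoalSym P Γ)}
    (h : Ends R (ruleProg r) σ G) :
    ∃ σ' G', G = encFact (r.head.inst σ') ++ G' ∧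
      R (encFacts (r.body.map (Atom.inst σ')) ++ G') := by
  obtain ⟨σ', h₁⟩ := Ends.of_guess h
  obtain ⟨G', rfl, h₂⟩ := Ends.of_pop h₁
  refine ⟨σ', G', by rw [instG_patAtom], ?_⟩
  rw [← List.append_nil (List.map pushInstr _)] at h₂
  have := Ends.of_push h₂
  rwa [instG_patAtoms] at this

/-! ### The machine -/

inductive EngineStack (v : ℕ) where
  | goal
  | tmp
  | inp
  | var (i : Fin v)

def EngineStack.equiv : EngineStack v ≃ Fin 3 ⊕ Fin v where
  toFun
    | .goal => .inl 0
    | .tmp => .inl 1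
    | .inp => .inl 2
    | .var i => .inr i
  invFun
    | .inl 0 => .goal
    | .inl 1 => .tmp
    | .inl 2 => .inp
    | .inr i => .var i
  left_inv s := by cases s <;> rfl
  right_inv s := by
    rcases s with s | _
    · fin_cases s <;> rfl
    · rfl

noncomputable instance : Fintype (EngineStack v) := Fintype.ofEquiv _ EngineStack.equiv.symm

/-- States of the machine; a program and the phase of its first instruction. -/
inductive EngineState (P Γ : Type) (v : ℕ) where
  | start
  | load
  | run (p : List (Instr P Γ v)) (phase : Bool)
  | done

abbrev EngineEdge (P Γ : Type) (v : ℕ) :=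
  Transition (EngineStack v) (GoalSym P Γ) (EngineState P Γ v)

open StackOp EngineStack in
/-- The transitions that execute the first instruction of a program. -/
def instrEdges (letters : List Γ) : List (Instr P Γ v) → List (EngineEdge P Γ v)
  | [] => []
  | .guess i :: p =>
    ⟨.run (.guess i :: p) false, [], .run p false⟩ :: letters.flatMap fun a =>
      [⟨.run (.guess i :: p) false, [push (var i) (.letter a)], .run (.guess i :: p) false⟩,
        ⟨.run (.guess i :: p) false, [pop (var i) (.letter a)], .run (.guess i :: p) false⟩]
  | .popSym s :: p => [⟨.run (.popSym s :: p) false, [pop goal s], .run p false⟩]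
  | .popVar i :: p =>
    ⟨.run (.popVar i :: p) false, [empty (var i)], .run (.popVar i :: p) true⟩ ::
    ⟨.run (.popVar i :: p) true, [empty tmp], .run p false⟩ :: letters.flatMap fun a =>
      [⟨.run (.popVar i :: p) false,
        [pop (var i) (.letter a), pop goal (.letter a), push tmp (.letter a)],
        .run (.popVar i :: p) false⟩,
      ⟨.run (.popVar i :: p) true, [pop tmp (.letter a), push (var i) (.letter a)],
        .run (.popVar i :: p) true⟩]
  | .pushSym s :: p => [⟨.run (.pushSym s :: p) false, [push goal s], .run p false⟩]
  | .pushVar i :: p =>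
    ⟨.run (.pushVar i :: p) false, [empty (var i)], .run (.pushVar i :: p) true⟩ ::
    ⟨.run (.pushVar i :: p) true, [empty tmp], .run p false⟩ :: letters.flatMap fun a =>
      [⟨.run (.pushVar i :: p) false, [pop (var i) (.letter a), push tmp (.letter a)],
        .run (.pushVar i :: p) false⟩,
      ⟨.run (.pushVar i :: p) true,
        [pop tmp (.letter a), push (var i) (.letter a), push goal (.letter a)],
        .run (.pushVar i :: p) true⟩]

open StackOp EngineStack in
/-- The machine that derives the goal `top(x)` from the input `x`. -/
def engine (rules : List (Rule P Γ v)) (top : P) (letters : List Γ) :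
    StackMachine Γ (EngineStack v) (GoalSym P Γ) (EngineState P Γ v) where
  edges :=
    [⟨.start, [push goal .bottom, push goal .sep], .load⟩,
      ⟨.load, [empty inp, push goal (.pred top)], .run [] false⟩,
      ⟨.run [] false, [empty goal], .done⟩] ++
    ((letters.map fun a => ⟨.load, [pop inp (.letter a), push goal (.letter a)], .load⟩) ++
    ((rules.map fun r => ⟨.run [] false, [], .run (ruleProg r) false⟩) ++
    rules.flatMap fun r => (ruleProg r).tails.flatMap (instrEdges letters)))
  start := .start
  final := .done
  inStack := .inp
  letter := .letter

/-- The stacks of the machine. -/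
def mkStacks (σ : Fin v → List Γ) (t : List Γ) (x : List Γ) (G : List (GoalSym P Γ)) :
    EngineStack v → List (GoalSym P Γ)
  | .goal => G
  | .tmp => t.map .letter
  | .inp => x.map .letter
  | .var i => (σ i).map .letter

/-! ### Operations on the stacks of the machine -/

section

variable [DecidableEq (EngineStack v)] (σ : Fin v → List Γ) (t x w : List Γ)
  (G G' : List (GoalSym P Γ)) (i : Fin v)

theorem update_mkStacks_goal : update (mkStacks σ t x G) .goal G' = mkStacks σ t x G' := by
  funext k
  cases k <;> simp [mkStacks]

theorem update_mkStacks_tmp :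
    update (mkStacks σ t x G) .tmp (w.map .letter) = mkStacks σ w x G := by
  funext k
  cases k <;> simp [mkStacks]

theorem update_mkStacks_inp :
    update (mkStacks σ t x G) .inp (w.map .letter) = mkStacks σ t w G := by
  funext k
  cases k <;> simp [mkStacks]

theorem update_mkStacks_var :
    update (mkStacks σ t x G) (.var i) (w.map .letter) = mkStacks (update σ i w) t x G := by
  funext k
  cases k with
  | var j =>
    by_cases h : j = i
    · subst h; simp [mkStacks]
    · rw [update_of_ne (by simpa using h)]
      simp [mkStacks, h]
  | _ => simp [mkStacks]

end

section

variable (b : Bool) (a : Γ) (s : GoalSym P Γ) (σ : Fin v → List Γ) (t x w : List Γ)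
  (G : List (GoalSym P Γ)) (i : Fin v)

open Classical in
theorem exec_push_goal :
    (StackOp.push .goal s).exec (b, mkStacks σ t x G) = (b, mkStacks σ t x (s :: G)) := by
  simp only [StackOp.exec, update_mkStacks_goal]
  rfl

theorem exec_push_tmp : (StackOp.push .tmp (.letter a)).exec (b, mkStacks σ t x G) =
    (b, mkStacks σ (a :: t) x G) := by
  classical
  simp only [StackOp.exec]
  exact Prod.ext rfl (update_mkStacks_tmp σ t x (a :: t) G)

theorem exec_push_var : (StackOp.push (.var i) (.letter a)).exec (b, mkStacks σ t x G) =
    (b, mkStacks (update σ i (a :: σ i)) t x G) := by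
  classical
  simp only [StackOp.exec]
  exact Prod.ext rfl (update_mkStacks_var σ t x (a :: σ i) G i)

theorem exec_pop_goal :
    (StackOp.pop .goal s).exec (b, mkStacks σ t x (s :: G)) = (b, mkStacks σ t x G) := by
  classical
  simp [StackOp.exec, update_mkStacks_goal, mkStacks]

theorem exec_pop_tmp : (StackOp.pop .tmp (.letter a)).exec (b, mkStacks σ (a :: t) x G) =
    (b, mkStacks σ t x G) := by
  classical
  simp only [StackOp.exec]
  refine Prod.ext ?_ (update_mkStacks_tmp σ _ x t G)
  simp [mkStacks]

theorem exec_pop_inp : (StackOp.pop .inp (.letter a)).exec (b, mkStacks σ t (a :: x) G) =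
    (b, mkStacks σ t x G) := by
  classical
  simp only [StackOp.exec]
  refine Prod.ext ?_ (update_mkStacks_inp σ t _ x G)
  simp [mkStacks]

theorem exec_pop_var (h : σ i = a :: w) :
    (StackOp.pop (.var i) (.letter a)).exec (b, mkStacks σ t x G) =
      (b, mkStacks (update σ i w) t x G) := by
  classical
  simp only [StackOp.exec]
  refine Prod.ext ?_ ?_
  · simp [mkStacks, h]
  · rw [← update_mkStacks_var]
    simp [mkStacks, h]

end

/-- Executing a list of operations from given stacks succeeds only if the first one does. -/
theorem execOps_cons_true {K A : Type} {o : StackOp K A} {l : List (StackOp K A)}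
    {S S' : K → List A} (h : execOps (o :: l) (true, S) = (true, S')) :
    ∃ S₁, o.exec (true, S) = (true, S₁) ∧ execOps l (true, S₁) = (true, S') := by
  rw [execOps] at h
  rcases he : o.exec (true, S) with ⟨b, S₁⟩
  rw [he] at h
  cases b
  · have := execOps_false l S₁
    rw [h] at this
    simp at this
  · exact ⟨S₁, rfl, h⟩

theorem head?_of_pop {K A : Type} {k : K} {a : A} {S S' : K → List A}
    (h : (StackOp.pop k a).exec (true, S) = (true, S')) : (S k).head? = some a := by
  simp only [StackOp.exec, Bool.true_and, Prod.mk.injEq, decide_eq_true_eq] at h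
  exact h.1

/-! ### Inversion of successful operations -/

section

variable {s : GoalSym P Γ} {a : Γ} {σ : Fin v → List Γ} {t x : List Γ} {G : List (GoalSym P Γ)}
  {i : Fin v} {l : List (StackOp (EngineStack v) (GoalSym P Γ))} {S : EngineStack v → List (GoalSym P Γ)}

theorem pop_goal_inv (h : execOps (.pop .goal s :: l) (true, mkStacks σ t x G) = (true, S)) :
    ∃ G', G = s :: G' ∧ execOps l (true, mkStacks σ t x G') = (true, S) := by
  classical
  obtain ⟨S₁, h1, h2⟩ := execOps_cons_true h
  have h3 : G.head? = some s := head?_of_pop h1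
  obtain ⟨G', rfl⟩ : ∃ G', G = s :: G' := by cases G <;> simp_all
  rw [exec_pop_goal] at h1
  cases h1
  exact ⟨G', rfl, h2⟩

theorem head?_map_letter {w : List Γ} (h : (w.map (GoalSym.letter (P := P))).head? = some (.letter a)) :
    ∃ w', w = a :: w' := by
  cases w <;> simp_all

theorem pop_tmp_inv
    (h : execOps (.pop .tmp (.letter a) :: l) (true, mkStacks σ t x G) = (true, S)) :
    ∃ t', t = a :: t' ∧ execOps l (true, mkStacks σ t' x G) = (true, S) := by
  classical
  obtain ⟨S₁, h1, h2⟩ := execOps_cons_true h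
  have h3 := head?_of_pop h1
  obtain ⟨t', rfl⟩ := head?_map_letter (w := t) h3
  rw [exec_pop_tmp] at h1
  cases h1
  exact ⟨t', rfl, h2⟩

theorem pop_inp_inv
    (h : execOps (.pop .inp (.letter a) :: l) (true, mkStacks σ t x G) = (true, S)) :
    ∃ x', x = a :: x' ∧ execOps l (true, mkStacks σ t x' G) = (true, S) := by
  classical
  obtain ⟨S₁, h1, h2⟩ := execOps_cons_true h
  have h3 := head?_of_pop h1
  obtain ⟨x', rfl⟩ := head?_map_letter (w := x) h3
  rw [exec_pop_inp] at h1
  cases h1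
  exact ⟨x', rfl, h2⟩

theorem pop_var_inv
    (h : execOps (.pop (.var i) (.letter a) :: l) (true, mkStacks σ t x G) = (true, S)) :
    ∃ w, σ i = a :: w ∧ execOps l (true, mkStacks (update σ i w) t x G) = (true, S) := by
  classical
  obtain ⟨S₁, h1, h2⟩ := execOps_cons_true h
  have h3 := head?_of_pop h1
  obtain ⟨w, hw⟩ := head?_map_letter (w := σ i) h3
  rw [exec_pop_var _ _ _ _ _ _ _ _ hw] at h1
  cases h1
  exact ⟨w, hw, h2⟩

theorem push_goal_inv (h : execOps (.push .goal s :: l) (true, mkStacks σ t x G) = (true, S)) :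
    execOps l (true, mkStacks σ t x (s :: G)) = (true, S) := by
  rwa [execOps, exec_push_goal] at h

theorem push_tmp_inv
    (h : execOps (.push .tmp (.letter a) :: l) (true, mkStacks σ t x G) = (true, S)) :
    execOps l (true, mkStacks σ (a :: t) x G) = (true, S) := by
  rwa [execOps, exec_push_tmp] at h

theorem push_var_inv
    (h : execOps (.push (.var i) (.letter a) :: l) (true, mkStacks σ t x G) = (true, S)) :
    execOps l (true, mkStacks (update σ i (a :: σ i)) t x G) = (true, S) := by
  rwa [execOps, exec_push_var] at h

theorem empty_inv {k : EngineStack v}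
    (h : execOps (.empty k :: l) (true, mkStacks σ t x G) = (true, S)) :
    mkStacks σ t x G k = [] ∧ execOps l (true, mkStacks σ t x G) = (true, S) := by
  classical
  obtain ⟨S₁, h1, h2⟩ := execOps_cons_true h
  simp only [StackOp.exec, Bool.true_and, Prod.mk.injEq, decide_eq_true_eq, List.head?_eq_none_iff] at h1
  obtain ⟨h1, rfl⟩ := h1
  exact ⟨h1, h2⟩

theorem nil_inv {S' : EngineStack v → List (GoalSym P Γ)} (h : execOps [] (true, S') = (true, S)) :
    S = S' := by
  simpa [execOps] using h.symm

end

/-! ### Soundness of the machine -/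

variable (rules) in
/-- The word lists derivable goals. -/
def Solvable (G : List (GoalSym P Γ)) : Prop :=
  ∃ gs ℓ n, G = encFacts gs ∧ Ders rules ℓ n gs

/-- A guessed word has no length bound in advance. There are finitely many variables, so a common
bound exists for the old derivation and the new substitution. -/
theorem Solvable.rule {r : Rule P Γ v} (hr : r ∈ rules) (σ : Fin v → List Γ)
    {gs : List (Fact P Γ)} {ℓ n : ℕ} (h : Ders rules ℓ n (r.body.map (Atom.inst σ) ++ gs)) :
    Solvable rules (encFact (r.head.inst σ) ++ encFacts gs) := by
  refine ⟨r.head.inst σ :: gs, max ℓ (Finset.univ.sup fun i => (σ i).length), n + 1, rfl,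
    .cons hr σ (fun i => le_max_of_le_right ?_) (h.mono (le_max_left _ _))⟩
  exact Finset.le_sup (f := fun i => (σ i).length) (Finset.mem_univ i)

variable (rules) in
/-- What is known about a configuration from which the machine can accept. -/
def Inv (top : P) : EngineState P Γ v → (Fin v → List Γ) → List Γ → List Γ →
    List (GoalSym P Γ) → Prop
  | .start, _, t, x, G => t = [] →
      Solvable rules (.pred top :: (x.reverse.map .letter ++ .sep :: .bottom :: G))
  | .load, _, t, x, G => t = [] → Solvable rules (.pred top :: (x.reverse.map .letter ++ G))
  | .done, _, _, _, _ => True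
  -- While variable `i` is being matched or copied, its value is split: the letters already moved
  -- lie in reverse on the temporary stack, so the full value is `t.reverse ++ σ i`.
  | .run (.popVar i :: p) false, σ, t, _, G =>
      ∃ G', G = (σ i).map .letter ++ G' ∧
        Ends (Solvable rules) p (update σ i (t.reverse ++ σ i)) G'
  | .run (.popVar i :: p) true, σ, t, _, G =>
      Ends (Solvable rules) p (update σ i (t.reverse ++ σ i)) G
  | .run (.pushVar i :: p) false, σ, t, _, G =>
      Ends (Solvable rules) p (update σ i (t.reverse ++ σ i))
        ((t.reverse ++ σ i).map .letter ++ G)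
  | .run (.pushVar i :: p) true, σ, t, _, G =>
      Ends (Solvable rules) p (update σ i (t.reverse ++ σ i)) (t.reverse.map .letter ++ G)
  | .run p _, σ, t, _, G => t = [] → Ends (Solvable rules) p σ G

/-- Between two instructions the temporary stack is empty, and then all forms of the invariant
amount to the same statement. -/
theorem Inv.ends {top : P} {p : List (Instr P Γ v)} {σ : Fin v → List Γ} {x : List Γ}
    {G : List (GoalSym P Γ)} (h : Inv rules top (.run p false) σ [] x G) :
    Ends (Solvable rules) p σ G := by
  rcases p with _ | ⟨i, p⟩
  · exact h rfl
  · cases i with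
    | guess i => exact h rfl
    | popSym s => exact h rfl
    | pushSym s => exact h rfl
    | popVar i => simpa [Inv, Ends] using h
    | pushVar i => simpa [Inv, Ends] using h

/-- The invariant is a kind of weakest precondition: it records what an accepting continuation
entails, so it is carried from the target of a transition back to its source. -/
theorem inv_instrEdges {letters : List Γ} {top : P} {l : List (Instr P Γ v)}
    {e : EngineEdge P Γ v} (he : e ∈ instrEdges letters l) {σ : Fin v → List Γ} {t x : List Γ}
    {G : List (GoalSym P Γ)} {S : EngineStack v → List (GoalSym P Γ)}
    (h : execOps e.ops (true, mkStacks σ t x G) = (true, S))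
    (ih : ∀ σ' t' x' G', S = mkStacks σ' t' x' G' → Inv rules top e.dst σ' t' x' G') :
    Inv rules top e.src σ t x G := by
  rcases l with _ | ⟨i, p⟩
  · simp [instrEdges] at he
  cases i with
  | guess i =>
    simp only [instrEdges, List.mem_cons, List.mem_flatMap, List.not_mem_nil, or_false] at he
    rcases he with rfl | ⟨a, -, rfl | rfl⟩
    · rintro rfl
      -- Leaving the loop fixes the present content of the stack as the guess.
      exact ⟨σ i, by simpa using (ih _ _ _ _ (nil_inv h)).ends⟩
    · rintro rfl
      obtain ⟨w, hw⟩ := ih _ _ _ _ (nil_inv (push_var_inv h)) rfl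
      exact ⟨w, by simpa using hw⟩
    · rintro rfl
      obtain ⟨u, hu, h⟩ := pop_var_inv h
      obtain ⟨w, hw⟩ := ih _ _ _ _ (nil_inv h) rfl
      exact ⟨w, by simpa using hw⟩
  | popSym s =>
    simp only [instrEdges, List.mem_cons, List.not_mem_nil, or_false] at he
    subst he
    rintro rfl
    obtain ⟨G', rfl, h₁⟩ := pop_goal_inv h
    exact ⟨G', rfl, (ih _ _ _ _ (nil_inv h₁)).ends⟩
  | pushSym s =>
    simp only [instrEdges, List.mem_cons, List.not_mem_nil, or_false] at he
    subst he
    rintro rfl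
    exact (ih _ _ _ _ (nil_inv (push_goal_inv h))).ends
  | popVar i =>
    simp only [instrEdges, List.mem_cons, List.mem_flatMap, List.not_mem_nil, or_false] at he
    rcases he with rfl | rfl | ⟨a, -, rfl | rfl⟩
    · obtain ⟨hi, h⟩ := empty_inv h
      have hi : σ i = [] := by simpa [mkStacks] using hi
      have := ih _ _ _ _ (nil_inv h)
      exact ⟨G, by simp [hi], this⟩
    · obtain ⟨ht, h⟩ := empty_inv h
      obtain rfl : t = [] := by simpa [mkStacks] using ht
      have := (ih _ _ _ _ (nil_inv h)).ends
      simpa [Inv] using this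
    · obtain ⟨w, hw, h₁⟩ := pop_var_inv h
      obtain ⟨G', rfl, h₂⟩ := pop_goal_inv h₁
      obtain ⟨G'', rfl, hE⟩ := ih _ _ _ _ (nil_inv (push_tmp_inv h₂))
      exact ⟨G'', by simp [hw], by simpa [hw] using hE⟩
    · obtain ⟨t', rfl, h₁⟩ := pop_tmp_inv h
      have := ih _ _ _ _ (nil_inv (push_var_inv h₁))
      simpa [Inv] using this
  | pushVar i =>
    simp only [instrEdges, List.mem_cons, List.mem_flatMap, List.not_mem_nil, or_false] at he
    rcases he with rfl | rfl | ⟨a, -, rfl | rfl⟩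
    · obtain ⟨hi, h⟩ := empty_inv h
      have hi : σ i = [] := by simpa [mkStacks] using hi
      have := ih _ _ _ _ (nil_inv h)
      simpa [Inv, hi] using this
    · obtain ⟨ht, h⟩ := empty_inv h
      obtain rfl : t = [] := by simpa [mkStacks] using ht
      have := (ih _ _ _ _ (nil_inv h)).ends
      simpa [Inv] using this
    · obtain ⟨w, hw, h⟩ := pop_var_inv h
      have := ih _ _ _ _ (nil_inv (push_tmp_inv h))
      simpa [Inv, hw] using this
    · obtain ⟨t', rfl, h₁⟩ := pop_tmp_inv h
      have := ih _ _ _ _ (nil_inv (push_goal_inv (push_var_inv h₁)))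
      simpa [Inv] using this

theorem inv_of_run {letters : List Γ} {top : P} {n : ℕ}
    {c c' : EngineState P Γ v × (EngineStack v → List (GoalSym P Γ))}
    (h : (engine rules top letters).Run n c c') (hc' : c'.1 = .done) :
    ∀ σ t x G, c.2 = mkStacks σ t x G → Inv rules top c.1 σ t x G := by
  induction h with
  | refl c => intro σ t x G _; rw [hc']; trivial
  | @head n c d c'' hs _ ih =>
    intro σ t x G hc
    obtain ⟨e, he, hsrc, hdst, hops⟩ := hs
    have ih := ih hc'
    rw [hc] at hops
    rw [← hdst] at ih
    rw [← hsrc]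
    simp only [engine, List.cons_append, List.nil_append, List.mem_cons, List.mem_append,
      List.mem_map, List.mem_flatMap, List.mem_tails] at he
    rcases he with rfl | rfl | rfl | ⟨a, -, rfl⟩ | ⟨r, hr, rfl⟩ | ⟨r, hr, l, -, he⟩
    · rintro rfl
      exact ih _ _ _ _ (nil_inv (push_goal_inv (push_goal_inv hops))) rfl
    · rintro rfl
      obtain ⟨hx, h⟩ := empty_inv hops
      obtain rfl : x = [] := by simpa [mkStacks] using hx
      exact (ih _ _ _ _ (nil_inv (push_goal_inv h))).ends
    · rintro rfl
      obtain ⟨hx, h⟩ := empty_inv hops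
      obtain rfl : G = [] := hx
      exact ⟨[], 0, 0, rfl, .nil⟩
    · rintro rfl
      obtain ⟨x', rfl, h⟩ := pop_inp_inv hops
      simpa using ih _ _ _ _ (nil_inv (push_goal_inv h)) rfl
    · rintro rfl
      -- After the rule the stack codes derivable goals. They begin with the instantiated body, and
      -- what follows it are the goals that stood behind the head.
      obtain ⟨σ', G', rfl, gs, ℓ, n, hG, hD⟩ := (ih _ _ _ _ (nil_inv hops)).ends.of_ruleProg
      obtain ⟨bs, rfl, rfl⟩ := exists_of_encFacts_append hG
      exact Solvable.rule hr σ' hD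
    · exact inv_instrEdges he hops ih

/-! ### Completeness of the machine -/

theorem step_of_edge {letters : List Γ} {top : P} {e : EngineEdge P Γ v}
    (he : e ∈ (engine rules top letters).edges) {S S' : EngineStack v → List (GoalSym P Γ)}
    (h : execOps e.ops (true, S) = (true, S')) :
    (engine rules top letters).Run 1 (e.src, S) (e.dst, S') :=
  .single ⟨e, he, rfl, rfl, h⟩

theorem exec_empty {K A : Type} {k : K} {S : K → List A} (h : S k = []) :
    (StackOp.empty k).exec (true, S) = (true, S) := by
  simp [StackOp.exec, h]

section

variable {letters : List Γ} {top : P} {i : Fin v} {p : List (Instr P Γ v)}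
  (σ : Fin v → List Γ) (t x : List Γ) (G : List (GoalSym P Γ))

/-- The old value is popped letter by letter, and the new one is pushed with its last letter first.
Both are loops at the same state, followed by one transition that leaves it. -/
theorem run_guess (hlet : ∀ a, a ∈ letters)
    (hl : ∀ e ∈ instrEdges letters (.guess i :: p), e ∈ (engine rules top letters).edges) (w : List Γ) :
    (engine rules top letters).Run ((σ i).length + w.length + 1)
      (.run (.guess i :: p) false, mkStacks σ t x G)
      (.run p false, mkStacks (update σ i w) t x G) := by
  have h1 : ∀ (u : List Γ) (τ : Fin v → List Γ), τ i = u →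
      (engine rules top letters).Run u.length
        (.run (.guess i :: p) false, mkStacks τ t x G)
        (.run (.guess i :: p) false, mkStacks (update τ i []) t x G) := by
    intro u
    induction u with
    | nil => intro τ h; rw [update_eq_self_iff.2 h.symm]; exact .refl _
    | cons a u ih =>
      intro τ h
      have e : (⟨.run (.guess i :: p) false, [.pop (.var i) (.letter a)],
        .run (.guess i :: p) false⟩ : EngineEdge P Γ v) ∈ (engine rules top letters).edges :=
        hl _ (by simp [instrEdges, hlet])
      have h2 := ih (update τ i u) (by simp)
      rw [update_idem] at h2
      rw [List.length_cons, Nat.add_comm]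
      refine (step_of_edge e ?_).trans h2
      simp only [execOps]
      exact exec_pop_var _ _ _ _ _ _ _ _ h
  have h2 : ∀ (u : List Γ) (τ : Fin v → List Γ),
      (engine rules top letters).Run u.length
        (.run (.guess i :: p) false, mkStacks τ t x G)
        (.run (.guess i :: p) false, mkStacks (update τ i (u.reverse ++ τ i)) t x G) := by
    intro u
    induction u with
    | nil => intro τ; simpa using StackMachine.Run.refl _
    | cons a u ih =>
      intro τ
      have e : (⟨.run (.guess i :: p) false, [.push (.var i) (.letter a)],
        .run (.guess i :: p) false⟩ : EngineEdge P Γ v) ∈ (engine rules top letters).edges :=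
        hl _ (by simp [instrEdges, hlet])
      have h2 := ih (update τ i (a :: τ i))
      rw [update_idem, update_self] at h2
      rw [List.length_cons, Nat.add_comm, List.reverse_cons, List.append_assoc]
      refine (step_of_edge e ?_).trans h2
      simp only [execOps]
      exact exec_push_var _ _ _ _ _ _ _
  have e : (⟨.run (.guess i :: p) false, [], .run p false⟩ : EngineEdge P Γ v) ∈
      (engine rules top letters).edges := hl _ (by simp [instrEdges])
  have h3 := h2 w.reverse (update σ i [])
  simp only [List.reverse_reverse, List.length_reverse, update_idem, update_self,
    List.append_nil] at h3
  exact ((h1 _ σ rfl).trans h3).trans (step_of_edge e rfl)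

/-- The letters of the variable are compared with the goal while they move to the temporary stack,
and then they move back. The changes of phase account for the summand 2. -/
theorem run_popVar (hlet : ∀ a, a ∈ letters)
    (hl : ∀ e ∈ instrEdges letters (.popVar i :: p), e ∈ (engine rules top letters).edges) :
    (engine rules top letters).Run (2 * (σ i).length + 2)
      (.run (.popVar i :: p) false, mkStacks σ [] x ((σ i).map .letter ++ G))
      (.run p false, mkStacks σ [] x G) := by
  have h1 : ∀ (u t : List Γ) (τ : Fin v → List Γ), τ i = u →
      (engine rules top letters).Run u.length
        (.run (.popVar i :: p) false, mkStacks τ t x (u.map .letter ++ G))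
        (.run (.popVar i :: p) false, mkStacks (update τ i []) (u.reverse ++ t) x G) := by
    intro u
    induction u with
    | nil => intro t τ h; rw [update_eq_self_iff.2 h.symm]; exact .refl _
    | cons a u ih =>
      intro t τ h
      have e : (⟨.run (.popVar i :: p) false,
        [.pop (.var i) (.letter a), .pop .goal (.letter a), .push .tmp (.letter a)],
        .run (.popVar i :: p) false⟩ : EngineEdge P Γ v) ∈ (engine rules top letters).edges :=
        hl _ (by simp [instrEdges, hlet])
      have h2 := ih (a :: t) (update τ i u) (by simp)
      rw [update_idem] at h2
      rw [List.length_cons, Nat.add_comm, List.reverse_cons, List.append_assoc]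
      refine (step_of_edge e ?_).trans h2
      simp only [execOps, List.map_cons, List.cons_append]
      rw [exec_pop_var _ _ _ _ _ _ _ _ h, exec_pop_goal, exec_push_tmp]
  have h2 : ∀ (u : List Γ) (τ : Fin v → List Γ),
      (engine rules top letters).Run u.length
        (.run (.popVar i :: p) true, mkStacks τ u x G)
        (.run (.popVar i :: p) true, mkStacks (update τ i (u.reverse ++ τ i)) [] x G) := by
    intro u
    induction u with
    | nil => intro τ; simpa using StackMachine.Run.refl _
    | cons a u ih =>
      intro τ
      have e : (⟨.run (.popVar i :: p) true, [.pop .tmp (.letter a), .push (.var i) (.letter a)],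
        .run (.popVar i :: p) true⟩ : EngineEdge P Γ v) ∈ (engine rules top letters).edges :=
        hl _ (by simp [instrEdges, hlet])
      have h2 := ih (update τ i (a :: τ i))
      rw [update_idem, update_self] at h2
      rw [List.length_cons, Nat.add_comm, List.reverse_cons, List.append_assoc]
      refine (step_of_edge e ?_).trans h2
      simp only [execOps]
      rw [exec_pop_tmp, exec_push_var]
  have e1 : (⟨.run (.popVar i :: p) false, [.empty (.var i)], .run (.popVar i :: p) true⟩ :
      EngineEdge P Γ v) ∈ (engine rules top letters).edges := hl _ (by simp [instrEdges])
  have e2 : (⟨.run (.popVar i :: p) true, [.empty .tmp], .run p false⟩ :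
      EngineEdge P Γ v) ∈ (engine rules top letters).edges := hl _ (by simp [instrEdges])
  have h3 := h2 (σ i).reverse (update σ i [])
  simp only [List.reverse_reverse, List.length_reverse, update_idem, update_self,
    List.append_nil, update_eq_self] at h3
  have h4 := h1 _ [] σ rfl
  rw [List.append_nil] at h4
  have := ((h4.trans (step_of_edge e1 (exec_empty (by simp [mkStacks])))).trans h3).trans
    (step_of_edge e2 (exec_empty (by simp [mkStacks])))
  convert this using 1
  omega

/-- The value is first moved to the temporary stack and copied to the goal on the way back, so that
it arrives there in the right order and the variable is restored. -/
theorem run_pushVar (hlet : ∀ a, a ∈ letters)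
    (hl : ∀ e ∈ instrEdges letters (.pushVar i :: p), e ∈ (engine rules top letters).edges) :
    (engine rules top letters).Run (2 * (σ i).length + 2) (.run (.pushVar i :: p) false, mkStacks σ [] x G)
      (.run p false, mkStacks σ [] x ((σ i).map .letter ++ G)) := by
  have h1 : ∀ (u t : List Γ) (τ : Fin v → List Γ), τ i = u →
      (engine rules top letters).Run u.length
        (.run (.pushVar i :: p) false, mkStacks τ t x G)
        (.run (.pushVar i :: p) false, mkStacks (update τ i []) (u.reverse ++ t) x G) := by
    intro u
    induction u with
    | nil => intro t τ h; rw [update_eq_self_iff.2 h.symm]; exact .refl _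
    | cons a u ih =>
      intro t τ h
      have e : (⟨.run (.pushVar i :: p) false, [.pop (.var i) (.letter a), .push .tmp (.letter a)],
        .run (.pushVar i :: p) false⟩ : EngineEdge P Γ v) ∈ (engine rules top letters).edges :=
        hl _ (by simp [instrEdges, hlet])
      have h2 := ih (a :: t) (update τ i u) (by simp)
      rw [update_idem] at h2
      rw [List.length_cons, Nat.add_comm, List.reverse_cons, List.append_assoc]
      refine (step_of_edge e ?_).trans h2
      simp only [execOps]
      rw [exec_pop_var _ _ _ _ _ _ _ _ h, exec_push_tmp]
  have h2 : ∀ (u : List Γ) (τ : Fin v → List Γ) (G : List (GoalSym P Γ)),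
      (engine rules top letters).Run u.length
        (.run (.pushVar i :: p) true, mkStacks τ u x G)
        (.run (.pushVar i :: p) true,
          mkStacks (update τ i (u.reverse ++ τ i)) [] x (u.reverse.map .letter ++ G)) := by
    intro u
    induction u with
    | nil => intro τ G; simpa using StackMachine.Run.refl _
    | cons a u ih =>
      intro τ G
      have e : (⟨.run (.pushVar i :: p) true,
        [.pop .tmp (.letter a), .push (.var i) (.letter a), .push .goal (.letter a)],
        .run (.pushVar i :: p) true⟩ : EngineEdge P Γ v) ∈ (engine rules top letters).edges :=
        hl _ (by simp [instrEdges, hlet])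
      have h2 := ih (update τ i (a :: τ i)) (.letter a :: G)
      rw [update_idem, update_self] at h2
      rw [List.length_cons, Nat.add_comm, List.reverse_cons, List.append_assoc, List.map_append,
        List.append_assoc]
      refine (step_of_edge e ?_).trans h2
      simp only [execOps]
      rw [exec_pop_tmp, exec_push_var, exec_push_goal]
  have e1 : (⟨.run (.pushVar i :: p) false, [.empty (.var i)], .run (.pushVar i :: p) true⟩ :
      EngineEdge P Γ v) ∈ (engine rules top letters).edges := hl _ (by simp [instrEdges])
  have e2 : (⟨.run (.pushVar i :: p) true, [.empty .tmp], .run p false⟩ :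
      EngineEdge P Γ v) ∈ (engine rules top letters).edges := hl _ (by simp [instrEdges])
  have h3 := h2 (σ i).reverse (update σ i []) G
  simp only [List.reverse_reverse, List.length_reverse, update_idem, update_self,
    List.append_nil, update_eq_self] at h3
  have h4 := h1 _ [] σ rfl
  rw [List.append_nil] at h4
  have := ((h4.trans (step_of_edge e1 (exec_empty (by simp [mkStacks])))).trans h3).trans
    (step_of_edge e2 (exec_empty (by simp [mkStacks])))
  convert this using 1
  omega

end

/-! ### Lengths of runs -/

section

variable {letters : List Γ} {top : P} {ℓ : ℕ}

/-- Runs of bounded length. -/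
def RunLe (rules : List (Rule P Γ v)) (top : P) (letters : List Γ) (n : ℕ)
    (c c' : EngineState P Γ v × (EngineStack v → List (GoalSym P Γ))) : Prop :=
  ∃ m ≤ n, (engine rules top letters).Run m c c'

theorem RunLe.trans {m n : ℕ} {a b c : EngineState P Γ v × (EngineStack v → List (GoalSym P Γ))}
    (h : RunLe rules top letters m a b) (h' : RunLe rules top letters n b c) :
    RunLe rules top letters (m + n) a c := by
  obtain ⟨i, hi, r⟩ := h
  obtain ⟨j, hj, r'⟩ := h'
  exact ⟨i + j, by omega, r.trans r'⟩

theorem RunLe.mono {m n : ℕ} {a b : EngineState P Γ v × (EngineStack v → List (GoalSym P Γ))}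
    (h : RunLe rules top letters m a b) (hmn : m ≤ n) : RunLe rules top letters n a b := by
  obtain ⟨i, hi, r⟩ := h
  exact ⟨i, hi.trans hmn, r⟩

/-- The machine has the transitions that execute the program. -/
def Covers (rules : List (Rule P Γ v)) (top : P) (letters : List Γ) (l : List (Instr P Γ v)) :
    Prop :=
  ∀ q, q <:+ l → ∀ e ∈ instrEdges letters q, e ∈ (engine rules top letters).edges

theorem Covers.of_append {l l' : List (Instr P Γ v)} (h : Covers rules top letters (l ++ l')) :
    Covers rules top letters l' :=
  fun q hq => h q (hq.trans (List.suffix_append _ _))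

theorem Covers.of_cons {i : Instr P Γ v} {l : List (Instr P Γ v)}
    (h : Covers rules top letters (i :: l)) : Covers rules top letters l :=
  fun q hq => h q (hq.trans (List.suffix_cons _ _))

/-- A word of length at most `ℓ` is replaced by another one, which fits into the uniform cost `2 * ℓ
+ 2` of an instruction. -/
theorem runLe_guesses (hlet : ∀ a, a ∈ letters) (js : List (Fin v)) (p : List (Instr P Γ v))
    (hc : Covers rules top letters (js.map .guess ++ p)) {σ τ : Fin v → List Γ}
    (hσ : ∀ i, (σ i).length ≤ ℓ) (hτ : ∀ i, (τ i).length ≤ ℓ) (x : List Γ)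
    (G : List (GoalSym P Γ)) :
    RunLe rules top letters (js.length * (2 * ℓ + 2))
      (.run (js.map .guess ++ p) false, mkStacks σ [] x G)
      (.run p false, mkStacks (fun i => if i ∈ js then τ i else σ i) [] x G) := by
  induction js generalizing σ with
  | nil => exact ⟨0, by simp, by simpa using StackMachine.Run.refl _⟩
  | cons j js ih =>
    have h1 := run_guess σ [] x G hlet (hc _ List.suffix_rfl) (τ j)
    have h2 := ih hc.of_cons (σ := update σ j (τ j)) (fun i => by
      by_cases h : i = j
      · subst h; simpa using hτ i
      · simpa [h] using hσ i)
    have h3 := RunLe.trans ⟨_, le_rfl, h1⟩ h2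
    have h4 : (fun i => if i ∈ js then τ i else update σ j (τ j) i) =
        fun i => if i ∈ j :: js then τ i else σ i := by
      funext i
      by_cases h : i = j
      · subst h; simp
      · simp [h]
    rw [h4] at h3
    refine h3.mono ?_
    have := hσ j
    have := hτ j
    rw [List.length_cons, Nat.add_mul]
    omega

theorem runLe_pops (hlet : ∀ a, a ∈ letters) (q : GPat P Γ v) (p : List (Instr P Γ v))
    (hc : Covers rules top letters (q.map popInstr ++ p)) {σ : Fin v → List Γ}
    (hσ : ∀ i, (σ i).length ≤ ℓ) (x : List Γ) (G : List (GoalSym P Γ)) :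
    RunLe rules top letters (q.length * (2 * ℓ + 2))
      (.run (q.map popInstr ++ p) false, mkStacks σ [] x (instG σ q ++ G))
      (.run p false, mkStacks σ [] x G) := by
  induction q with
  | nil => exact ⟨0, by simp, .refl _⟩
  | cons s q ih =>
    rw [List.length_cons, Nat.add_comm, Nat.add_mul]
    rcases s with s | i
    · have e := hc _ List.suffix_rfl ⟨.run (.popSym s :: (q.map popInstr ++ p)) false,
        [.pop .goal s], .run (q.map popInstr ++ p) false⟩ (by simp [instrEdges, popInstr])
      refine RunLe.trans ?_ (ih hc.of_cons)
      exact ⟨1, by omega, step_of_edge e (exec_pop_goal _ _ _ _ _ _)⟩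
    · refine RunLe.trans ?_ (ih hc.of_cons)
      have h := run_popVar σ x (instG σ q ++ G) hlet (hc _ List.suffix_rfl)
      refine ⟨_, ?_, by simpa [instG, popInstr] using h⟩
      have := hσ i
      omega

theorem runLe_pushes (hlet : ∀ a, a ∈ letters) (q : GPat P Γ v) (p : List (Instr P Γ v))
    (hc : Covers rules top letters (q.reverse.map pushInstr ++ p)) {σ : Fin v → List Γ}
    (hσ : ∀ i, (σ i).length ≤ ℓ) (x : List Γ) (G : List (GoalSym P Γ)) :
    RunLe rules top letters (q.length * (2 * ℓ + 2))
      (.run (q.reverse.map pushInstr ++ p) false, mkStacks σ [] x G)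
      (.run p false, mkStacks σ [] x (instG σ q ++ G)) := by
  induction q generalizing p with
  | nil => exact ⟨0, by simp, .refl _⟩
  | cons s q ih =>
    rw [List.length_cons, Nat.add_mul]
    rw [List.reverse_cons, List.map_append, List.append_assoc] at hc ⊢
    refine (ih _ hc).trans ?_
    have hc' := hc.of_append
    rcases s with s | i
    · have e := hc' _ List.suffix_rfl ⟨.run (.pushSym s :: p) false,
        [.push .goal s], .run p false⟩ (by simp [instrEdges, pushInstr])
      exact ⟨1, by omega, step_of_edge e (exec_push_goal _ _ _ _ _ _)⟩
    · have h := run_pushVar σ x (instG σ q ++ G) hlet (hc' _ List.suffix_rfl)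
      refine ⟨_, ?_, by simpa [instG, pushInstr] using h⟩
      have := hσ i
      omega

theorem covers_ruleProg {r : Rule P Γ v} (hr : r ∈ rules) :
    Covers rules top letters (ruleProg r) := by
  intro q hq e he
  simp only [engine, List.mem_append, List.mem_flatMap, List.mem_tails]
  exact .inr (.inr (.inr ⟨r, hr, q, hq, he⟩))

theorem runLe_rule (hlet : ∀ a, a ∈ letters) {r : Rule P Γ v} (hr : r ∈ rules)
    {σ τ : Fin v → List Γ} (hσ : ∀ i, (σ i).length ≤ ℓ) (hτ : ∀ i, (τ i).length ≤ ℓ)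
    (x : List Γ) (G : List (GoalSym P Γ)) :
    RunLe rules top letters ((ruleProg r).length * (2 * ℓ + 2) + 1)
      (.run [] false, mkStacks σ [] x (encFact (r.head.inst τ) ++ G))
      (.run [] false, mkStacks τ [] x (encFacts (r.body.map (Atom.inst τ)) ++ G)) := by
  have hc : Covers rules top letters (ruleProg r) := covers_ruleProg hr
  have e : (⟨.run [] false, [], .run (ruleProg r) false⟩ : EngineEdge P Γ v) ∈
      (engine rules top letters).edges := by
    simp only [engine, List.mem_append, List.mem_map]
    exact .inr (.inr (.inl ⟨r, hr, rfl⟩))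
  have h1 := runLe_guesses hlet _ _ hc hσ hτ x (encFact (r.head.inst τ) ++ G)
  simp only [List.mem_finRange, if_true] at h1
  have h2 := runLe_pops hlet _ _ hc.of_append hτ x G
  rw [instG_patAtom] at h2
  have h3 := runLe_pushes hlet (patAtoms r.body) [] (by
    rw [List.append_nil]; exact hc.of_append.of_append) hτ x G
  rw [instG_patAtoms, List.append_nil] at h3
  refine (RunLe.trans ⟨1, le_rfl, step_of_edge e rfl⟩ ((h1.trans h2).trans h3)).mono ?_
  simp only [ruleProg, List.length_append, List.length_map, List.length_reverse, Nat.add_mul]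
  omega

variable (rules) in
/-- A bound for the length of the programs. -/
def progBound : ℕ := (rules.map fun r => (ruleProg r).length).sum

theorem length_ruleProg_le {r : Rule P Γ v} (hr : r ∈ rules) :
    (ruleProg r).length ≤ progBound rules :=
  List.single_le_sum (fun _ _ => Nat.zero_le _) _ (List.mem_map_of_mem hr)

/-- The programs are fixed and the substituted words have length at most `ℓ`, so an application of a
rule costs a number of steps linear in `ℓ`. The height of the goal stack does not enter, since only
its top is touched. -/
theorem runLe_ders (hlet : ∀ a, a ∈ letters) {n : ℕ} {gs : List (Fact P Γ)}
    (h : Ders rules ℓ n gs) (x : List Γ) {σ : Fin v → List Γ} (hσ : ∀ i, (σ i).length ≤ ℓ) :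
    ∃ τ, RunLe rules top letters (n * (progBound rules * (2 * ℓ + 2) + 1))
      (.run [] false, mkStacks σ [] x (encFacts gs)) (.run [] false, mkStacks τ [] x []) := by
  induction h generalizing σ with
  | nil => exact ⟨σ, 0, by simp, .refl _⟩
  | @cons n r gs hr τ hτ _ ih =>
    obtain ⟨τ', h⟩ := ih hτ
    rw [encFacts_append] at h
    refine ⟨τ', ((runLe_rule hlet hr hσ hτ x (encFacts gs)).trans h).mono ?_⟩
    have := Nat.mul_le_mul_right (2 * ℓ + 2) (length_ruleProg_le hr)
    rw [Nat.add_mul]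
    omega

theorem runLe_load (hlet : ∀ a, a ∈ letters) (x : List Γ) (σ : Fin v → List Γ)
    (G : List (GoalSym P Γ)) :
    RunLe rules top letters (x.length + 1) (.load, mkStacks σ [] x G)
      (.run [] false, mkStacks σ [] [] (.pred top :: (x.reverse.map .letter ++ G))) := by
  induction x generalizing G with
  | nil =>
    have e : (⟨.load, [.empty .inp, .push .goal (.pred top)], .run [] false⟩ :
      EngineEdge P Γ v) ∈ (engine rules top letters).edges := by simp [engine]
    refine ⟨1, le_rfl, step_of_edge e ?_⟩
    rw [execOps, exec_empty (by simp [mkStacks]), execOps, exec_push_goal]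
    rfl
  | cons a x ih =>
    have e : (⟨.load, [.pop .inp (.letter a), .push .goal (.letter a)], .load⟩ :
      EngineEdge P Γ v) ∈ (engine rules top letters).edges := by simp [engine, hlet]
    have h := ih (.letter a :: G)
    rw [List.length_cons, Nat.add_comm (x.length + 1)]
    refine RunLe.trans ⟨1, le_rfl, step_of_edge e ?_⟩ (by simpa using h)
    simp only [execOps]
    rw [exec_pop_inp, exec_push_goal]

theorem initStacks_engine (x : List Γ) :
    (engine rules top letters).initStacks x = mkStacks (fun _ => []) [] x.reverse [] := by
  funext k
  cases k <;> simp [StackMachine.initStacks, engine, mkStacks]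

variable (rules top) in
/-- A language is in NP if membership is characterized by derivations of polynomial size from a
finite set of Horn clauses. -/
theorem inNP [Fintype Γ] (L : Set (List Γ)) (p : Polynomial ℕ)
    (sound : ∀ x ℓ n, Ders rules ℓ n [(top, [x])] → x ∈ L)
    (complete : ∀ x ∈ L, ∃ n ≤ p.eval x.length, Ders rules (p.eval x.length) n [(top, [x])]) :
    InNP L := by
  have : Inhabited (GoalSym P Γ) := ⟨.sep⟩
  have hlet : ∀ a : Γ, a ∈ (Finset.univ : Finset Γ).toList := by simp
  refine StackMachine.inNP (engine rules top (Finset.univ : Finset Γ).toList) L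
    -- Apart from the derivation there are the first and the last transition, and `x.length + 1`
    -- transitions that load the input.
    (p * (Polynomial.C (progBound rules) * (2 * p + 2) + 1) + Polynomial.X + 3) ?_ ?_
  · rintro x n ⟨S, h⟩
    have h1 := inv_of_run h rfl _ _ _ _ (initStacks_engine x) rfl
    obtain ⟨gs, ℓ, n, h2, h3⟩ := h1
    obtain rfl := encFacts_eq_single (g := (top, [x])) (by
      rw [← h2]
      simp [encFact, encArgs])
    exact sound x ℓ n h3
  · intro x hx
    obtain ⟨n, hn, h⟩ := complete x hx
    have e1 : (⟨.start, [.push .goal .bottom, .push .goal .sep], .load⟩ : EngineEdge P Γ v) ∈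
      (engine rules top (Finset.univ : Finset Γ).toList).edges := by simp [engine]
    have e2 : (⟨.run [] false, [.empty .goal], .done⟩ : EngineEdge P Γ v) ∈
      (engine rules top (Finset.univ : Finset Γ).toList).edges := by simp [engine]
    have h1 := step_of_edge e1 (S := mkStacks (fun _ => []) [] x.reverse [])
      (S' := mkStacks (fun _ => []) [] x.reverse [.sep, .bottom]) (by
        simp only [execOps]
        rw [exec_push_goal, exec_push_goal])
    have h2 := runLe_load (rules := rules) (top := top) hlet x.reverse (fun _ => []) [.sep, .bottom]
    obtain ⟨τ, h3⟩ := runLe_ders (top := top) hlet h [] (σ := fun _ => []) (by simp)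
    have h4 := step_of_edge e2 (S := mkStacks τ [] [] []) (exec_empty rfl)
    have h5 : encFacts [(top, [x])] =
        .pred top :: (x.reverse.reverse.map .letter ++ [.sep, .bottom]) := by
      simp [encFacts, encFact, encArgs]
    rw [h5] at h3
    obtain ⟨m, hm, hr⟩ := ((RunLe.trans ⟨1, le_rfl, h1⟩ h2).trans h3).trans ⟨1, le_rfl, h4⟩
    refine ⟨m, hm.trans ?_, _, by rw [initStacks_engine]; exact hr⟩
    have := Nat.mul_le_mul_right (progBound rules * (2 * p.eval x.length + 2) + 1) hn
    simp only [List.length_reverse, Polynomial.eval_add, Polynomial.eval_mul, Polynomial.eval_C,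
      Polynomial.eval_X, Polynomial.eval_ofNat, Polynomial.eval_one]
    omega

end

end

end Horn

/-! ### A grammar for the encodings -/

namespace OBDM

instance : Fintype Sym :=
  ⟨⟨([.zero, .one, .item, .close] : List Sym), by simp⟩, fun a => by cases a <;> simp⟩

/-- Elements of the canonical model: constants, the objects required by the head of a mapping
assertion, successors, and representatives of basic concepts. -/
inductive Tm where
  | const (c : Const)
  | null (m : GLAVAssertion) (c : List Const) (z : Var)
  | child (R : BasicRole) (t : Tm)
  | root (B : BasicConcept)

def encodeTm : Tm → List Sym
  | .const c => .zero :: encodeName c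
  | .null m c z => .one :: (encodeGLAV m ++ (encodeList encodeName c ++ encodeName z))
  | .child R t => .item :: (encodeBasicRole R ++ encodeTm t)
  | .root B => .close :: encodeBasicConcept B

theorem prefixCode_tm : PrefixCode encodeTm := by
  intro a
  induction a with
  | const c =>
    intro b s t h
    cases b <;> simp [encodeTm] at h ⊢
    exact prefixCode_name _ _ _ _ h
  | null m c z =>
    intro b s t h
    cases b <;> simp only [encodeTm, List.cons_append, List.append_assoc, List.cons.injEq,
      reduceCtorEq, false_and, true_and] at h
    obtain ⟨rfl, h₁⟩ := prefixCode_glav _ _ _ _ h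
    obtain ⟨rfl, h₂⟩ := prefixCode_list prefixCode_name _ _ _ _ h₁
    obtain ⟨rfl, h₃⟩ := prefixCode_name _ _ _ _ h₂
    exact ⟨rfl, h₃⟩
  | child R t ih =>
    intro b s t h
    cases b <;> simp only [encodeTm, List.cons_append, List.append_assoc, List.cons.injEq,
      reduceCtorEq, false_and, true_and] at h
    obtain ⟨rfl, h₁⟩ := prefixCode_basicRole _ _ _ _ h
    obtain ⟨rfl, h₂⟩ := ih _ _ _ h₁
    exact ⟨rfl, h₂⟩
  | root B =>
    intro b s t h
    cases b <;> simp [encodeTm] at h ⊢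
    exact prefixCode_basicConcept _ _ _ _ h

/-- An entry of an assignment of terms to variables. -/
def encodeEntry (e : Name × Tm) : List Sym :=
  encodeName e.1 ++ encodeTm e.2

theorem prefixCode_entry : PrefixCode encodeEntry :=
  prefixCode_pair prefixCode_name prefixCode_tm

/-- The syntactic categories. -/
inductive NT where
  | name | nat | names | rel | rels | sch | schs | ac | role | bc | asr | asrs | oa | oas
  | cq | cqs | ucq | glav | glavs | tuples | input | tm | ent | ents

/-- The words of a category. -/
def lang : NT → Set (List Sym)
  | .name => Set.range encodeName
  | .nat => Set.range encodeNat
  | .names => Set.range (encodeList encodeName)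
  | .rel => Set.range encodeRelAtom
  | .rels => Set.range (encodeList encodeRelAtom)
  | .sch => Set.range encodeSchemaEntry
  | .schs => Set.range (encodeList encodeSchemaEntry)
  | .ac => Set.range encodeAtomicConcept
  | .role => Set.range encodeBasicRole
  | .bc => Set.range encodeBasicConcept
  | .asr => Set.range encodeAssertion
  | .asrs => Set.range (encodeList encodeAssertion)
  | .oa => Set.range encodeOntologyAtom
  | .oas => Set.range (encodeList encodeOntologyAtom)
  | .cq => Set.range encodeCQ
  | .cqs => Set.range (encodeList encodeCQ)
  | .ucq => Set.range encodeUCQ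
  | .glav => Set.range encodeGLAV
  | .glavs => Set.range (encodeList encodeGLAV)
  | .tuples => Set.range (encodeList (encodeList encodeName))
  | .input => Set.range Input.encode
  | .tm => Set.range encodeTm
  | .ent => Set.range encodeEntry
  | .ents => Set.range (encodeList encodeEntry)

/-- The productions: what follows after a first letter. -/
def prod : NT → Sym → Option (List NT)
  | .name, .zero => some [.name]
  | .name, .one => some [.name]
  | .name, .close => some []
  | .nat, .one => some [.nat]
  | .nat, .close => some []
  | .names, .item => some [.name, .names]
  | .names, .close => some []
  | .rel, .zero => some [.rel]
  | .rel, .one => some [.rel]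
  | .rel, .close => some [.names]
  | .rels, .item => some [.rel, .rels]
  | .rels, .close => some []
  | .sch, .zero => some [.sch]
  | .sch, .one => some [.sch]
  | .sch, .close => some [.nat]
  | .schs, .item => some [.sch, .schs]
  | .schs, .close => some []
  | .ac, .zero => some []
  | .ac, .close => some []
  | .ac, .one => some [.name]
  | .role, .zero => some [.name]
  | .role, .one => some [.name]
  | .bc, .zero => some [.ac]
  | .bc, .one => some [.role]
  | .asr, .zero => some [.bc, .bc]
  | .asr, .one => some [.role, .role]
  | .asr, .item => some [.bc, .bc]
  | .asr, .close => some [.role, .role]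
  | .asrs, .item => some [.asr, .asrs]
  | .asrs, .close => some []
  | .oa, .zero => some [.ac, .name]
  | .oa, .one => some [.name, .name, .name]
  | .oas, .item => some [.oa, .oas]
  | .oas, .close => some []
  | .cq, .item => some [.name, .cq]
  | .cq, .close => some [.oas]
  | .cqs, .item => some [.cq, .cqs]
  | .cqs, .close => some []
  | .ucq, .one => some [.ucq]
  | .ucq, .close => some [.cqs]
  | .glav, .item => some [.name, .glav]
  | .glav, .close => some [.rels, .oas]
  | .glavs, .item => some [.glav, .glavs]
  | .glavs, .close => some []
  | .tuples, .item => some [.names, .tuples]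
  | .tuples, .close => some []
  | .input, .item => some [.asr, .input]
  | .input, .close => some [.schs, .glavs, .rels, .tuples, .ucq]
  | .tm, .zero => some [.name]
  | .tm, .one => some [.glav, .names, .name]
  | .tm, .item => some [.role, .tm]
  | .tm, .close => some [.bc]
  | .ent, .zero => some [.ent]
  | .ent, .one => some [.ent]
  | .ent, .close => some [.tm]
  | .ents, .item => some [.ent, .ents]
  | .ents, .close => some []
  | _, _ => none

/-- The concatenations of words of given categories. -/
def langs : List NT → Set (List Sym)
  | [] => {[]}
  | N :: Ns => {w | ∃ X ∈ lang N, ∃ Y ∈ langs Ns, w = X ++ Y}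

/-- The words that the productions give for a category. -/
def expand (N : NT) : Set (List Sym) :=
  {w | ∃ a Ns Y, prod N a = some Ns ∧ Y ∈ langs Ns ∧ w = a :: Y}

theorem expand_iff {N : NT} {w : List Sym} : w ∈ expand N ↔
    (∃ Ns, prod N .zero = some Ns ∧ ∃ Y, Y ∈ langs Ns ∧ w = .zero :: Y) ∨
    (∃ Ns, prod N .one = some Ns ∧ ∃ Y, Y ∈ langs Ns ∧ w = .one :: Y) ∨
    (∃ Ns, prod N .item = some Ns ∧ ∃ Y, Y ∈ langs Ns ∧ w = .item :: Y) ∨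
    (∃ Ns, prod N .close = some Ns ∧ ∃ Y, Y ∈ langs Ns ∧ w = .close :: Y) := by
  constructor
  · rintro ⟨a, Ns, Y, h, hY, e⟩
    cases a
    exacts [.inl ⟨Ns, h, Y, hY, e⟩, .inr (.inl ⟨Ns, h, Y, hY, e⟩),
      .inr (.inr (.inl ⟨Ns, h, Y, hY, e⟩)), .inr (.inr (.inr ⟨Ns, h, Y, hY, e⟩))]
  · rintro (⟨Ns, h, Y, hY, e⟩ | ⟨Ns, h, Y, hY, e⟩ | ⟨Ns, h, Y, hY, e⟩ | ⟨Ns, h, Y, hY, e⟩)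
    exacts [⟨_, Ns, Y, h, hY, e⟩, ⟨_, Ns, Y, h, hY, e⟩, ⟨_, Ns, Y, h, hY, e⟩,
      ⟨_, Ns, Y, h, hY, e⟩]

theorem mem_langs_single {N : NT} {w : List Sym} : w ∈ langs [N] ↔ w ∈ lang N := by
  simp [langs]

theorem range_encodeList {α : Type} {f : α → List Sym} {w : List Sym} :
    w ∈ Set.range (encodeList f) ↔ w = [.close] ∨
      ∃ X ∈ Set.range f, ∃ Y ∈ Set.range (encodeList f), w = .item :: (X ++ Y) := by
  constructor
  · rintro ⟨l, rfl⟩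
    cases l with
    | nil => exact .inl rfl
    | cons a l => exact .inr ⟨_, ⟨a, rfl⟩, _, ⟨l, rfl⟩, rfl⟩
  · rintro (rfl | ⟨_, ⟨a, rfl⟩, _, ⟨l, rfl⟩, rfl⟩)
    · exact ⟨[], rfl⟩
    · exact ⟨a :: l, rfl⟩

theorem expand_list {N M : NT} {α : Type} {f : α → List Sym} (hN : lang N = Set.range (encodeList f))
    (hM : lang M = Set.range f) (h0 : prod N .zero = none) (h1 : prod N .one = none)
    (hi : prod N .item = some [M, N]) (hc : prod N .close = some []) : lang N = expand N := by
  ext w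
  rw [expand_iff, h0, h1, hi, hc, hN, range_encodeList]
  simp only [reduceCtorEq, false_and, exists_false, Option.some.injEq, exists_eq_left', langs,
    hM, hN, false_or, Set.mem_singleton_iff, exists_eq_left]
  rw [or_comm]
  simp

theorem lang_name : lang .name = expand .name := by
  ext w
  rw [expand_iff]
  simp only [prod, Option.some.injEq, exists_eq_left', mem_langs_single, reduceCtorEq, false_and, exists_false, false_or]
  constructor
  · rintro ⟨l, rfl⟩
    rcases l with _ | ⟨_ | _, l⟩
    · simp [encodeName, langs]
    · exact .inl ⟨_, ⟨l, rfl⟩, rfl⟩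
    · exact .inr (.inl ⟨_, ⟨l, rfl⟩, rfl⟩)
  · rintro (⟨_, ⟨l, rfl⟩, rfl⟩ | ⟨_, ⟨l, rfl⟩, rfl⟩ | ⟨_, rfl, rfl⟩)
    exacts [⟨false :: l, rfl⟩, ⟨true :: l, rfl⟩, ⟨[], rfl⟩]

theorem lang_nat : lang .nat = expand .nat := by
  ext w
  rw [expand_iff]
  simp only [prod, Option.some.injEq, exists_eq_left', mem_langs_single, reduceCtorEq, false_and, exists_false, false_or]
  constructor
  · rintro ⟨n, rfl⟩
    rcases n with _ | n
    · simp [encodeNat, langs]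
    · exact .inl ⟨_, ⟨n, rfl⟩, rfl⟩
  · rintro (⟨_, ⟨n, rfl⟩, rfl⟩ | ⟨_, rfl, rfl⟩)
    exacts [⟨n + 1, rfl⟩, ⟨0, rfl⟩]

/-- A category whose words start with a name. -/
theorem expand_name {N M : NT} (hN : lang N = {w | ∃ X ∈ lang .name, ∃ Y ∈ lang M, w = X ++ Y})
    (h0 : prod N .zero = some [N]) (h1 : prod N .one = some [N]) (hi : prod N .item = none)
    (hc : prod N .close = some [M]) : lang N = expand N := by
  ext w
  rw [expand_iff, h0, h1, hi, hc]
  simp only [Option.some.injEq, exists_eq_left', mem_langs_single, reduceCtorEq, false_and,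
    exists_false, false_or]
  rw [hN]
  constructor
  · rintro ⟨_, ⟨l, rfl⟩, Y, hY, rfl⟩
    rcases l with _ | ⟨_ | _, l⟩
    · exact .inr (.inr ⟨Y, hY, rfl⟩)
    · exact .inl ⟨_, ⟨_, ⟨l, rfl⟩, Y, hY, rfl⟩, rfl⟩
    · exact .inr (.inl ⟨_, ⟨_, ⟨l, rfl⟩, Y, hY, rfl⟩, rfl⟩)
  · rintro (⟨_, ⟨_, ⟨l, rfl⟩, Y, hY, rfl⟩, rfl⟩ | ⟨_, ⟨_, ⟨l, rfl⟩, Y, hY, rfl⟩, rfl⟩ | ⟨Y, hY, rfl⟩)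
    exacts [⟨_, ⟨false :: l, rfl⟩, Y, hY, rfl⟩, ⟨_, ⟨true :: l, rfl⟩, Y, hY, rfl⟩,
      ⟨_, ⟨[], rfl⟩, Y, hY, rfl⟩]

/-- A category whose words start with a list. -/
theorem expand_listStart {N M : NT} {Ns : List NT} {α : Type} {f : α → List Sym}
    (hM : lang M = Set.range f)
    (hN : lang N = {w | ∃ X ∈ Set.range (encodeList f), ∃ Y ∈ langs Ns, w = X ++ Y})
    (h0 : prod N .zero = none) (h1 : prod N .one = none) (hi : prod N .item = some [M, N])
    (hc : prod N .close = some Ns) : lang N = expand N := by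
  ext w
  rw [expand_iff, h0, h1, hi, hc]
  simp only [Option.some.injEq, exists_eq_left', reduceCtorEq, false_and,
    exists_false, false_or]
  constructor
  · rw [hN]
    rintro ⟨X, hX, Y, hY, rfl⟩
    rcases range_encodeList.1 hX with rfl | ⟨X, hX, Z, hZ, rfl⟩
    · exact .inr ⟨Y, hY, rfl⟩
    · exact .inl ⟨X ++ (Z ++ Y), ⟨X, by rwa [hM], Z ++ Y,
        mem_langs_single.2 (by rw [hN]; exact ⟨Z, hZ, Y, hY, rfl⟩), rfl⟩, by simp⟩
  · rintro (⟨_, ⟨X, hX, Z, hZ, rfl⟩, rfl⟩ | ⟨Y, hY, rfl⟩)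
    · rw [mem_langs_single, hN] at hZ
      rw [hM] at hX
      rw [hN]
      obtain ⟨Z, hZ, Y, hY, rfl⟩ := hZ
      exact ⟨.item :: (X ++ Z), range_encodeList.2 (.inr ⟨X, hX, Z, hZ, rfl⟩), Y, hY, by simp⟩
    · rw [hN]
      exact ⟨[.close], range_encodeList.2 (.inl rfl), Y, hY, rfl⟩

/-- The grammar is LL(1): the first letter of a word determines how it continues, and every
production consumes a letter. A category that begins with a name or a list reads this beginning
itself, letter by letter or item by item; thus `.input` reads the assertions of the ontology one at
a time. -/
theorem lang_eq_expand (N : NT) : lang N = expand N := by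
  cases N
  case name => exact lang_name
  case nat => exact lang_nat
  case names => exact expand_list rfl (M := .name) rfl rfl rfl rfl rfl
  case rels => exact expand_list rfl (M := .rel) rfl rfl rfl rfl rfl
  case schs => exact expand_list rfl (M := .sch) rfl rfl rfl rfl rfl
  case asrs => exact expand_list rfl (M := .asr) rfl rfl rfl rfl rfl
  case oas => exact expand_list rfl (M := .oa) rfl rfl rfl rfl rfl
  case cqs => exact expand_list rfl (M := .cq) rfl rfl rfl rfl rfl
  case glavs => exact expand_list rfl (M := .glav) rfl rfl rfl rfl rfl
  case tuples => exact expand_list rfl (M := .names) rfl rfl rfl rfl rfl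
  case ents => exact expand_list rfl (M := .ent) rfl rfl rfl rfl rfl
  case rel =>
    refine expand_name (M := .names) ?_ rfl rfl rfl rfl
    ext w
    constructor
    · rintro ⟨a, rfl⟩
      exact ⟨_, ⟨a.pred, rfl⟩, _, ⟨a.args, rfl⟩, rfl⟩
    · rintro ⟨_, ⟨p, rfl⟩, _, ⟨l, rfl⟩, rfl⟩
      exact ⟨⟨p, l⟩, rfl⟩
  case sch =>
    refine expand_name (M := .nat) ?_ rfl rfl rfl rfl
    ext w
    constructor
    · rintro ⟨a, rfl⟩
      exact ⟨_, ⟨a.1, rfl⟩, _, ⟨a.2, rfl⟩, rfl⟩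
    · rintro ⟨_, ⟨p, rfl⟩, _, ⟨l, rfl⟩, rfl⟩
      exact ⟨⟨p, l⟩, rfl⟩
  case ent =>
    refine expand_name (M := .tm) ?_ rfl rfl rfl rfl
    ext w
    constructor
    · rintro ⟨a, rfl⟩
      exact ⟨_, ⟨a.1, rfl⟩, _, ⟨a.2, rfl⟩, rfl⟩
    · rintro ⟨_, ⟨p, rfl⟩, _, ⟨l, rfl⟩, rfl⟩
      exact ⟨⟨p, l⟩, rfl⟩
  case cq =>
    refine expand_listStart (M := .name) (Ns := [.oas]) (f := encodeName) rfl ?_ rfl rfl rfl rfl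
    ext w
    constructor
    · rintro ⟨a, rfl⟩
      exact ⟨_, ⟨a.target, rfl⟩, _, mem_langs_single.2 ⟨a.body, rfl⟩, rfl⟩
    · rintro ⟨_, ⟨p, rfl⟩, _, h, rfl⟩
      obtain ⟨l, rfl⟩ := mem_langs_single.1 h
      exact ⟨⟨p, l⟩, rfl⟩
  case glav =>
    refine expand_listStart (M := .name) (Ns := [.rels, .oas]) (f := encodeName) rfl ?_ rfl rfl
      rfl rfl
    ext w
    constructor
    · rintro ⟨a, rfl⟩
      exact ⟨_, ⟨a.target, rfl⟩, _, ⟨_, ⟨a.sourceBody, rfl⟩, _,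
        mem_langs_single.2 ⟨a.ontologyBody, rfl⟩, rfl⟩, rfl⟩
    · rintro ⟨_, ⟨p, rfl⟩, _, ⟨_, ⟨b, rfl⟩, _, h, rfl⟩, rfl⟩
      obtain ⟨l, rfl⟩ := mem_langs_single.1 h
      exact ⟨⟨p, b, l⟩, rfl⟩
  case input =>
    refine expand_listStart (M := .asr) (Ns := [.schs, .glavs, .rels, .tuples, .ucq])
      (f := encodeAssertion) rfl ?_ rfl rfl rfl rfl
    ext w
    constructor
    · rintro ⟨x, rfl⟩
      exact ⟨_, ⟨x.system.spec.ontology, rfl⟩, _, ⟨_, ⟨x.system.spec.schema, rfl⟩, _,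
        ⟨_, ⟨x.system.spec.mapping, rfl⟩, _, ⟨_, ⟨x.system.database, rfl⟩, _,
        ⟨_, ⟨x.dataset, rfl⟩, _, mem_langs_single.2 ⟨x.query, rfl⟩, rfl⟩, rfl⟩, rfl⟩, rfl⟩,
        by simp [Input.encode, encodeSystem, encodeSpecification]⟩
    · rintro ⟨_, ⟨o, rfl⟩, _, ⟨_, ⟨s, rfl⟩, _, ⟨_, ⟨m, rfl⟩, _, ⟨_, ⟨d, rfl⟩, _,
        ⟨_, ⟨l, rfl⟩, _, h, rfl⟩, rfl⟩, rfl⟩, rfl⟩, rfl⟩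
      obtain ⟨q, rfl⟩ := mem_langs_single.1 h
      exact ⟨⟨⟨⟨o, s, m⟩, d⟩, l, q⟩, by simp [Input.encode, encodeSystem, encodeSpecification]⟩
  case ucq =>
    ext w
    rw [expand_iff]
    simp only [prod, Option.some.injEq, exists_eq_left', mem_langs_single, reduceCtorEq,
      false_and, exists_false, false_or]
    constructor
    · rintro ⟨⟨_ | n, d⟩, rfl⟩
      · exact .inr ⟨_, ⟨d, rfl⟩, rfl⟩
      · exact .inl ⟨_, ⟨⟨n, d⟩, rfl⟩, rfl⟩
    · rintro (⟨_, ⟨⟨n, d⟩, rfl⟩, rfl⟩ | ⟨_, ⟨d, rfl⟩, rfl⟩)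
      exacts [⟨⟨n + 1, d⟩, rfl⟩, ⟨⟨0, d⟩, rfl⟩]
  case ac =>
    ext w
    rw [expand_iff]
    simp only [prod, Option.some.injEq, exists_eq_left', mem_langs_single, reduceCtorEq,
      false_and, exists_false, false_or]
    constructor
    · rintro ⟨_ | _ | a, rfl⟩
      exacts [.inl ⟨[], rfl, rfl⟩, .inr (.inr ⟨[], rfl, rfl⟩), .inr (.inl ⟨_, ⟨a, rfl⟩, rfl⟩)]
    · rintro (⟨_, rfl, rfl⟩ | ⟨_, ⟨a, rfl⟩, rfl⟩ | ⟨_, rfl, rfl⟩)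
      exacts [⟨.top, rfl⟩, ⟨.name a, rfl⟩, ⟨.bot, rfl⟩]
  case role =>
    ext w
    rw [expand_iff]
    simp only [prod, Option.some.injEq, exists_eq_left', mem_langs_single, reduceCtorEq,
      false_and, exists_false, or_false]
    constructor
    · rintro ⟨a | a, rfl⟩
      exacts [.inl ⟨_, ⟨a, rfl⟩, rfl⟩, .inr ⟨_, ⟨a, rfl⟩, rfl⟩]
    · rintro (⟨_, ⟨a, rfl⟩, rfl⟩ | ⟨_, ⟨a, rfl⟩, rfl⟩)
      exacts [⟨.atomic a, rfl⟩, ⟨.inv a, rfl⟩]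
  case bc =>
    ext w
    rw [expand_iff]
    simp only [prod, Option.some.injEq, exists_eq_left', mem_langs_single, reduceCtorEq,
      false_and, exists_false, or_false]
    constructor
    · rintro ⟨a | a, rfl⟩
      exacts [.inl ⟨_, ⟨a, rfl⟩, rfl⟩, .inr ⟨_, ⟨a, rfl⟩, rfl⟩]
    · rintro (⟨_, ⟨a, rfl⟩, rfl⟩ | ⟨_, ⟨a, rfl⟩, rfl⟩)
      exacts [⟨.atomic a, rfl⟩, ⟨.some a, rfl⟩]
  case asr =>
    ext w
    rw [expand_iff]
    simp only [prod, Option.some.injEq, exists_eq_left', langs, Set.mem_singleton_iff,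
      exists_eq_left, List.append_nil]
    constructor
    · rintro ⟨a | a | a | a, rfl⟩
      exacts [.inl ⟨_, ⟨_, ⟨a, rfl⟩, _, ⟨_, ⟨_, rfl⟩, rfl⟩, rfl⟩, rfl⟩,
        .inr (.inl ⟨_, ⟨_, ⟨a, rfl⟩, _, ⟨_, ⟨_, rfl⟩, rfl⟩, rfl⟩, rfl⟩),
        .inr (.inr (.inl ⟨_, ⟨_, ⟨a, rfl⟩, _, ⟨_, ⟨_, rfl⟩, rfl⟩, rfl⟩, rfl⟩)),
        .inr (.inr (.inr ⟨_, ⟨_, ⟨a, rfl⟩, _, ⟨_, ⟨_, rfl⟩, rfl⟩, rfl⟩, rfl⟩))]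
    · rintro (⟨_, ⟨_, ⟨a, rfl⟩, _, ⟨_, ⟨b, rfl⟩, rfl⟩, rfl⟩, rfl⟩ |
        ⟨_, ⟨_, ⟨a, rfl⟩, _, ⟨_, ⟨b, rfl⟩, rfl⟩, rfl⟩, rfl⟩ |
        ⟨_, ⟨_, ⟨a, rfl⟩, _, ⟨_, ⟨b, rfl⟩, rfl⟩, rfl⟩, rfl⟩ |
        ⟨_, ⟨_, ⟨a, rfl⟩, _, ⟨_, ⟨b, rfl⟩, rfl⟩, rfl⟩, rfl⟩)
      exacts [⟨.conceptIncl a b, rfl⟩, ⟨.roleIncl a b, rfl⟩, ⟨.conceptDisj a b, rfl⟩,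
        ⟨.roleDisj a b, rfl⟩]
  case oa =>
    ext w
    rw [expand_iff]
    simp only [prod, Option.some.injEq, exists_eq_left', langs, Set.mem_singleton_iff,
      exists_eq_left, List.append_nil, reduceCtorEq, false_and, exists_false, or_false]
    constructor
    · rintro ⟨a | a, rfl⟩
      exacts [.inl ⟨_, ⟨_, ⟨a, rfl⟩, _, ⟨_, ⟨_, rfl⟩, rfl⟩, rfl⟩, rfl⟩,
        .inr ⟨_, ⟨_, ⟨a, rfl⟩, _, ⟨_, ⟨_, rfl⟩, _, ⟨_, ⟨_, rfl⟩, rfl⟩, rfl⟩, rfl⟩, rfl⟩]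
    · rintro (⟨_, ⟨_, ⟨a, rfl⟩, _, ⟨_, ⟨b, rfl⟩, rfl⟩, rfl⟩, rfl⟩ |
        ⟨_, ⟨_, ⟨a, rfl⟩, _, ⟨_, ⟨b, rfl⟩, _, ⟨_, ⟨c, rfl⟩, rfl⟩, rfl⟩, rfl⟩, rfl⟩)
      exacts [⟨.concept a b, rfl⟩, ⟨.role a b c, rfl⟩]
  case tm =>
    ext w
    rw [expand_iff]
    simp only [prod, Option.some.injEq, exists_eq_left', langs, Set.mem_singleton_iff,
      exists_eq_left, List.append_nil]
    constructor
    · rintro ⟨a | ⟨m, c, z⟩ | ⟨R, t⟩ | a, rfl⟩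
      exacts [.inl ⟨_, ⟨_, ⟨a, rfl⟩, rfl⟩, rfl⟩,
        .inr (.inl ⟨_, ⟨_, ⟨m, rfl⟩, _, ⟨_, ⟨c, rfl⟩, _, ⟨_, ⟨z, rfl⟩, rfl⟩, rfl⟩, rfl⟩, rfl⟩),
        .inr (.inr (.inl ⟨_, ⟨_, ⟨R, rfl⟩, _, ⟨_, ⟨t, rfl⟩, rfl⟩, rfl⟩, rfl⟩)),
        .inr (.inr (.inr ⟨_, ⟨_, ⟨a, rfl⟩, rfl⟩, rfl⟩))]
    · rintro (⟨_, ⟨_, ⟨a, rfl⟩, rfl⟩, rfl⟩ |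
        ⟨_, ⟨_, ⟨m, rfl⟩, _, ⟨_, ⟨c, rfl⟩, _, ⟨_, ⟨z, rfl⟩, rfl⟩, rfl⟩, rfl⟩, rfl⟩ |
        ⟨_, ⟨_, ⟨R, rfl⟩, _, ⟨_, ⟨t, rfl⟩, rfl⟩, rfl⟩, rfl⟩ | ⟨_, ⟨_, ⟨a, rfl⟩, rfl⟩, rfl⟩)
      exacts [⟨.const a, rfl⟩, ⟨.null m c z, rfl⟩, ⟨.child R t, rfl⟩, ⟨.root a, rfl⟩]

/-- No word of a set is a proper prefix of another. -/
def PrefixFree (L : Set (List Sym)) : Prop :=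
  ∀ X ∈ L, ∀ Y ∈ L, ∀ s t, X ++ s = Y ++ t → X = Y ∧ s = t

theorem PrefixCode.prefixFree {α : Type} {f : α → List Sym} (h : PrefixCode f) :
    PrefixFree (Set.range f) := by
  rintro _ ⟨a, rfl⟩ _ ⟨b, rfl⟩ s t e
  obtain ⟨rfl, rfl⟩ := h _ _ _ _ e
  exact ⟨rfl, rfl⟩

/-- Prefix-freeness makes the splitting of a word into codes unique, so a splitting guessed by a
clause is the true one. -/
theorem prefixFree_lang (N : NT) : PrefixFree (lang N) := by
  cases N
  case name => exact prefixCode_name.prefixFree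
  case nat => exact prefixCode_nat.prefixFree
  case names => exact (prefixCode_list prefixCode_name).prefixFree
  case rel => exact prefixCode_relAtom.prefixFree
  case rels => exact (prefixCode_list prefixCode_relAtom).prefixFree
  case sch => exact prefixCode_schemaEntry.prefixFree
  case schs => exact (prefixCode_list prefixCode_schemaEntry).prefixFree
  case ac => exact prefixCode_atomicConcept.prefixFree
  case role => exact prefixCode_basicRole.prefixFree
  case bc => exact prefixCode_basicConcept.prefixFree
  case asr => exact prefixCode_assertion.prefixFree
  case asrs => exact (prefixCode_list prefixCode_assertion).prefixFree
  case oa => exact prefixCode_ontologyAtom.prefixFree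
  case oas => exact (prefixCode_list prefixCode_ontologyAtom).prefixFree
  case cq => exact prefixCode_cq.prefixFree
  case cqs => exact (prefixCode_list prefixCode_cq).prefixFree
  case ucq => exact prefixCode_ucq.prefixFree
  case glav => exact prefixCode_glav.prefixFree
  case glavs => exact (prefixCode_list prefixCode_glav).prefixFree
  case tuples => exact (prefixCode_list (prefixCode_list prefixCode_name)).prefixFree
  case input => exact prefixCode_input.prefixFree
  case tm => exact prefixCode_tm.prefixFree
  case ent => exact prefixCode_entry.prefixFree
  case ents => exact (prefixCode_list prefixCode_entry).prefixFree

/-! ### The clauses -/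

/-- The predicates of the clauses. -/
inductive Pr where
  | code (N : NT) | codes (Ns : List NT) | bad (N : NT) | bads (Ns : List NT)
  | neq | mem (N : NT) | notin (N : NT)
  | flds | inO | inS | inM | inD | inL | inQ | arity | notS | notL
  | len | dom | domall | outside | notdom | lk | tgt | sat | src | inst | pair | val
  | conc | role | incons | cert | top

/-- Ten variables are needed for `roleMap`, the clause with the most variables. -/
abbrev HRule := Horn.Rule Pr Sym 10

namespace Clause

def codesNil : HRule :=
  ⟨⟨.codes [], [[]]⟩,
    []⟩

def codesCons (N : NT) (Ns : List NT) : HRule :=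
  ⟨⟨.codes (N :: Ns), [[.var 0, .var 1]]⟩,
    [⟨.code N, [[.var 0]]⟩, ⟨.codes Ns, [[.var 1]]⟩]⟩

/-- A word has no prefix in a concatenation if it has none in the first category, or if its unique
prefix in that category leaves a rest that is refuted. The second case is `badsTail`. -/
def badsHead (N : NT) (Ns : List NT) : HRule :=
  ⟨⟨.bads (N :: Ns), [[.var 0]]⟩,
    [⟨.bad N, [[.var 0]]⟩]⟩

def badsTail (N : NT) (Ns : List NT) : HRule :=
  ⟨⟨.bads (N :: Ns), [[.var 0, .var 1]]⟩,
    [⟨.code N, [[.var 0]]⟩, ⟨.bads Ns, [[.var 1]]⟩]⟩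

def codeProd (N : NT) (a : Sym) (Ns : List NT) : HRule :=
  ⟨⟨.code N, [[.ch a, .var 0]]⟩,
    [⟨.codes Ns, [[.var 0]]⟩]⟩

def badProd (N : NT) (a : Sym) (Ns : List NT) : HRule :=
  ⟨⟨.bad N, [[.ch a, .var 0]]⟩,
    [⟨.bads Ns, [[.var 0]]⟩]⟩

def badNone (N : NT) (a : Sym) : HRule :=
  ⟨⟨.bad N, [[.ch a, .var 0]]⟩,
    []⟩

def badNil (N : NT) : HRule :=
  ⟨⟨.bad N, [[]]⟩,
    []⟩

/-- Horn clauses have no negation, so inequality gets derivations of its own: a common prefix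
followed by a visible difference. -/
def neqSame (a : Sym) : HRule :=
  ⟨⟨.neq, [[.ch a, .var 0], [.ch a, .var 1]]⟩,
    [⟨.neq, [[.var 0], [.var 1]]⟩]⟩

def neqDiff (a : Sym) (b : Sym) : HRule :=
  ⟨⟨.neq, [[.ch a, .var 0], [.ch b, .var 1]]⟩,
    []⟩

def neqNilLeft (a : Sym) : HRule :=
  ⟨⟨.neq, [[], [.ch a, .var 0]]⟩,
    []⟩

def neqNilRight (a : Sym) : HRule :=
  ⟨⟨.neq, [[.ch a, .var 0], []]⟩,
    []⟩

def memHead (N : NT) : HRule :=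
  ⟨⟨.mem N, [[.var 0], [.ch .item, .var 0, .var 1]]⟩,
    [⟨.code N, [[.var 0]]⟩]⟩

def memTail (N : NT) : HRule :=
  ⟨⟨.mem N, [[.var 0], [.ch .item, .var 1, .var 2]]⟩,
    [⟨.code N, [[.var 1]]⟩, ⟨.mem N, [[.var 0], [.var 2]]⟩]⟩

def notinNil (N : NT) : HRule :=
  ⟨⟨.notin N, [[.var 0], [.ch .close]]⟩,
    []⟩

def notinCons (N : NT) : HRule :=
  ⟨⟨.notin N, [[.var 0], [.ch .item, .var 1, .var 2]]⟩,
    [⟨.code N, [[.var 1]]⟩, ⟨.neq, [[.var 0], [.var 1]]⟩, ⟨.notin N, [[.var 0], [.var 2]]⟩]⟩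

/-- The splitting of the input into its seven parts is guessed and then justified by recognising
each part. -/
def fields : HRule :=
  ⟨⟨.flds, [[.var 0], [.var 1], [.var 2], [.var 3], [.var 4], [.var 5], [.var 6]]⟩,
    [⟨.code .asrs, [[.var 0]]⟩,
      ⟨.code .schs, [[.var 1]]⟩,
      ⟨.code .glavs, [[.var 2]]⟩,
      ⟨.code .rels, [[.var 3]]⟩,
      ⟨.code .tuples, [[.var 4]]⟩,
      ⟨.code .nat, [[.var 5]]⟩,
      ⟨.code .cqs, [[.var 6]]⟩]⟩

def inOnt : HRule :=
  ⟨⟨.inO, [[.var 0], [.var 1, .var 2, .var 3, .var 4, .var 5, .var 6, .var 7]]⟩,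
    [⟨.flds, [[.var 1], [.var 2], [.var 3], [.var 4], [.var 5], [.var 6], [.var 7]]⟩,
      ⟨.mem .asr, [[.var 0], [.var 1]]⟩]⟩

def inSch : HRule :=
  ⟨⟨.inS, [[.var 0], [.var 1, .var 2, .var 3, .var 4, .var 5, .var 6, .var 7]]⟩,
    [⟨.flds, [[.var 1], [.var 2], [.var 3], [.var 4], [.var 5], [.var 6], [.var 7]]⟩,
      ⟨.mem .sch, [[.var 0], [.var 2]]⟩]⟩

def inMap : HRule :=
  ⟨⟨.inM, [[.var 0], [.var 1, .var 2, .var 3, .var 4, .var 5, .var 6, .var 7]]⟩,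
    [⟨.flds, [[.var 1], [.var 2], [.var 3], [.var 4], [.var 5], [.var 6], [.var 7]]⟩,
      ⟨.mem .glav, [[.var 0], [.var 3]]⟩]⟩

def inDat : HRule :=
  ⟨⟨.inD, [[.var 0], [.var 1, .var 2, .var 3, .var 4, .var 5, .var 6, .var 7]]⟩,
    [⟨.flds, [[.var 1], [.var 2], [.var 3], [.var 4], [.var 5], [.var 6], [.var 7]]⟩,
      ⟨.mem .rel, [[.var 0], [.var 4]]⟩]⟩

def inLam : HRule :=
  ⟨⟨.inL, [[.var 0], [.var 1, .var 2, .var 3, .var 4, .var 5, .var 6, .var 7]]⟩,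
    [⟨.flds, [[.var 1], [.var 2], [.var 3], [.var 4], [.var 5], [.var 6], [.var 7]]⟩,
      ⟨.mem .names, [[.var 0], [.var 5]]⟩]⟩

def inQue : HRule :=
  ⟨⟨.inQ, [[.var 0], [.var 1, .var 2, .var 3, .var 4, .var 5, .var 6, .var 7]]⟩,
    [⟨.flds, [[.var 1], [.var 2], [.var 3], [.var 4], [.var 5], [.var 6], [.var 7]]⟩,
      ⟨.mem .cq, [[.var 0], [.var 7]]⟩]⟩

def isArity : HRule :=
  ⟨⟨.arity, [[.var 0], [.var 1, .var 2, .var 3, .var 4, .var 5, .var 0, .var 6]]⟩,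
    [⟨.flds, [[.var 1], [.var 2], [.var 3], [.var 4], [.var 5], [.var 0], [.var 6]]⟩]⟩

def notSch : HRule :=
  ⟨⟨.notS, [[.var 0], [.var 1, .var 2, .var 3, .var 4, .var 5, .var 6, .var 7]]⟩,
    [⟨.flds, [[.var 1], [.var 2], [.var 3], [.var 4], [.var 5], [.var 6], [.var 7]]⟩,
      ⟨.notin .sch, [[.var 0], [.var 2]]⟩]⟩

def notLam : HRule :=
  ⟨⟨.notL, [[.var 0], [.var 1, .var 2, .var 3, .var 4, .var 5, .var 6, .var 7]]⟩,
    [⟨.flds, [[.var 1], [.var 2], [.var 3], [.var 4], [.var 5], [.var 6], [.var 7]]⟩,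
      ⟨.notin .names, [[.var 0], [.var 5]]⟩]⟩

def lenNil : HRule :=
  ⟨⟨.len, [[.ch .close], [.ch .close]]⟩,
    []⟩

def lenCons : HRule :=
  ⟨⟨.len, [[.ch .item, .var 0, .var 1], [.ch .one, .var 2]]⟩,
    [⟨.code .name, [[.var 0]]⟩, ⟨.len, [[.var 1], [.var 2]]⟩]⟩

def domFact : HRule :=
  ⟨⟨.dom, [[.var 0], [.var 1]]⟩,
    [⟨.inD, [[.var 2, .var 3], [.var 1]]⟩,
      ⟨.code .name, [[.var 2]]⟩,
      ⟨.mem .name, [[.var 0], [.var 3]]⟩]⟩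

def domallNil : HRule :=
  ⟨⟨.domall, [[.ch .close], [.var 0]]⟩,
    []⟩

def domallCons : HRule :=
  ⟨⟨.domall, [[.ch .item, .var 0, .var 1], [.var 2]]⟩,
    [⟨.dom, [[.var 0], [.var 2]]⟩, ⟨.domall, [[.var 1], [.var 2]]⟩]⟩

def outsideNil : HRule :=
  ⟨⟨.outside, [[.var 0], [.ch .close]]⟩,
    []⟩

def outsideCons : HRule :=
  ⟨⟨.outside, [[.var 0], [.ch .item, .var 1, .var 2, .var 3]]⟩,
    [⟨.code .name, [[.var 1]]⟩,
      ⟨.code .names, [[.var 2]]⟩,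
      ⟨.notin .name, [[.var 0], [.var 2]]⟩,
      ⟨.outside, [[.var 0], [.var 3]]⟩]⟩

def notDom : HRule :=
  ⟨⟨.notdom, [[.var 0], [.var 1, .var 2, .var 3, .var 4, .var 5, .var 6, .var 7]]⟩,
    [⟨.flds, [[.var 1], [.var 2], [.var 3], [.var 4], [.var 5], [.var 6], [.var 7]]⟩,
      ⟨.outside, [[.var 0], [.var 4]]⟩]⟩

def lkHead : HRule :=
  ⟨⟨.lk, [[.var 0], [.var 1], [.ch .item, .var 0, .var 1, .var 2]]⟩,
    [⟨.code .name, [[.var 0]]⟩, ⟨.code .tm, [[.var 1]]⟩]⟩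

/-- The inequality ensures that the first entry for a variable is returned, so that a list of
entries denotes a function even if it mentions a variable twice. -/
def lkTail : HRule :=
  ⟨⟨.lk, [[.var 0], [.var 1], [.ch .item, .var 2, .var 3, .var 4]]⟩,
    [⟨.code .name, [[.var 2]]⟩,
      ⟨.code .tm, [[.var 3]]⟩,
      ⟨.neq, [[.var 0], [.var 2]]⟩,
      ⟨.lk, [[.var 0], [.var 1], [.var 4]]⟩]⟩

def tgtNil : HRule :=
  ⟨⟨.tgt, [[.ch .close], [.var 0], [.ch .close]]⟩,
    []⟩

/-- The letter `.zero` in the looked-up value forces it to be a constant. -/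
def tgtCons : HRule :=
  ⟨⟨.tgt, [[.ch .item, .var 0, .var 1], [.var 2], [.ch .item, .var 3, .var 4]]⟩,
    [⟨.code .name, [[.var 0]]⟩,
      ⟨.code .name, [[.var 3]]⟩,
      ⟨.lk, [[.var 0], [.ch .zero, .var 3], [.var 2]]⟩,
      ⟨.tgt, [[.var 1], [.var 2], [.var 4]]⟩]⟩

def satNil : HRule :=
  ⟨⟨.sat, [[.ch .close], [.var 0], [.var 1]]⟩,
    []⟩

def satConcept : HRule :=
  ⟨⟨.sat, [[.ch .item, .ch .zero, .var 0, .var 1, .var 2], [.var 3], [.var 4]]⟩,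
    [⟨.code .ac, [[.var 0]]⟩,
      ⟨.code .name, [[.var 1]]⟩,
      ⟨.lk, [[.var 1], [.var 5], [.var 3]]⟩,
      ⟨.conc, [[.ch .zero, .var 0], [.var 5], [.var 4]]⟩,
      ⟨.sat, [[.var 2], [.var 3], [.var 4]]⟩]⟩

def satRole : HRule :=
  ⟨⟨.sat, [[.ch .item, .ch .one, .var 0, .var 1, .var 2, .var 3], [.var 4], [.var 5]]⟩,
    [⟨.code .name, [[.var 0]]⟩,
      ⟨.code .name, [[.var 1]]⟩,
      ⟨.code .name, [[.var 2]]⟩,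
      ⟨.lk, [[.var 1], [.var 6], [.var 4]]⟩,
      ⟨.lk, [[.var 2], [.var 7], [.var 4]]⟩,
      ⟨.role, [[.ch .zero, .var 0], [.var 6], [.var 7], [.var 5]]⟩,
      ⟨.sat, [[.var 3], [.var 4], [.var 5]]⟩]⟩

def srcNil : HRule :=
  ⟨⟨.src, [[.ch .close], [.var 0], [.var 1]]⟩,
    []⟩

def srcCons : HRule :=
  ⟨⟨.src, [[.ch .item, .var 0, .var 1, .var 2], [.var 3], [.var 4]]⟩,
    [⟨.code .name, [[.var 0]]⟩,
      ⟨.code .names, [[.var 1]]⟩,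
      ⟨.tgt, [[.var 1], [.var 3], [.var 5]]⟩,
      ⟨.inD, [[.var 0, .var 5], [.var 4]]⟩,
      ⟨.src, [[.var 2], [.var 3], [.var 4]]⟩]⟩

/-- Variable 5 is the guessed assignment of constants to the variables of the source query. It
occurs in the body only and is thus existentially quantified. -/
def mapInst : HRule :=
  ⟨⟨.inst, [[.var 0], [.var 1], [.var 2], [.var 3], [.var 4]]⟩,
    [⟨.inM, [[.var 0, .var 1, .var 2], [.var 4]]⟩,
      ⟨.code .names, [[.var 0]]⟩,
      ⟨.code .rels, [[.var 1]]⟩,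
      ⟨.code .ents, [[.var 5]]⟩,
      ⟨.tgt, [[.var 0], [.var 5], [.var 3]]⟩,
      ⟨.src, [[.var 1], [.var 5], [.var 4]]⟩,
      ⟨.domall, [[.var 3], [.var 4]]⟩]⟩

def pairHead : HRule :=
  ⟨⟨.pair, [[.var 0], [.var 1], [.ch .item, .var 0, .var 2], [.ch .item, .var 1, .var 3]]⟩,
    [⟨.code .name, [[.var 0]]⟩, ⟨.code .name, [[.var 1]]⟩]⟩

def pairTail : HRule :=
  ⟨⟨.pair, [[.var 0], [.var 1], [.ch .item, .var 2, .var 3], [.ch .item, .var 4, .var 5]]⟩,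
    [⟨.code .name, [[.var 2]]⟩,
      ⟨.code .name, [[.var 4]]⟩,
      ⟨.pair, [[.var 0], [.var 1], [.var 3], [.var 5]]⟩]⟩

def valConst : HRule :=
  ⟨⟨.val, [[.var 0], [.ch .zero, .var 1], [.var 2], [.var 3], [.var 4], [.var 5]]⟩,
    [⟨.pair, [[.var 0], [.var 1], [.var 2], [.var 5]]⟩]⟩

/-- The word after `.one` spells the mapping assertion, the tuple and the variable, so it is the
code of the corresponding null. -/
def valNull : HRule :=
  ⟨⟨.val, [[.var 0], [.ch .one, .var 1, .var 2, .var 3, .var 4, .var 0], [.var 1], [.var 2], [.var 3], [.var 4]]⟩,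
    [⟨.notin .name, [[.var 0], [.var 1]]⟩]⟩

/-- Domains are non-empty, so `⊤` has a representative even if the database is empty. Without it, an
ontology that makes `⊤` unsatisfiable would go unnoticed in that case. -/
def concRootTop : HRule :=
  ⟨⟨.conc, [[.ch .zero, .ch .zero], [.ch .close, .ch .zero, .ch .zero], [.var 0]]⟩,
    []⟩

def concDom : HRule :=
  ⟨⟨.conc, [[.ch .zero, .ch .zero], [.ch .zero, .var 0], [.var 1]]⟩,
    [⟨.dom, [[.var 0], [.var 1]]⟩]⟩

def concMap : HRule :=
  ⟨⟨.conc, [[.ch .zero, .var 0], [.var 1], [.var 2]]⟩,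
    [⟨.inst, [[.var 3], [.var 4], [.var 5], [.var 6], [.var 2]]⟩,
      ⟨.mem .oa, [[.ch .zero, .var 0, .var 7], [.var 5]]⟩,
      ⟨.code .ac, [[.var 0]]⟩,
      ⟨.code .name, [[.var 7]]⟩,
      ⟨.val, [[.var 7], [.var 1], [.var 3], [.var 4], [.var 5], [.var 6]]⟩]⟩

def roleMap : HRule :=
  ⟨⟨.role, [[.ch .zero, .var 0], [.var 1], [.var 2], [.var 3]]⟩,
    [⟨.inst, [[.var 4], [.var 5], [.var 6], [.var 7], [.var 3]]⟩,
      ⟨.mem .oa, [[.ch .one, .var 0, .var 8, .var 9], [.var 6]]⟩,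
      ⟨.code .name, [[.var 0]]⟩,
      ⟨.code .name, [[.var 8]]⟩,
      ⟨.code .name, [[.var 9]]⟩,
      ⟨.val, [[.var 8], [.var 1], [.var 4], [.var 5], [.var 6], [.var 7]]⟩,
      ⟨.val, [[.var 9], [.var 2], [.var 4], [.var 5], [.var 6], [.var 7]]⟩]⟩

def roleInv : HRule :=
  ⟨⟨.role, [[.ch .one, .var 0], [.var 1], [.var 2], [.var 3]]⟩,
    [⟨.role, [[.ch .zero, .var 0], [.var 2], [.var 1], [.var 3]]⟩]⟩

def roleUninv : HRule :=
  ⟨⟨.role, [[.ch .zero, .var 0], [.var 1], [.var 2], [.var 3]]⟩,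
    [⟨.role, [[.ch .one, .var 0], [.var 2], [.var 1], [.var 3]]⟩]⟩

def concSome : HRule :=
  ⟨⟨.conc, [[.ch .one, .var 0], [.var 1], [.var 2]]⟩,
    [⟨.role, [[.var 0], [.var 1], [.var 3], [.var 2]]⟩]⟩

/-- This is Skolemisation: an element of `∃R` has the successor named after `R` and the element. -/
def roleChild : HRule :=
  ⟨⟨.role, [[.var 0], [.var 1], [.ch .item, .var 0, .var 1], [.var 2]]⟩,
    [⟨.conc, [[.ch .one, .var 0], [.var 1], [.var 2]]⟩]⟩

def concIncl : HRule :=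
  ⟨⟨.conc, [[.var 0], [.var 1], [.var 2]]⟩,
    [⟨.inO, [[.ch .zero, .var 3, .var 0], [.var 2]]⟩,
      ⟨.code .bc, [[.var 3]]⟩,
      ⟨.conc, [[.var 3], [.var 1], [.var 2]]⟩]⟩

def roleIncl : HRule :=
  ⟨⟨.role, [[.var 0], [.var 1], [.var 2], [.var 3]]⟩,
    [⟨.inO, [[.ch .one, .var 4, .var 0], [.var 3]]⟩,
      ⟨.code .role, [[.var 4]]⟩,
      ⟨.role, [[.var 4], [.var 1], [.var 2], [.var 3]]⟩]⟩

def concTop : HRule :=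
  ⟨⟨.conc, [[.ch .zero, .ch .zero], [.var 0], [.var 1]]⟩,
    [⟨.conc, [[.var 2], [.var 0], [.var 1]]⟩]⟩

/-- The term `root B` stands for some member of `B`. It makes it possible to forget how deep in the
model a member was found, which keeps terms short. -/
def concRoot : HRule :=
  ⟨⟨.conc, [[.var 0], [.ch .close, .var 0], [.var 1]]⟩,
    [⟨.conc, [[.var 0], [.var 2], [.var 1]]⟩]⟩

def inconsBot : HRule :=
  ⟨⟨.incons, [[.var 0]]⟩,
    [⟨.conc, [[.ch .zero, .ch .close], [.var 1], [.var 0]]⟩]⟩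

def inconsConc : HRule :=
  ⟨⟨.incons, [[.var 0]]⟩,
    [⟨.inO, [[.ch .item, .var 1, .var 2], [.var 0]]⟩,
      ⟨.code .bc, [[.var 1]]⟩,
      ⟨.conc, [[.var 1], [.var 3], [.var 0]]⟩,
      ⟨.conc, [[.var 2], [.var 3], [.var 0]]⟩]⟩

def inconsRole : HRule :=
  ⟨⟨.incons, [[.var 0]]⟩,
    [⟨.inO, [[.ch .close, .var 1, .var 2], [.var 0]]⟩,
      ⟨.code .role, [[.var 1]]⟩,
      ⟨.role, [[.var 1], [.var 3], [.var 4], [.var 0]]⟩,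
      ⟨.role, [[.var 2], [.var 3], [.var 4], [.var 0]]⟩]⟩

def certIncons : HRule :=
  ⟨⟨.cert, [[.var 0], [.var 1]]⟩,
    [⟨.incons, [[.var 1]]⟩]⟩

def certAnswer : HRule :=
  ⟨⟨.cert, [[.var 0], [.var 1]]⟩,
    [⟨.inQ, [[.var 2, .var 3], [.var 1]]⟩,
      ⟨.code .names, [[.var 2]]⟩,
      ⟨.code .ents, [[.var 4]]⟩,
      ⟨.tgt, [[.var 2], [.var 4], [.var 0]]⟩,
      ⟨.sat, [[.var 3], [.var 4], [.var 1]]⟩]⟩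

def topBad : HRule :=
  ⟨⟨.top, [[.var 0]]⟩,
    [⟨.bad .input, [[.var 0]]⟩]⟩

/-- With `topBad` this covers all words that code no input: either no prefix codes an input or a
proper one does. -/
def topTrail (a : Sym) : HRule :=
  ⟨⟨.top, [[.var 0, .ch a, .var 1]]⟩,
    [⟨.code .input, [[.var 0]]⟩]⟩

def topSchema : HRule :=
  ⟨⟨.top, [[.var 0]]⟩,
    [⟨.inS, [[.var 1, .var 2], [.var 0]]⟩,
      ⟨.inS, [[.var 1, .var 3], [.var 0]]⟩,
      ⟨.code .name, [[.var 1]]⟩,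
      ⟨.neq, [[.var 2], [.var 3]]⟩]⟩

def topFact : HRule :=
  ⟨⟨.top, [[.var 0]]⟩,
    [⟨.inD, [[.var 1, .var 2], [.var 0]]⟩,
      ⟨.code .name, [[.var 1]]⟩,
      ⟨.len, [[.var 2], [.var 3]]⟩,
      ⟨.notS, [[.var 1, .var 3], [.var 0]]⟩]⟩

def topMapping : HRule :=
  ⟨⟨.top, [[.var 0]]⟩,
    [⟨.inM, [[.var 1, .var 2, .var 3], [.var 0]]⟩,
      ⟨.code .names, [[.var 1]]⟩,
      ⟨.code .rels, [[.var 2]]⟩,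
      ⟨.mem .rel, [[.var 4, .var 5], [.var 2]]⟩,
      ⟨.code .name, [[.var 4]]⟩,
      ⟨.len, [[.var 5], [.var 6]]⟩,
      ⟨.notS, [[.var 4, .var 6], [.var 0]]⟩]⟩

def topArity : HRule :=
  ⟨⟨.top, [[.var 0]]⟩,
    [⟨.inQ, [[.var 1, .var 2], [.var 0]]⟩,
      ⟨.code .names, [[.var 1]]⟩,
      ⟨.len, [[.var 1], [.var 3]]⟩,
      ⟨.neq, [[.var 3], [.var 4]]⟩,
      ⟨.arity, [[.var 4], [.var 0]]⟩]⟩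

def topLength : HRule :=
  ⟨⟨.top, [[.var 0]]⟩,
    [⟨.inL, [[.var 1], [.var 0]]⟩,
      ⟨.len, [[.var 1], [.var 2]]⟩,
      ⟨.neq, [[.var 2], [.var 3]]⟩,
      ⟨.arity, [[.var 3], [.var 0]]⟩]⟩

def topOutside : HRule :=
  ⟨⟨.top, [[.var 0]]⟩,
    [⟨.inL, [[.var 1], [.var 0]]⟩,
      ⟨.mem .name, [[.var 2], [.var 1]]⟩,
      ⟨.notdom, [[.var 2], [.var 0]]⟩]⟩

/-- The genuine counterexample, guessed as variable 1: a tuple over the database, of the right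
arity, that is certain and missing from the dataset. -/
def topCert : HRule :=
  ⟨⟨.top, [[.var 0]]⟩,
    [⟨.domall, [[.var 1], [.var 0]]⟩,
      ⟨.len, [[.var 1], [.var 2]]⟩,
      ⟨.arity, [[.var 2], [.var 0]]⟩,
      ⟨.notL, [[.var 1], [.var 0]]⟩,
      ⟨.cert, [[.var 1], [.var 0]]⟩]⟩

/-- The clauses for a concatenation. -/
def seqClauses : List NT → List HRule
  | [] => [codesNil]
  | N :: Ns => [codesCons N Ns, badsHead N Ns, badsTail N Ns]

/-- The clauses for a category and a first letter. -/
def letterClauses (N : NT) (a : Sym) : List HRule :=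
  match prod N a with
  | none => [badNone N a]
  | some Ns => codeProd N a Ns :: badProd N a Ns :: Ns.tails.flatMap seqClauses

def allSyms : List Sym := [.zero, .one, .item, .close]

def allNTs : List NT :=
  [.name, .nat, .names, .rel, .rels, .sch, .schs, .ac, .role, .bc, .asr, .asrs, .oa, .oas,
    .cq, .cqs, .ucq, .glav, .glavs, .tuples, .input, .tm, .ent, .ents]

theorem mem_allSyms (a : Sym) : a ∈ allSyms := by cases a <;> simp [allSyms]

theorem mem_allNTs (N : NT) : N ∈ allNTs := by cases N <;> simp [allNTs]

/-- The clauses for a category. -/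
def categoryClauses (N : NT) : List HRule :=
  badNil N :: memHead N :: memTail N :: notinNil N :: notinCons N ::
    allSyms.flatMap (letterClauses N)

open Classical in
/-- The clauses with a distinguished letter. -/
noncomputable def symClauses (a : Sym) : List HRule :=
  neqSame a :: neqNilLeft a :: neqNilRight a :: topTrail a ::
    (allSyms.filter (· ≠ a)).map (neqDiff a)

/-- The remaining clauses. -/
def basicClauses : List HRule :=
  [fields, inOnt, inSch, inMap, inDat, inLam, inQue, isArity, notSch, notLam, lenNil, lenCons,
    domFact, domallNil, domallCons, outsideNil, outsideCons, notDom, lkHead, lkTail, tgtNil,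
    tgtCons, satNil, satConcept, satRole, srcNil, srcCons, mapInst, pairHead, pairTail,
    valConst, valNull, concRootTop, concDom, concMap, roleMap, roleInv, roleUninv, concSome,
    roleChild, concIncl, roleIncl, concTop, concRoot, inconsBot, inconsConc, inconsRole,
    certIncons, certAnswer, topBad, topSchema, topFact, topMapping, topArity, topLength,
    topOutside, topCert]

end Clause

open Clause in
/-- The clauses that characterize the complement of Sound-VQDEF. -/
noncomputable def clauses : List HRule :=
  allNTs.flatMap categoryClauses ++ (allSyms.flatMap symClauses ++ basicClauses)

theorem basic_mem {r : HRule} (h : r ∈ Clause.basicClauses) : r ∈ clauses :=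
  List.mem_append_right _ (List.mem_append_right _ h)

theorem sym_mem {r : HRule} {a : Sym} (h : r ∈ Clause.symClauses a) : r ∈ clauses :=
  List.mem_append_right _ (List.mem_append_left _ (List.mem_flatMap.2 ⟨a, Clause.mem_allSyms a, h⟩))

theorem category_mem {r : HRule} {N : NT} (h : r ∈ Clause.categoryClauses N) : r ∈ clauses :=
  List.mem_append_left _ (List.mem_flatMap.2 ⟨N, Clause.mem_allNTs N, h⟩)

theorem letter_mem {r : HRule} {N : NT} {a : Sym} (h : r ∈ Clause.letterClauses N a) :
    r ∈ clauses :=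
  category_mem (N := N) (by
    simp only [Clause.categoryClauses, List.mem_cons, List.mem_flatMap]
    exact .inr (.inr (.inr (.inr (.inr ⟨a, Clause.mem_allSyms a, h⟩)))))

end OBDM

/-! ### Soundness of the clauses -/

namespace OBDM

namespace Interpretation

variable (I : Interpretation)

/-- The objects that the head of a mapping assertion requires. -/
def Witnesses (m : GLAVAssertion) (c : List Const) (h : Var → I.Domain) : Prop :=
  m.target.map h = c.map I.const ∧ ∀ α ∈ m.ontologyBody, I.SatAtom h α

open Classical in
/-- A choice of an object with the given property, if there is one. -/
noncomputable def choice {α : Type} [Nonempty α] (p : α → Prop) : α :=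
  if h : ∃ a, p a then h.choose else Classical.arbitrary α

theorem choice_spec {α : Type} [Nonempty α] {p : α → Prop} (h : ∃ a, p a) : p (choice p) := by
  rw [choice, dif_pos h]
  exact h.choose_spec

/-- The value of a term. -/
noncomputable def value : Tm → I.Domain
  | .const c => I.const c
  | .null m c z => haveI := I.nonempty; choice (I.Witnesses m c) z
  | .child R t => haveI := I.nonempty; choice fun o => (value t, o) ∈ I.basicRole R
  | .root B => haveI := I.nonempty; choice fun o => o ∈ I.basicConcept B

/-- The whole assignment is chosen at once for an instance of a mapping assertion, so its nulls
satisfy the head jointly and not just one by one. -/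
theorem value_null {m : GLAVAssertion} {c : List Const} {h : Var → I.Domain}
    (hh : I.Witnesses m c h) : I.Witnesses m c fun z => I.value (.null m c z) := by
  have := I.nonempty
  exact choice_spec ⟨h, hh⟩

theorem value_child {R : BasicRole} {t : Tm} (h : I.value t ∈ I.basicConcept (.some R)) :
    (I.value t, I.value (.child R t)) ∈ I.basicRole R := by
  have := I.nonempty
  exact choice_spec h

theorem value_root {B : BasicConcept} {o : I.Domain} (h : o ∈ I.basicConcept B) :
    I.value (.root B) ∈ I.basicConcept B := by
  have := I.nonempty
  exact choice_spec (p := fun o => o ∈ I.basicConcept B) ⟨o, h⟩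

end Interpretation

/-- The term that a list of entries assigns to a variable. -/
def assigned (hl : List (Name × Tm)) (v : Var) : Tm :=
  (hl.lookup v).getD (.root (.atomic .top))

/-- The constant that a list of entries assigns to a variable. -/
def assignedConst (hl : List (Name × Tm)) (v : Var) : Const :=
  match hl.lookup v with
  | some (Tm.const c) => c
  | _ => []

/-- What the predicates express. -/
def Meaning : Horn.Fact Pr Sym → Prop
  | (.code N, [X]) => X ∈ lang N
  | (.codes Ns, [X]) => X ∈ langs Ns
  | (.bad N, [X]) => ∀ Y ∈ lang N, ∀ t, X ≠ Y ++ t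
  | (.bads Ns, [X]) => ∀ Y ∈ langs Ns, ∀ t, X ≠ Y ++ t
  | (.neq, [X, Y]) => X ≠ Y
  | (.mem N, [X, S]) => X ∈ lang N ∧
      ∀ l : List (List Sym), (∀ w ∈ l, w ∈ lang N) → S = encodeList id l → X ∈ l
  | (.notin N, [X, S]) =>
      ∀ l : List (List Sym), (∀ w ∈ l, w ∈ lang N) → S = encodeList id l → X ∉ l
  | (.flds, [O, S, M, D, L, A, Q]) => O ∈ lang .asrs ∧ S ∈ lang .schs ∧ M ∈ lang .glavs ∧
      D ∈ lang .rels ∧ L ∈ lang .tuples ∧ A ∈ lang .nat ∧ Q ∈ lang .cqs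
  -- Facts about the input are stated for every input coded by `W`. There is at most one by
  -- injectivity of the encoding; if there is none, the statements about it are vacuous.
  | (.inO, [E, W]) => ∀ x : Input, x.encode = W →
      ∃ a ∈ x.system.spec.ontology, E = encodeAssertion a
  | (.inS, [E, W]) => ∀ x : Input, x.encode = W →
      ∃ a ∈ x.system.spec.schema, E = encodeSchemaEntry a
  | (.inM, [E, W]) => ∀ x : Input, x.encode = W → ∃ a ∈ x.system.spec.mapping, E = encodeGLAV a
  | (.inD, [E, W]) => ∀ x : Input, x.encode = W → ∃ a ∈ x.system.database, E = encodeRelAtom a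
  | (.inL, [E, W]) => ∀ x : Input, x.encode = W → ∃ a ∈ x.dataset, E = encodeList encodeName a
  | (.inQ, [E, W]) => ∀ x : Input, x.encode = W → ∃ a ∈ x.query.disjuncts, E = encodeCQ a
  | (.arity, [A, W]) => ∀ x : Input, x.encode = W → A = encodeNat x.query.arity
  | (.notS, [E, W]) => ∀ x : Input, x.encode = W →
      ∀ a ∈ x.system.spec.schema, E ≠ encodeSchemaEntry a
  | (.notL, [E, W]) => ∀ x : Input, x.encode = W → ∀ a ∈ x.dataset, E ≠ encodeList encodeName a
  | (.len, [L, N]) => ∀ l, L = encodeList encodeName l → N = encodeNat l.length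
  | (.dom, [X, W]) => ∃ c, X = encodeName c ∧
      ∀ x : Input, x.encode = W → c ∈ Database.dom x.system.database
  | (.domall, [C, W]) => ∃ cs, C = encodeList encodeName cs ∧
      ∀ x : Input, x.encode = W → ∀ c ∈ cs, c ∈ Database.dom x.system.database
  | (.outside, [X, D]) => ∀ d : Database, D = encodeList encodeRelAtom d →
      ∀ c ∈ Database.dom d, X ≠ encodeName c
  | (.notdom, [X, W]) => ∀ x : Input, x.encode = W →
      ∀ c ∈ Database.dom x.system.database, X ≠ encodeName c
  | (.lk, [V, T, H]) => ∃ t, T = encodeTm t ∧ ∀ hl v, H = encodeList encodeEntry hl →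
      V = encodeName v → hl.lookup v = some t
  | (.tgt, [T, H, C]) => ∃ ts cs, T = encodeList encodeName ts ∧ C = encodeList encodeName cs ∧
      ∀ hl, H = encodeList encodeEntry hl → ts.map (fun v => hl.lookup v) = cs.map fun c => some (Tm.const c)
  | (.sat, [B, H, W]) => ∀ x : Input, x.encode = W → ∀ hl, H = encodeList encodeEntry hl →
      ∀ b, B = encodeList encodeOntologyAtom b → ∀ I : Interpretation, I.IsModel x.system →
      ∀ α ∈ b, I.SatAtom (fun v => I.value (assigned hl v)) α
  | (.src, [B, H, W]) => ∀ x : Input, x.encode = W → ∀ hl, H = encodeList encodeEntry hl →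
      ∀ b, B = encodeList encodeRelAtom b → ∀ α ∈ b, α.map (assignedConst hl) ∈ x.system.database
  | (.inst, [T, B, G, C, W]) => ∀ x : Input, x.encode = W → ∃ m ∈ x.system.spec.mapping,
      ∃ cs ∈ sourceAnswers m.sourceQuery x.system.database, T = encodeList encodeName m.target ∧
      B = encodeList encodeRelAtom m.sourceBody ∧
      G = encodeList encodeOntologyAtom m.ontologyBody ∧ C = encodeList encodeName cs
  | (.pair, [V, X, T, C]) => ∃ v c, V = encodeName v ∧ X = encodeName c ∧ ∀ ts cs,
      T = encodeList encodeName ts → C = encodeList encodeName cs → (v, c) ∈ ts.zip cs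
  | (.val, [V, Y, T, B, G, C]) => ∀ (v : Var) (m : GLAVAssertion) (cs : List Const),
      V = encodeName v → T = encodeList encodeName m.target →
      B = encodeList encodeRelAtom m.sourceBody →
      G = encodeList encodeOntologyAtom m.ontologyBody → C = encodeList encodeName cs →
      (∃ c, Y = encodeTm (.const c) ∧ (v, c) ∈ m.target.zip cs) ∨
        (Y = encodeTm (.null m cs v) ∧ v ∉ m.target)
  | (.conc, [B, T, W]) => ∀ x : Input, x.encode = W → ∃ b t, B = encodeBasicConcept b ∧
      T = encodeTm t ∧ ∀ I : Interpretation, I.IsModel x.system → I.value t ∈ I.basicConcept b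
  | (.role, [R, T, U, W]) => ∀ x : Input, x.encode = W → ∃ r t u, R = encodeBasicRole r ∧
      T = encodeTm t ∧ U = encodeTm u ∧
      ∀ I : Interpretation, I.IsModel x.system → (I.value t, I.value u) ∈ I.basicRole r
  | (.incons, [W]) => ∀ x : Input, x.encode = W → ∀ I : Interpretation, ¬ I.IsModel x.system
  | (.cert, [C, W]) => ∀ x : Input, x.encode = W → ∀ cs, C = encodeList encodeName cs →
      ∀ I : Interpretation, I.IsModel x.system → cs.map I.const ∈ I.ucqAnswers x.query
  | (.top, [W]) => W ∉ soundVQDEF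
  -- No clause builds a fact with another number of arguments, so the value here is immaterial.
  | _ => True

/-- All facts of a list are true. -/
def AllTrue : List (Horn.Fact Pr Sym) → Prop
  | [] => True
  | f :: fs => Meaning f ∧ AllTrue fs

theorem allTrue_iff {fs : List (Horn.Fact Pr Sym)} : AllTrue fs ↔ ∀ f ∈ fs, Meaning f := by
  induction fs with
  | nil => simp [AllTrue]
  | cons f fs ih => simp [AllTrue, ih]

/-- The clause preserves truth. -/
def Sound (r : HRule) : Prop :=
  ∀ σ, AllTrue (r.body.map (Horn.Atom.inst σ)) → Meaning (r.head.inst σ)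

/-! #### Decoding -/

theorem encodeList_map {α : Type} (f : α → List Sym) (l : List α) :
    encodeList id (l.map f) = encodeList f l := by
  induction l with
  | nil => rfl
  | cons a l ih => simp [encodeList, ih]

theorem PrefixCode.injective {α : Type} {f : α → List Sym} (hf : PrefixCode f) {a b : α}
    (h : f a = f b) : a = b :=
  (hf a b [] [] (by rw [h])).1

theorem mem_decode {N : NT} {α : Type} {f : α → List Sym} (hN : lang N = Set.range f)
    {X S : List Sym} {l : List α} (h : Meaning (.mem N, [X, S])) (hS : S = encodeList f l) :
    ∃ a ∈ l, X = f a := by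
  have := h.2 (l.map f) (by simp [hN]) (by rw [hS, encodeList_map])
  obtain ⟨a, ha, e⟩ := List.mem_map.1 this
  exact ⟨a, ha, e.symm⟩

theorem notin_decode {N : NT} {α : Type} {f : α → List Sym} (hN : lang N = Set.range f)
    {X S : List Sym} {l : List α} (h : Meaning (.notin N, [X, S])) (hS : S = encodeList f l) :
    ∀ a ∈ l, X ≠ f a := by
  intro a ha e
  exact h (l.map f) (by simp [hN]) (by rw [hS, encodeList_map]) (List.mem_map.2 ⟨a, ha, e.symm⟩)

theorem encode_eq (x : Input) : x.encode =
    encodeList encodeAssertion x.system.spec.ontology ++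
      (encodeList encodeSchemaEntry x.system.spec.schema ++
      (encodeList encodeGLAV x.system.spec.mapping ++
      (encodeList encodeRelAtom x.system.database ++
      (encodeList (encodeList encodeName) x.dataset ++
      (encodeNat x.query.arity ++ encodeList encodeCQ x.query.disjuncts))))) := by
  simp [Input.encode, encodeSystem, encodeSpecification, encodeUCQ]

theorem fields_decode {O S M D L A Q : List Sym} (h : Meaning (.flds, [O, S, M, D, L, A, Q]))
    {x : Input} (hx : x.encode = O ++ (S ++ (M ++ (D ++ (L ++ (A ++ Q)))))) :
    O = encodeList encodeAssertion x.system.spec.ontology ∧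
    S = encodeList encodeSchemaEntry x.system.spec.schema ∧
    M = encodeList encodeGLAV x.system.spec.mapping ∧
    D = encodeList encodeRelAtom x.system.database ∧
    L = encodeList (encodeList encodeName) x.dataset ∧
    A = encodeNat x.query.arity ∧ Q = encodeList encodeCQ x.query.disjuncts := by
  obtain ⟨⟨O, rfl⟩, ⟨S, rfl⟩, ⟨M, rfl⟩, ⟨D, rfl⟩, ⟨L, rfl⟩, ⟨A, rfl⟩, ⟨Q, rfl⟩⟩ := h
  rw [encode_eq] at hx
  obtain ⟨hO, hx⟩ := prefixCode_list prefixCode_assertion _ _ _ _ hx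
  obtain ⟨hS, hx⟩ := prefixCode_list prefixCode_schemaEntry _ _ _ _ hx
  obtain ⟨hM, hx⟩ := prefixCode_list prefixCode_glav _ _ _ _ hx
  obtain ⟨hD, hx⟩ := prefixCode_list prefixCode_relAtom _ _ _ _ hx
  obtain ⟨hL, hx⟩ := prefixCode_list (prefixCode_list prefixCode_name) _ _ _ _ hx
  obtain ⟨hA, hQ⟩ := prefixCode_nat _ _ _ _ hx
  exact ⟨by rw [hO], by rw [hS], by rw [hM], by rw [hD], by rw [hL], by rw [hA], hQ.symm⟩

theorem encodeList_cons_eq {α : Type} {f : α → List Sym} (hf : PrefixCode f) {a : α}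
    {Y : List Sym} {l : List α} (h : .item :: (f a ++ Y) = encodeList f l) :
    ∃ l', l = a :: l' ∧ Y = encodeList f l' := by
  cases l with
  | nil => simp [encodeList] at h
  | cons b l =>
    simp only [encodeList, List.cons.injEq, true_and] at h
    obtain ⟨rfl, h'⟩ := hf _ _ _ _ h
    exact ⟨l, rfl, h'⟩

theorem encodeList_close_eq {α : Type} {f : α → List Sym} {l : List α}
    (h : [.close] = encodeList f l) : l = [] := by
  cases l with
  | nil => rfl
  | cons b l => simp [encodeList] at h

namespace Clause

/-! #### Recognition of codes -/

theorem sound_codesNil : Sound codesNil := fun _ _ => rfl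

theorem sound_codesCons (N : NT) (Ns : List NT) : Sound (codesCons N Ns) :=
  fun σ ⟨h1, h2, _⟩ => ⟨σ 0, h1, σ 1, h2, rfl⟩

theorem sound_badsHead (N : NT) (Ns : List NT) : Sound (badsHead N Ns) := by
  rintro σ ⟨h1, _⟩ _ ⟨X, hX, Y, hY, rfl⟩ t e
  exact h1 X hX (Y ++ t) (by rw [← List.append_assoc]; exact e)

/-- A hypothetical decomposition of a prefix must start with the code split off by the clause, by
prefix-freeness; the rest is then excluded by the second premise. -/
theorem sound_badsTail (N : NT) (Ns : List NT) : Sound (badsTail N Ns) := by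
  rintro σ ⟨h1, h2, _⟩ _ ⟨X, hX, Y, hY, rfl⟩ t e
  have e' : σ 0 ++ σ 1 = X ++ (Y ++ t) := by rw [← List.append_assoc]; exact e
  exact h2 Y hY t (prefixFree_lang N _ h1 _ hX _ _ e').2

theorem sound_codeProd {N : NT} {a : Sym} {Ns : List NT} (h : prod N a = some Ns) :
    Sound (codeProd N a Ns) := by
  rintro σ ⟨h1, _⟩
  change a :: σ 0 ∈ lang N
  rw [lang_eq_expand]
  exact ⟨a, Ns, σ 0, h, h1, rfl⟩

/-- The first letter determines the production, so a prefix in the category could only come from the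
sequence that is refuted. -/
theorem sound_badProd {N : NT} {a : Sym} {Ns : List NT} (h : prod N a = some Ns) :
    Sound (badProd N a Ns) := by
  rintro σ ⟨h1, _⟩ X hX t e
  rw [lang_eq_expand] at hX
  obtain ⟨b, Ms, Y, hb, hY, rfl⟩ := hX
  obtain ⟨rfl, e'⟩ := List.cons.inj (show a :: σ 0 = b :: (Y ++ t) from e)
  obtain rfl := Option.some.inj (h.symm.trans hb)
  exact h1 Y hY t e'

theorem sound_badNone {N : NT} {a : Sym} (h : prod N a = none) : Sound (badNone N a) := by
  rintro σ _ X hX t e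
  rw [lang_eq_expand] at hX
  obtain ⟨b, Ms, Y, hb, hY, rfl⟩ := hX
  obtain ⟨rfl, e'⟩ := List.cons.inj (show a :: σ 0 = b :: (Y ++ t) from e)
  simp [h] at hb

theorem sound_badNil (N : NT) : Sound (badNil N) := by
  rintro σ _ X hX t e
  rw [lang_eq_expand] at hX
  obtain ⟨b, Ms, Y, hb, hY, rfl⟩ := hX
  exact absurd (show [] = b :: (Y ++ t) from e) (by simp)

theorem sound_seq (Ns : List NT) : ∀ r ∈ seqClauses Ns, Sound r := by
  cases Ns with
  | nil => simp [seqClauses, sound_codesNil]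
  | cons N Ns => simp [seqClauses, sound_codesCons, sound_badsHead, sound_badsTail]

theorem sound_letter (N : NT) (a : Sym) : ∀ r ∈ letterClauses N a, Sound r := by
  rw [letterClauses]
  cases h : prod N a with
  | none => simp [sound_badNone h]
  | some Ns =>
    simp only [List.mem_cons, List.mem_flatMap]
    rintro r (rfl | rfl | ⟨Ms, -, hr⟩)
    exacts [sound_codeProd h, sound_badProd h, sound_seq Ms r hr]

/-! #### Words and lists -/

theorem sound_neqSame (a : Sym) : Sound (neqSame a) :=
  fun _ ⟨h1, _⟩ e => h1 (List.cons.inj e).2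

theorem sound_neqDiff {a b : Sym} (h : b ≠ a) : Sound (neqDiff a b) :=
  fun _ _ e => h (List.cons.inj e).1.symm

theorem sound_neqNilLeft (a : Sym) : Sound (neqNilLeft a) :=
  fun _ _ e => List.cons_ne_nil _ _ e.symm

theorem sound_neqNilRight (a : Sym) : Sound (neqNilRight a) :=
  fun _ _ e => List.cons_ne_nil _ _ e

theorem item_decode {N : NT} {X Y : List Sym} {l : List (List Sym)} (hX : X ∈ lang N)
    (hl : ∀ w ∈ l, w ∈ lang N) (e : .item :: (X ++ Y) = encodeList id l) :
    ∃ l', l = X :: l' ∧ (∀ w ∈ l', w ∈ lang N) ∧ Y = encodeList id l' := by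
  cases l with
  | nil => simp [encodeList] at e
  | cons b l =>
    simp only [encodeList, List.cons.injEq, true_and, id] at e
    obtain ⟨rfl, h'⟩ := prefixFree_lang N _ hX _ (hl b (by simp)) _ _ e
    exact ⟨l, rfl, fun w hw => hl w (by simp [hw]), h'⟩

theorem sound_memHead (N : NT) : Sound (memHead N) := by
  rintro σ ⟨h1, _⟩
  refine ⟨h1, fun l hl e => ?_⟩
  obtain ⟨l', rfl, -⟩ := item_decode h1 hl e
  exact List.mem_cons_self

theorem sound_memTail (N : NT) : Sound (memTail N) := by
  rintro σ ⟨h1, h2, _⟩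
  refine ⟨h2.1, fun l hl e => ?_⟩
  obtain ⟨l', rfl, hl', e'⟩ := item_decode h1 hl e
  exact List.mem_cons_of_mem _ (h2.2 l' hl' e')

theorem sound_notinNil (N : NT) : Sound (notinNil N) := by
  rintro σ - l hl e
  rw [encodeList_close_eq e]
  exact List.not_mem_nil

theorem sound_notinCons (N : NT) : Sound (notinCons N) := by
  rintro σ ⟨h1, h2, h3, _⟩ l hl e
  obtain ⟨l', rfl, hl', e'⟩ := item_decode h1 hl e
  exact fun hm => (List.mem_cons.1 hm).elim h2 (h3 l' hl' e')

theorem sound_category (N : NT) : ∀ r ∈ categoryClauses N, Sound r := by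
  simp only [categoryClauses, List.mem_cons, List.mem_flatMap]
  rintro r (rfl | rfl | rfl | rfl | rfl | ⟨a, -, hr⟩)
  exacts [sound_badNil N, sound_memHead N, sound_memTail N, sound_notinNil N, sound_notinCons N,
    sound_letter N a r hr]

/-- If the longer word coded an input as well, one code word would be a proper prefix of another. -/
theorem sound_topTrail (a : Sym) : Sound (topTrail a) := by
  rintro σ ⟨⟨y, hy⟩, _⟩ ⟨x, -, e, -⟩
  have hy : y.encode = σ 0 := hy
  have e : x.encode = σ 0 ++ (a :: σ 1) := e
  rw [← hy, ← List.append_nil x.encode] at e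
  simpa using (prefixCode_input _ _ _ _ e).2

theorem sound_sym (a : Sym) : ∀ r ∈ symClauses a, Sound r := by
  simp only [symClauses, List.mem_cons, List.mem_map, List.mem_filter]
  rintro r (rfl | rfl | rfl | rfl | ⟨b, ⟨-, hb⟩, rfl⟩)
  exacts [sound_neqSame a, sound_neqNilLeft a, sound_neqNilRight a, sound_topTrail a,
    sound_neqDiff (by simpa using hb)]

/-! #### Parts of the input -/

theorem sound_fields : Sound fields := fun _ ⟨h1, h2, h3, h4, h5, h6, h7, _⟩ =>
  ⟨h1, h2, h3, h4, h5, h6, h7⟩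

theorem sound_inOnt : Sound inOnt := fun _ ⟨h1, h2, _⟩ _ hx =>
  mem_decode (N := .asr) rfl h2 (fields_decode h1 hx).1

theorem sound_inSch : Sound inSch := fun _ ⟨h1, h2, _⟩ _ hx =>
  mem_decode (N := .sch) rfl h2 (fields_decode h1 hx).2.1

theorem sound_inMap : Sound inMap := fun _ ⟨h1, h2, _⟩ _ hx =>
  mem_decode (N := .glav) rfl h2 (fields_decode h1 hx).2.2.1

theorem sound_inDat : Sound inDat := fun _ ⟨h1, h2, _⟩ _ hx =>
  mem_decode (N := .rel) rfl h2 (fields_decode h1 hx).2.2.2.1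

theorem sound_inLam : Sound inLam := fun _ ⟨h1, h2, _⟩ _ hx =>
  mem_decode (N := .names) rfl h2 (fields_decode h1 hx).2.2.2.2.1

theorem sound_inQue : Sound inQue := fun _ ⟨h1, h2, _⟩ _ hx =>
  mem_decode (N := .cq) rfl h2 (fields_decode h1 hx).2.2.2.2.2.2

theorem sound_isArity : Sound isArity := fun _ ⟨h1, _⟩ _ hx =>
  (fields_decode h1 hx).2.2.2.2.2.1

theorem sound_notSch : Sound notSch := fun _ ⟨h1, h2, _⟩ _ hx =>
  notin_decode (N := .sch) rfl h2 (fields_decode h1 hx).2.1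

theorem sound_notLam : Sound notLam := fun _ ⟨h1, h2, _⟩ _ hx =>
  notin_decode (N := .names) rfl h2 (fields_decode h1 hx).2.2.2.2.1

theorem sound_lenNil : Sound lenNil := by
  intro σ _ l e
  rw [encodeList_close_eq e]
  rfl

theorem sound_lenCons : Sound lenCons := by
  rintro σ ⟨⟨a, ha⟩, h2, _⟩ l e
  have e : .item :: (σ 0 ++ σ 1) = encodeList encodeName l := e
  dsimp only [Horn.instPat, Horn.PSym.inst] at ha
  rw [← ha] at e
  obtain ⟨l', rfl, e'⟩ := encodeList_cons_eq prefixCode_name e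
  have h2 : σ 2 = encodeNat l'.length := h2 l' e'
  change .one :: σ 2 = _
  rw [h2]
  rfl

theorem sound_domFact : Sound domFact := by
  rintro σ ⟨h1, ⟨p, hp⟩, h3, _⟩
  obtain ⟨c, hc⟩ : σ 0 ∈ lang .name := h3.1
  refine ⟨c, hc.symm, fun x hx => ?_⟩
  obtain ⟨a, ha, e⟩ := h1 x hx
  have e : σ 2 ++ σ 3 = encodeName a.pred ++ encodeList encodeName a.args := e
  dsimp only [Horn.instPat, Horn.PSym.inst] at hp
  rw [← hp] at e
  obtain ⟨-, e'⟩ := prefixCode_name _ _ _ _ e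
  obtain ⟨c', hc', e''⟩ := mem_decode (N := .name) rfl h3 e'
  obtain rfl := prefixCode_name.injective (hc.trans e'')
  exact ⟨a, ha, hc'⟩

theorem sound_domallNil : Sound domallNil := fun _ _ => ⟨[], rfl, by simp⟩

theorem sound_domallCons : Sound domallCons := by
  rintro σ ⟨⟨c, hc, h1⟩, ⟨cs, hcs, h2⟩, _⟩
  refine ⟨c :: cs, ?_, fun x hx => ?_⟩
  · change .item :: (σ 0 ++ σ 1) = .item :: (encodeName c ++ encodeList encodeName cs)
    rw [← hc, ← hcs]
    rfl
  · exact List.forall_mem_cons.2 ⟨h1 x hx, h2 x hx⟩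

theorem sound_outsideNil : Sound outsideNil := by
  rintro σ - d e c ⟨a, ha, -⟩
  rw [encodeList_close_eq e] at ha
  simp at ha

theorem sound_outsideCons : Sound outsideCons := by
  rintro σ ⟨⟨p, hp⟩, ⟨l, hl⟩, h3, h4, _⟩ d e c ⟨a, ha, hc⟩
  have e : .item :: (σ 1 ++ (σ 2 ++ σ 3)) = encodeList encodeRelAtom d := e
  dsimp only [Horn.instPat, Horn.PSym.inst] at hp hl
  rw [← hp, ← hl, ← List.append_assoc] at e
  obtain ⟨d', rfl, e'⟩ := encodeList_cons_eq (a := ⟨p, l⟩) prefixCode_relAtom e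
  rcases List.mem_cons.1 ha with rfl | ha
  · exact notin_decode (N := .name) rfl h3 hl.symm c hc
  · exact h4 d' e' c ⟨a, ha, hc⟩

theorem sound_notDom : Sound notDom := fun _ ⟨h1, h2, _⟩ _ hx =>
  h2 _ (fields_decode h1 hx).2.2.2.1

/-! #### Assignments -/

theorem sound_lkHead : Sound lkHead := by
  rintro σ ⟨⟨v, hv⟩, ⟨t, ht⟩, _⟩
  refine ⟨t, ht.symm, fun hl w e hw => ?_⟩
  have e : .item :: (σ 0 ++ (σ 1 ++ σ 2)) = encodeList encodeEntry hl := e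
  have hw : σ 0 = encodeName w := hw
  dsimp only [Horn.instPat, Horn.PSym.inst] at hv ht
  rw [← hv, ← ht, ← List.append_assoc] at e
  obtain ⟨l', rfl, -⟩ := encodeList_cons_eq (a := (v, t)) prefixCode_entry e
  obtain rfl := prefixCode_name.injective (hv.trans hw)
  simp

theorem sound_lkTail : Sound lkTail := by
  rintro σ ⟨⟨u, hu⟩, ⟨z, hz⟩, h3, ⟨t, ht, h4⟩, _⟩
  refine ⟨t, ht, fun hl w e hw => ?_⟩
  have e : .item :: (σ 2 ++ (σ 3 ++ σ 4)) = encodeList encodeEntry hl := e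
  dsimp only [Horn.instPat, Horn.PSym.inst] at hu hz
  rw [← hu, ← hz, ← List.append_assoc] at e
  obtain ⟨l', rfl, e'⟩ := encodeList_cons_eq (a := (u, z)) prefixCode_entry e
  have hne : w ≠ u := by
    rintro rfl
    exact h3 (hw.trans hu)
  rw [List.lookup_cons, beq_false_of_ne hne]
  exact h4 l' w e' hw

theorem sound_tgtNil : Sound tgtNil := fun _ _ => ⟨[], [], rfl, rfl, by simp⟩

theorem sound_tgtCons : Sound tgtCons := by
  rintro σ ⟨⟨v, hv⟩, ⟨c, hc⟩, ⟨t, ht, h3⟩, ⟨ts, cs, hts, hcs, h4⟩, _⟩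
  have hv : encodeName v = σ 0 := hv
  have hc : encodeName c = σ 3 := hc
  have ht : .zero :: σ 3 = encodeTm t := ht
  have hts : σ 1 = _ := hts
  have hcs : σ 4 = _ := hcs
  refine ⟨v :: ts, c :: cs, ?_, ?_, fun hl e => ?_⟩
  · change .item :: (σ 0 ++ σ 1) = .item :: (encodeName v ++ encodeList encodeName ts)
    rw [hv, hts]
  · change .item :: (σ 3 ++ σ 4) = .item :: (encodeName c ++ encodeList encodeName cs)
    rw [hc, hcs]
  · have h := h3 hl v e hv.symm
    obtain rfl : Tm.const c = t := prefixCode_tm.injective (by rw [← ht, ← hc]; rfl)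
    rw [List.map_cons, List.map_cons, h, h4 hl e]

theorem sound_satNil : Sound satNil := by
  rintro σ - x - hl - b e I -
  rw [encodeList_close_eq e]
  simp

theorem assigned_eq {hl : List (Name × Tm)} {v : Var} {t : Tm} (h : hl.lookup v = some t) :
    assigned hl v = t := by
  rw [assigned, h]
  rfl

theorem sound_satConcept : Sound satConcept := by
  rintro σ ⟨⟨a, ha⟩, ⟨v, hv⟩, ⟨t, ht, h3⟩, h4, h5, _⟩ x hx hl hH b e I hI
  have e : .item :: .zero :: (σ 0 ++ (σ 1 ++ σ 2)) = encodeList encodeOntologyAtom b := e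
  dsimp only [Horn.instPat, Horn.PSym.inst] at ha hv
  rw [← ha, ← hv, ← List.append_assoc] at e
  obtain ⟨b', rfl, e'⟩ := encodeList_cons_eq (a := .concept a v) prefixCode_ontologyAtom e
  refine List.forall_mem_cons.2 ⟨?_, h5 x hx hl hH b' e' I hI⟩
  obtain ⟨B, t', hB, ht', h⟩ := h4 x hx
  obtain rfl : BasicConcept.atomic a = B :=
    prefixCode_basicConcept.injective ((congrArg (Sym.zero :: ·) ha).trans hB)
  obtain rfl := prefixCode_tm.injective (ht.symm.trans ht')
  change I.value (assigned hl v) ∈ _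
  rw [assigned_eq (h3 hl v hH hv.symm)]
  exact h I hI

theorem sound_satRole : Sound satRole := by
  rintro σ ⟨⟨p, hp⟩, ⟨v, hv⟩, ⟨u, hu⟩, ⟨t, ht, h3⟩, ⟨z, hz, h3'⟩, h4, h5, _⟩ x hx hl hH b e I hI
  have e : .item :: .one :: (σ 0 ++ (σ 1 ++ (σ 2 ++ σ 3))) = encodeList encodeOntologyAtom b := e
  dsimp only [Horn.instPat, Horn.PSym.inst] at hp hv hu
  rw [← hp, ← hv, ← hu] at e
  obtain ⟨b', rfl, e'⟩ := encodeList_cons_eq (a := .role p v u) prefixCode_ontologyAtom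
    (Y := σ 3) (by simpa [encodeOntologyAtom] using e)
  refine List.forall_mem_cons.2 ⟨?_, h5 x hx hl hH b' e' I hI⟩
  obtain ⟨R, t', z', hR, ht', hz', h⟩ := h4 x hx
  obtain rfl : BasicRole.atomic p = R :=
    prefixCode_basicRole.injective ((congrArg (Sym.zero :: ·) hp).trans hR)
  obtain rfl := prefixCode_tm.injective (ht.symm.trans ht')
  obtain rfl := prefixCode_tm.injective (hz.symm.trans hz')
  change (I.value (assigned hl v), I.value (assigned hl u)) ∈ _
  rw [assigned_eq (h3 hl v hH hv.symm), assigned_eq (h3' hl u hH hu.symm)]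
  exact h I hI

theorem sound_srcNil : Sound srcNil := by
  rintro σ - x - hl - b e
  rw [encodeList_close_eq e]
  simp

theorem map_assignedConst {hl : List (Name × Tm)} {ts : List Var} {cs : List Const}
    (h : ts.map (fun v => hl.lookup v) = cs.map fun c => some (Tm.const c)) : ts.map (assignedConst hl) = cs := by
  induction ts generalizing cs with
  | nil => simpa using h.symm
  | cons v ts ih =>
    cases cs with
    | nil => simp at h
    | cons c cs =>
      simp only [List.map_cons, List.cons.injEq] at h
      rw [List.map_cons, ih h.2, assignedConst, h.1]

theorem sound_srcCons : Sound srcCons := by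
  rintro σ ⟨⟨p, hp⟩, ⟨l, hl'⟩, ⟨ts, cs, hts, hcs, h3⟩, h4, h5, _⟩ x hx hl hH b e
  have e : .item :: (σ 0 ++ (σ 1 ++ σ 2)) = encodeList encodeRelAtom b := e
  dsimp only [Horn.instPat, Horn.PSym.inst] at hp hl'
  rw [← hp, ← hl', ← List.append_assoc] at e
  obtain ⟨b', rfl, e'⟩ := encodeList_cons_eq (a := ⟨p, l⟩) prefixCode_relAtom e
  refine List.forall_mem_cons.2 ⟨?_, h5 x hx hl hH b' e'⟩
  obtain ⟨a, ha, h⟩ := h4 x hx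
  obtain rfl : l = ts := (prefixCode_list prefixCode_name).injective (hl'.trans hts)
  obtain rfl : RelAtom.mk p cs = a := by
    apply prefixCode_relAtom.injective
    rw [← h]
    change encodeName p ++ encodeList encodeName cs = σ 0 ++ σ 5
    rw [hp, ← hcs]
    rfl
  rw [RelAtom.map, map_assignedConst (h3 hl hH)]
  exact ha

/-- Read as a map into constants, the guessed assignment witnesses that the tuple is an answer to
the source query. The default value for unlisted variables plays no role, since each variable that
is used has been looked up successfully. -/
theorem sound_mapInst : Sound mapInst := by
  rintro σ ⟨h1, ⟨t, ht⟩, ⟨b, hb⟩, ⟨hl, hH⟩, ⟨ts, cs, hts, hcs, h5⟩, h6, ⟨cs', hcs', h7⟩, _⟩ x hx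
  obtain ⟨m, hm, e⟩ := h1 x hx
  have e : σ 0 ++ (σ 1 ++ σ 2) = encodeList encodeName m.target ++
    (encodeList encodeRelAtom m.sourceBody ++ encodeList encodeOntologyAtom m.ontologyBody) := e
  dsimp only [Horn.instPat, Horn.PSym.inst] at ht hb
  rw [← ht, ← hb] at e
  obtain ⟨rfl, e'⟩ := prefixCode_list prefixCode_name _ _ _ _ e
  obtain ⟨rfl, e''⟩ := prefixCode_list prefixCode_relAtom _ _ _ _ e'
  obtain rfl := (prefixCode_list prefixCode_name).injective (ht.trans hts)
  obtain rfl := (prefixCode_list prefixCode_name).injective (hcs.symm.trans hcs')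
  exact ⟨m, hm, cs, ⟨h7 x hx, assignedConst hl, map_assignedConst (h5 hl hH.symm),
    h6 x hx hl hH.symm _ hb.symm⟩, ht.symm, hb.symm, e'', hcs⟩

theorem sound_pairHead : Sound pairHead := by
  rintro σ ⟨⟨v, hv⟩, ⟨c, hc⟩, _⟩
  refine ⟨v, c, hv.symm, hc.symm, fun ts cs e e' => ?_⟩
  have e : .item :: (σ 0 ++ σ 2) = encodeList encodeName ts := e
  have e' : .item :: (σ 1 ++ σ 3) = encodeList encodeName cs := e'
  dsimp only [Horn.instPat, Horn.PSym.inst] at hv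
  rw [← hv] at e
  dsimp only [Horn.instPat, Horn.PSym.inst] at hc
  rw [← hc] at e'
  obtain ⟨ts, rfl, -⟩ := encodeList_cons_eq prefixCode_name e
  obtain ⟨cs, rfl, -⟩ := encodeList_cons_eq prefixCode_name e'
  simp

theorem sound_pairTail : Sound pairTail := by
  rintro σ ⟨⟨u, hu⟩, ⟨z, hz⟩, ⟨v, c, hv, hc, h⟩, _⟩
  refine ⟨v, c, hv, hc, fun ts cs e e' => ?_⟩
  have e : .item :: (σ 2 ++ σ 3) = encodeList encodeName ts := e
  have e' : .item :: (σ 4 ++ σ 5) = encodeList encodeName cs := e'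
  dsimp only [Horn.instPat, Horn.PSym.inst] at hu
  rw [← hu] at e
  dsimp only [Horn.instPat, Horn.PSym.inst] at hz
  rw [← hz] at e'
  obtain ⟨ts, rfl, hts⟩ := encodeList_cons_eq prefixCode_name e
  obtain ⟨cs, rfl, hcs⟩ := encodeList_cons_eq prefixCode_name e'
  simpa using .inr (h ts cs hts hcs)

theorem sound_valConst : Sound valConst := by
  rintro σ ⟨⟨v, c, hv, hc, h⟩, _⟩ w m cs hw ht - - hcs
  obtain rfl := prefixCode_name.injective (hv.symm.trans hw)
  exact .inl ⟨c, congrArg (Sym.zero :: ·) hc, h _ _ ht hcs⟩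

theorem sound_valNull : Sound valNull := by
  rintro σ ⟨h1, _⟩ v m cs hv ht hb hg hcs
  have hv : σ 0 = _ := hv
  have ht : σ 1 = _ := ht
  have hb : σ 2 = _ := hb
  have hg : σ 3 = _ := hg
  have hcs : σ 4 = _ := hcs
  refine .inr ⟨?_, fun hm => notin_decode (N := .name) rfl h1 ht v hm hv⟩
  change .one :: (σ 1 ++ (σ 2 ++ (σ 3 ++ (σ 4 ++ σ 0)))) = _
  rw [hv, ht, hb, hg, hcs]
  simp [encodeTm, encodeGLAV]

/-! #### Consequences of the ontology and the mapping -/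

theorem zip_map {ts : List Var} {cs : List Const} {α : Type} {h : Var → α} {k : Const → α}
    (e : ts.map h = cs.map k) {v : Var} {c : Const} (hvc : (v, c) ∈ ts.zip cs) : h v = k c := by
  induction ts generalizing cs with
  | nil => simp at hvc
  | cons t ts ih =>
    cases cs with
    | nil => simp at hvc
    | cons d cs =>
      simp only [List.map_cons, List.cons.injEq] at e
      rcases List.mem_cons.1 (by simpa only [List.zip_cons_cons] using hvc) with h | h
      · obtain ⟨rfl, rfl⟩ := Prod.mk.inj h
        exact e.1
      · exact ih e.2 h

/-- The values of the terms for the variables of the head satisfy it. -/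
theorem value_val {x : Input} {m : GLAVAssertion} (hm : m ∈ x.system.spec.mapping)
    {cs : List Const} (hcs : cs ∈ sourceAnswers m.sourceQuery x.system.database)
    {I : Interpretation} (hI : I.IsModel x.system) :
    ∃ h : Var → I.Domain, (∀ α ∈ m.ontologyBody, I.SatAtom h α) ∧
      ∀ v t, ((∃ c, encodeTm t = encodeTm (.const c) ∧ (v, c) ∈ m.target.zip cs) ∨
        (encodeTm t = encodeTm (.null m cs v) ∧ v ∉ m.target)) → I.value t = h v := by
  obtain ⟨h, hh⟩ := hI.2 m hm cs hcs
  obtain ⟨e, hs⟩ := I.value_null (h := h) (m := m) (c := cs) hh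
  refine ⟨_, hs, ?_⟩
  rintro v t (⟨c, ht, hc⟩ | ⟨ht, -⟩)
  · obtain rfl := prefixCode_tm.injective ht
    exact (zip_map e hc).symm
  · obtain rfl := prefixCode_tm.injective ht
    rfl

theorem sound_concRootTop : Sound concRootTop := by
  intro σ _ x hx
  exact ⟨.atomic .top, .root (.atomic .top), rfl, rfl, fun I hI => trivial⟩

theorem sound_concDom : Sound concDom := by
  rintro σ ⟨⟨c, hc, -⟩, _⟩ x hx
  exact ⟨.atomic .top, .const c, rfl, congrArg (Sym.zero :: ·) hc, fun I hI => trivial⟩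

theorem val_term {V Y T B G C : List Sym} (h : Meaning (.val, [V, Y, T, B, G, C])) {v : Var}
    {m : GLAVAssertion} {cs : List Const} (hv : V = encodeName v)
    (ht : T = encodeList encodeName m.target) (hb : B = encodeList encodeRelAtom m.sourceBody)
    (hg : G = encodeList encodeOntologyAtom m.ontologyBody) (hc : C = encodeList encodeName cs) :
    ∃ t, Y = encodeTm t ∧ ((∃ c, encodeTm t = encodeTm (.const c) ∧ (v, c) ∈ m.target.zip cs) ∨
        (encodeTm t = encodeTm (.null m cs v) ∧ v ∉ m.target)) := by
  rcases h v m cs hv ht hb hg hc with ⟨c, hY, hc⟩ | ⟨hY, hv⟩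
  · exact ⟨_, hY, .inl ⟨c, rfl, hc⟩⟩
  · exact ⟨_, hY, .inr ⟨rfl, hv⟩⟩

theorem sound_concMap : Sound concMap := by
  rintro σ ⟨h1, h2, ⟨A, hA⟩, ⟨v, hv⟩, h5, _⟩ x hx
  obtain ⟨m, hm, cs, hcs, ht, hb, hg, hc⟩ := h1 x hx
  obtain ⟨α, hα, e⟩ := mem_decode (N := .oa) rfl h2 hg
  have e : .zero :: (σ 0 ++ σ 7) = encodeOntologyAtom α := e
  dsimp only [Horn.instPat, Horn.PSym.inst] at hA hv
  rw [← hA, ← hv] at e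
  obtain rfl : OntologyAtom.concept A v = α := prefixCode_ontologyAtom.injective e
  obtain ⟨t, hY, h⟩ := val_term h5 hv.symm ht hb hg hc
  refine ⟨.atomic A, t, congrArg (Sym.zero :: ·) hA.symm, hY, fun I hI => ?_⟩
  obtain ⟨k, hk, hval⟩ := value_val hm hcs hI
  rw [hval v t h]
  exact hk _ hα

theorem sound_roleMap : Sound roleMap := by
  rintro σ ⟨h1, h2, ⟨P, hP⟩, ⟨v, hv⟩, ⟨u, hu⟩, h5, h6, _⟩ x hx
  obtain ⟨m, hm, cs, hcs, ht, hb, hg, hc⟩ := h1 x hx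
  obtain ⟨α, hα, e⟩ := mem_decode (N := .oa) rfl h2 hg
  have e : .one :: (σ 0 ++ (σ 8 ++ σ 9)) = encodeOntologyAtom α := e
  dsimp only [Horn.instPat, Horn.PSym.inst] at hP hv hu
  rw [← hP, ← hv, ← hu] at e
  obtain rfl : OntologyAtom.role P v u = α := prefixCode_ontologyAtom.injective e
  obtain ⟨t, hY, h⟩ := val_term h5 hv.symm ht hb hg hc
  obtain ⟨s, hZ, h'⟩ := val_term h6 hu.symm ht hb hg hc
  refine ⟨.atomic P, t, s, congrArg (Sym.zero :: ·) hP.symm, hY, hZ, fun I hI => ?_⟩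
  obtain ⟨k, hk, hval⟩ := value_val hm hcs hI
  rw [hval v t h, hval u s h']
  exact hk _ hα

theorem sound_roleInv : Sound roleInv := by
  rintro σ ⟨h1, _⟩ x hx
  obtain ⟨r, t, u, hr, ht, hu, h⟩ := h1 x hx
  have hr : .zero :: σ 0 = encodeBasicRole r := hr
  cases r with
  | inv P => simp [encodeBasicRole] at hr
  | atomic P =>
    exact ⟨.inv P, u, t, congrArg (Sym.one :: ·) (List.cons.inj hr).2, hu, ht, h⟩

theorem sound_roleUninv : Sound roleUninv := by
  rintro σ ⟨h1, _⟩ x hx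
  obtain ⟨r, t, u, hr, ht, hu, h⟩ := h1 x hx
  have hr : .one :: σ 0 = encodeBasicRole r := hr
  cases r with
  | atomic P => simp [encodeBasicRole] at hr
  | inv P =>
    exact ⟨.atomic P, u, t, congrArg (Sym.zero :: ·) (List.cons.inj hr).2, hu, ht, h⟩

theorem sound_concSome : Sound concSome := by
  rintro σ ⟨h1, _⟩ x hx
  obtain ⟨r, t, u, hr, ht, hu, h⟩ := h1 x hx
  exact ⟨.some r, t, congrArg (Sym.one :: ·) hr, ht, fun I hI => ⟨_, h I hI⟩⟩

theorem sound_roleChild : Sound roleChild := by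
  rintro σ ⟨h1, _⟩ x hx
  obtain ⟨b, t, hb, ht, h⟩ := h1 x hx
  have hb : .one :: σ 0 = encodeBasicConcept b := hb
  have ht : σ 1 = _ := ht
  cases b with
  | atomic A => simp [encodeBasicConcept] at hb
  | some R =>
    have hR : σ 0 = encodeBasicRole R := (List.cons.inj hb).2
    refine ⟨R, t, .child R t, hR, ht, ?_, fun I hI => I.value_child (h I hI)⟩
    change .item :: (σ 0 ++ σ 1) = .item :: (encodeBasicRole R ++ encodeTm t)
    rw [hR, ht]

theorem sound_concIncl : Sound concIncl := by
  rintro σ ⟨h1, ⟨a, ha⟩, h3, _⟩ x hx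
  obtain ⟨b, t, hb, ht, h⟩ := h3 x hx
  obtain ⟨s, hs, e⟩ := h1 x hx
  have e : .zero :: (σ 3 ++ σ 0) = encodeAssertion s := e
  obtain rfl := prefixCode_basicConcept.injective (ha.trans hb)
  dsimp only [Horn.instPat, Horn.PSym.inst] at ha
  rw [← ha] at e
  cases s with
  | conceptIncl B₁ B₂ =>
    obtain ⟨rfl, e'⟩ := prefixCode_basicConcept _ _ _ _ (List.cons.inj e).2
    exact ⟨B₂, t, e', ht, fun I hI => hI.1 _ hs (h I hI)⟩
  | roleIncl => simp [encodeAssertion] at e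
  | conceptDisj => simp [encodeAssertion] at e
  | roleDisj => simp [encodeAssertion] at e

theorem sound_roleIncl : Sound roleIncl := by
  rintro σ ⟨h1, ⟨a, ha⟩, h3, _⟩ x hx
  obtain ⟨b, t, u, hb, ht, hu, h⟩ := h3 x hx
  obtain ⟨s, hs, e⟩ := h1 x hx
  have e : .one :: (σ 4 ++ σ 0) = encodeAssertion s := e
  obtain rfl := prefixCode_basicRole.injective (ha.trans hb)
  dsimp only [Horn.instPat, Horn.PSym.inst] at ha
  rw [← ha] at e
  cases s with
  | roleIncl B₁ B₂ =>
    obtain ⟨rfl, e'⟩ := prefixCode_basicRole _ _ _ _ (List.cons.inj e).2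
    exact ⟨B₂, t, u, e', ht, hu, fun I hI => hI.1 _ hs (h I hI)⟩
  | conceptIncl => simp [encodeAssertion] at e
  | conceptDisj => simp [encodeAssertion] at e
  | roleDisj => simp [encodeAssertion] at e

theorem sound_concTop : Sound concTop := by
  rintro σ ⟨h1, _⟩ x hx
  obtain ⟨b, t, -, ht, -⟩ := h1 x hx
  exact ⟨.atomic .top, t, rfl, ht, fun I hI => trivial⟩

theorem sound_concRoot : Sound concRoot := by
  rintro σ ⟨h1, _⟩ x hx
  obtain ⟨b, t, hb, ht, h⟩ := h1 x hx
  exact ⟨b, .root b, hb, congrArg (Sym.close :: ·) hb, fun I hI => I.value_root (h I hI)⟩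

theorem sound_inconsBot : Sound inconsBot := by
  rintro σ ⟨h1, _⟩ x hx I hI
  obtain ⟨b, t, hb, ht, h⟩ := h1 x hx
  obtain rfl : .atomic .bot = b := prefixCode_basicConcept.injective hb
  exact h I hI

theorem sound_inconsConc : Sound inconsConc := by
  rintro σ ⟨h1, ⟨a, ha⟩, h3, h4, _⟩ x hx I hI
  obtain ⟨b, t, hb, ht, h⟩ := h3 x hx
  obtain ⟨b', t', hb', ht', h'⟩ := h4 x hx
  obtain ⟨s, hs, e⟩ := h1 x hx
  have e : .item :: (σ 1 ++ σ 2) = encodeAssertion s := e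
  obtain rfl := prefixCode_basicConcept.injective (ha.trans hb)
  obtain rfl := prefixCode_tm.injective (ht.symm.trans ht')
  dsimp only [Horn.instPat, Horn.PSym.inst] at ha
  rw [← ha, show σ 2 = encodeBasicConcept b' from hb'] at e
  obtain rfl : .conceptDisj a b' = s := prefixCode_assertion.injective e
  exact (hI.1 _ hs).subset ⟨h I hI, h' I hI⟩

theorem sound_inconsRole : Sound inconsRole := by
  rintro σ ⟨h1, ⟨a, ha⟩, h3, h4, _⟩ x hx I hI
  obtain ⟨b, t, u, hb, ht, hu, h⟩ := h3 x hx
  obtain ⟨b', t', u', hb', ht', hu', h'⟩ := h4 x hx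
  obtain ⟨s, hs, e⟩ := h1 x hx
  have e : .close :: (σ 1 ++ σ 2) = encodeAssertion s := e
  obtain rfl := prefixCode_basicRole.injective (ha.trans hb)
  obtain rfl := prefixCode_tm.injective (ht.symm.trans ht')
  obtain rfl := prefixCode_tm.injective (hu.symm.trans hu')
  dsimp only [Horn.instPat, Horn.PSym.inst] at ha
  rw [← ha, show σ 2 = encodeBasicRole b' from hb'] at e
  obtain rfl : .roleDisj a b' = s := prefixCode_assertion.injective e
  exact (hI.1 _ hs).subset ⟨h I hI, h' I hI⟩

theorem sound_certIncons : Sound certIncons :=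
  fun _ ⟨h1, _⟩ x hx _ _ I hI => absurd hI (h1 x hx I)

/-- The assignment of terms, composed with `value`, is a match in every model, and it sends
constants to their denotations. -/
theorem sound_certAnswer : Sound certAnswer := by
  rintro σ ⟨h1, ⟨ts, hts⟩, ⟨hl, hH⟩, ⟨ts', cs', hts', hcs', h4⟩, h5, _⟩ x hx cs hcs I hI
  obtain ⟨q, hq, e⟩ := h1 x hx
  have e : σ 2 ++ σ 3 = encodeList encodeName q.target ++ encodeList encodeOntologyAtom q.body := e
  dsimp only [Horn.instPat, Horn.PSym.inst] at hts
  rw [← hts] at e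
  obtain ⟨rfl, e'⟩ := prefixCode_list prefixCode_name _ _ _ _ e
  obtain rfl := (prefixCode_list prefixCode_name).injective (hts.trans hts')
  obtain rfl := (prefixCode_list prefixCode_name).injective (hcs.symm.trans hcs')
  refine ⟨q, hq, fun v => I.value (assigned hl v), ?_, h5 x hx hl hH.symm _ e' I hI⟩
  have := congrArg (List.map fun o : Option Tm => I.value (o.getD (.root (.atomic .top))))
    (h4 hl hH.symm)
  simpa [assigned, Function.comp_def, Interpretation.value] using this

/-! #### Rejected words -/

theorem sound_topBad : Sound topBad := by
  rintro σ ⟨h1, _⟩ ⟨x, -, e, -⟩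
  exact h1 _ ⟨x, rfl⟩ [] (by simpa using e.symm)

theorem entry_decode {a : Name × ℕ} {p : Name} {P N : List Sym} (hp : encodeName p = P)
    (e : P ++ N = encodeSchemaEntry a) : a.1 = p ∧ N = encodeNat a.2 := by
  rw [← hp] at e
  obtain ⟨h, h'⟩ := prefixCode_name _ _ _ _ (show _ = encodeName a.1 ++ encodeNat a.2 from e)
  exact ⟨h.symm, h'⟩

theorem sound_topSchema : Sound topSchema := by
  rintro σ ⟨h1, h2, ⟨p, hp⟩, h4, _⟩ ⟨x, hw, hx, -⟩
  obtain ⟨a, ha, e⟩ := h1 x hx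
  obtain ⟨b, hb, e'⟩ := h2 x hx
  obtain ⟨rfl, hM⟩ := entry_decode hp e
  obtain ⟨h, hN⟩ := entry_decode hp e'
  have := hw.1.1 a.1 a.2 b.2 ha (by rw [← h]; exact hb)
  exact h4 (hM.trans (by rw [this]; exact hN.symm))

theorem rel_decode {a : RelAtom Name} {p : Name} {P L : List Sym} (hp : encodeName p = P)
    (e : P ++ L = encodeRelAtom a) : p = a.pred ∧ L = encodeList encodeName a.args := by
  rw [← hp] at e
  exact prefixCode_name _ _ _ _ (show _ = encodeName a.pred ++ encodeList encodeName a.args from e)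

theorem not_over {x : Input} {W P L N : List Sym} (hx : x.encode = W) {a : RelAtom Name} {p : Name}
    (hp : encodeName p = P) (e : P ++ L = encodeRelAtom a) (hlen : Meaning (.len, [L, N]))
    (hS : Meaning (.notS, [P ++ N, W])) : ¬ a.IsOver x.system.spec.schema := by
  obtain ⟨rfl, hL⟩ := rel_decode hp e
  intro h
  refine hS x hx _ h ?_
  rw [hlen _ hL, ← hp]
  rfl

theorem sound_topFact : Sound topFact := by
  rintro σ ⟨h1, ⟨p, hp⟩, h3, h4, _⟩ ⟨x, hw, hx, -⟩
  obtain ⟨a, ha, e⟩ := h1 x hx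
  exact not_over hx hp e h3 h4 (hw.1.2.1 a ha)

theorem sound_topMapping : Sound topMapping := by
  rintro σ ⟨h1, ⟨t, ht⟩, ⟨b, hb⟩, h4, ⟨p, hp⟩, h6, h7, _⟩ ⟨x, hw, hx, -⟩
  obtain ⟨m, hm, e⟩ := h1 x hx
  have e : σ 1 ++ (σ 2 ++ σ 3) = encodeList encodeName m.target ++
    (encodeList encodeRelAtom m.sourceBody ++ encodeList encodeOntologyAtom m.ontologyBody) := e
  dsimp only [Horn.instPat, Horn.PSym.inst] at ht hb
  rw [← ht, ← hb] at e
  obtain ⟨rfl, e'⟩ := prefixCode_list prefixCode_name _ _ _ _ e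
  obtain ⟨rfl, e''⟩ := prefixCode_list prefixCode_relAtom _ _ _ _ e'
  obtain ⟨a, ha, e⟩ := mem_decode (N := .rel) rfl h4 hb.symm
  exact not_over hx hp e h6 h7 (hw.1.2.2 m hm a ha)

theorem sound_topArity : Sound topArity := by
  rintro σ ⟨h1, ⟨t, ht⟩, h3, h4, h5, _⟩ ⟨x, hw, hx, -⟩
  obtain ⟨q, hq, e⟩ := h1 x hx
  have e : σ 1 ++ σ 2 = encodeList encodeName q.target ++ encodeList encodeOntologyAtom q.body := e
  dsimp only [Horn.instPat, Horn.PSym.inst] at ht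
  rw [← ht] at e
  obtain ⟨rfl, -⟩ := prefixCode_list prefixCode_name _ _ _ _ e
  exact h4 ((h3 _ ht.symm).trans (by rw [hw.2.1 q hq]; exact (h5 x hx).symm))

theorem sound_topLength : Sound topLength := by
  rintro σ ⟨h1, h3, h4, h5, _⟩ ⟨x, hw, hx, -⟩
  obtain ⟨c, hc, e⟩ := h1 x hx
  exact h4 ((h3 _ e).trans (by rw [(hw.2.2 c hc).1]; exact (h5 x hx).symm))

theorem sound_topOutside : Sound topOutside := by
  rintro σ ⟨h1, h2, h3, _⟩ ⟨x, hw, hx, -⟩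
  obtain ⟨c, hc, e⟩ := h1 x hx
  obtain ⟨a, ha, e⟩ := mem_decode (N := .name) rfl h2 e
  exact h3 x hx a ((hw.2.2 c hc).2 a ha) e

theorem sound_topCert : Sound topCert := by
  rintro σ ⟨⟨cs, hcs, h1⟩, h2, h3, h4, h5, _⟩ ⟨x, hw, hx, h⟩
  refine h4 x hx cs (h cs ⟨?_, h1 x hx, h5 x hx cs hcs⟩) hcs
  exact prefixCode_nat.injective ((h2 cs hcs).symm.trans (h3 x hx))

theorem sound_basic : ∀ r ∈ basicClauses, Sound r :=
  List.forall_iff_forall_mem.1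
    ⟨sound_fields, sound_inOnt, sound_inSch, sound_inMap, sound_inDat, sound_inLam,
      sound_inQue, sound_isArity, sound_notSch, sound_notLam, sound_lenNil, sound_lenCons,
      sound_domFact, sound_domallNil, sound_domallCons, sound_outsideNil, sound_outsideCons,
      sound_notDom, sound_lkHead, sound_lkTail, sound_tgtNil, sound_tgtCons, sound_satNil,
      sound_satConcept, sound_satRole, sound_srcNil, sound_srcCons, sound_mapInst,
      sound_pairHead, sound_pairTail, sound_valConst, sound_valNull, sound_concRootTop,
      sound_concDom, sound_concMap, sound_roleMap, sound_roleInv, sound_roleUninv,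
      sound_concSome, sound_roleChild, sound_concIncl, sound_roleIncl, sound_concTop,
      sound_concRoot, sound_inconsBot, sound_inconsConc, sound_inconsRole, sound_certIncons,
      sound_certAnswer, sound_topBad, sound_topSchema, sound_topFact, sound_topMapping,
      sound_topArity, sound_topLength, sound_topOutside, sound_topCert⟩

end Clause

/-- Every clause preserves truth, and the truth of a fact for `top` is exclusion from the language.
-/
theorem clauses_sound {x : List Sym} {ℓ n : ℕ} (h : Horn.Ders clauses ℓ n [(.top, [x])]) :
    x ∉ soundVQDEF := by
  refine h.sound (I := Meaning) (fun r hr σ hb => ?_) _ List.mem_cons_self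
  have hr : Sound r := by
    rcases List.mem_append.1 hr with hr | hr
    · obtain ⟨N, -, hr⟩ := List.mem_flatMap.1 hr
      exact Clause.sound_category N r hr
    rcases List.mem_append.1 hr with hr | hr
    · obtain ⟨a, -, hr⟩ := List.mem_flatMap.1 hr
      exact Clause.sound_sym a r hr
    · exact Clause.sound_basic r hr
  exact hr σ (allTrue_iff.2 (by simpa using hb))

end OBDM

/-! ### The canonical model -/

namespace OBDM

open Relation

/-- The inverse of a basic role. -/
def BasicRole.flip : BasicRole → BasicRole
  | .atomic P => .inv P
  | .inv P => .atomic P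

theorem BasicRole.flip_flip (R : BasicRole) : R.flip.flip = R := by cases R <;> rfl

/-- One application of an inclusion between roles. -/
def RStep (O : Ontology) (R₁ R₂ : BasicRole) : Prop :=
  .roleIncl R₁ R₂ ∈ O ∨ .roleIncl R₁.flip R₂.flip ∈ O

theorem RStep.flip {O : Ontology} {R₁ R₂ : BasicRole} (h : RStep O R₁ R₂) :
    RStep O R₁.flip R₂.flip := by
  simpa only [RStep, BasicRole.flip_flip] using h.symm

/-- One application of an inclusion between concepts. -/
inductive BStep (O : Ontology) : BasicConcept → BasicConcept → Prop
  | incl {B₁ B₂ : BasicConcept} (h : .conceptIncl B₁ B₂ ∈ O) : BStep O B₁ B₂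
  | top (B : BasicConcept) : BStep O B (.atomic .top)
  | some {R₁ R₂ : BasicRole} (h : RStep O R₁ R₂) : BStep O (.some R₁) (.some R₂)

/-- A step between concepts that preserves non-emptiness. -/
inductive NStep (O : Ontology) : BasicConcept → BasicConcept → Prop
  | step {B₁ B₂ : BasicConcept} (h : BStep O B₁ B₂) : NStep O B₁ B₂
  | flip (R : BasicRole) : NStep O (.some R) (.some R.flip)

theorem RSub.flip {O : Ontology} {R₁ R₂ : BasicRole} (h : ReflTransGen (RStep O) R₁ R₂) :
    ReflTransGen (RStep O) R₁.flip R₂.flip :=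
  ReflTransGen.lift BasicRole.flip (fun _ _ => RStep.flip) _ _ h

theorem RSub.some {O : Ontology} {R₁ R₂ : BasicRole} (h : ReflTransGen (RStep O) R₁ R₂) :
    ReflTransGen (BStep O) (.some R₁) (.some R₂) :=
  ReflTransGen.lift BasicConcept.some (fun _ _ => BStep.some) _ _ h

/-- The term for a variable in the head of an instance of a mapping assertion. -/
def headTerm (m : GLAVAssertion) (c : List Const) (v : Var) : Tm :=
  match (m.target.zip c).lookup v with
  | some a => .const a
  | none => .null m c v

/-- The mapping assertion is triggered by the tuple. -/
def Instance (S : System) (m : GLAVAssertion) (c : List Const) : Prop :=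
  m ∈ S.spec.mapping ∧ c ∈ sourceAnswers m.sourceQuery S.database

/-- The role assertions that the mapping yields. -/
inductive SeedRole (S : System) : BasicRole → Tm → Tm → Prop
  | atomic {m : GLAVAssertion} {c : List Const} {P : Name} {v w : Var} (hm : Instance S m c)
      (h : .role P v w ∈ m.ontologyBody) :
      SeedRole S (.atomic P) (headTerm m c v) (headTerm m c w)
  | inv {m : GLAVAssertion} {c : List Const} {P : Name} {v w : Var} (hm : Instance S m c)
      (h : .role P v w ∈ m.ontologyBody) :
      SeedRole S (.inv P) (headTerm m c w) (headTerm m c v)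

/-- The concept assertions that the mapping yields. -/
inductive SeedConcept (S : System) : BasicConcept → Tm → Prop
  | dom {c : Const} (h : c ∈ Database.dom S.database) : SeedConcept S (.atomic .top) (.const c)
  | concept {m : GLAVAssertion} {c : List Const} {A : AtomicConcept} {v : Var}
      (hm : Instance S m c) (h : .concept A v ∈ m.ontologyBody) :
      SeedConcept S (.atomic A) (headTerm m c v)
  | role {R : BasicRole} {t u : Tm} (h : SeedRole S R t u) : SeedConcept S (.some R) t

theorem SeedRole.flip {S : System} {R : BasicRole} {t u : Tm} (h : SeedRole S R t u) :
    SeedRole S R.flip u t := by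
  cases h with
  | atomic hm h => exact .inv hm h
  | inv hm h => exact .atomic hm h

/-- Constants and the objects for the existential variables of the mapping. -/
def Tm.IsGround : Tm → Prop
  | .const _ => True
  | .null _ _ _ => True
  | _ => False

theorem isGround_headTerm (m : GLAVAssertion) (c : List Const) (v : Var) :
    (headTerm m c v).IsGround := by
  rw [headTerm]
  split <;> trivial

theorem SeedRole.isGround {S : System} {R : BasicRole} {t u : Tm} (h : SeedRole S R t u) :
    t.IsGround ∧ u.IsGround := by
  cases h with
  | atomic => exact ⟨isGround_headTerm _ _ _, isGround_headTerm _ _ _⟩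
  | inv => exact ⟨isGround_headTerm _ _ _, isGround_headTerm _ _ _⟩

/-- The concepts that generate the type of a term. -/
def Base (S : System) : Tm → BasicConcept → Prop
  -- The type of a successor depends only on the role by which it is reached. Cutting terms rests on
  -- this.
  | .child R _, B => B = .some R.flip
  | .root B₀, B => B = B₀
  | t, B => SeedConcept S B t

/-- The basic concepts of a term in the canonical model. -/
def Typ (S : System) (B : BasicConcept) (t : Tm) : Prop :=
  ∃ B₀, Base S t B₀ ∧ ReflTransGen (BStep S.spec.ontology) B₀ B

/-- The roles that generate those between two terms. -/
def RBase (S : System) (R : BasicRole) (t u : Tm) : Prop :=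
  SeedRole S R t u ∨ u = .child R t ∨ t = .child R.flip u

/-- The basic roles between two terms in the canonical model. -/
def Rol (S : System) (R : BasicRole) (t u : Tm) : Prop :=
  ∃ R₀, RBase S R₀ t u ∧ ReflTransGen (RStep S.spec.ontology) R₀ R

/-- Concepts that are non-empty by the seeds. -/
def Start (S : System) (B : BasicConcept) : Prop :=
  B = .atomic .top ∨ ∃ t, SeedConcept S B t

/-- The concepts that are non-empty in the canonical model. -/
def NonEmp (S : System) (B : BasicConcept) : Prop :=
  ∃ B₀, Start S B₀ ∧ ReflTransGen (NStep S.spec.ontology) B₀ B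

/-- The terms of the canonical model. -/
def Valid (S : System) : Tm → Prop
  | .child R t => Valid S t ∧ Typ S (.some R) t
  | .root B => NonEmp S B
  | t => ∃ B, SeedConcept S B t

variable {S : System}

theorem base_of_isGround {t : Tm} (h : t.IsGround) {B : BasicConcept} :
    Base S t B ↔ SeedConcept S B t := by
  cases t <;> first | exact Iff.rfl | exact h.elim

theorem valid_of_isGround {t : Tm} (h : t.IsGround) :
    Valid S t ↔ ∃ B, SeedConcept S B t := by
  cases t <;> first | exact Iff.rfl | exact h.elim

theorem SeedConcept.isGround {B : BasicConcept} {t : Tm} (h : SeedConcept S B t) :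
    t.IsGround := by
  cases h with
  | dom => trivial
  | concept => exact isGround_headTerm _ _ _
  | role h => exact h.isGround.1

theorem SeedConcept.valid {B : BasicConcept} {t : Tm} (h : SeedConcept S B t) : Valid S t :=
  (valid_of_isGround h.isGround).2 ⟨B, h⟩

theorem SeedConcept.typ {B : BasicConcept} {t : Tm} (h : SeedConcept S B t) : Typ S B t :=
  ⟨B, (base_of_isGround h.isGround).2 h, .refl⟩

theorem NonEmp.steps {B₁ B₂ : BasicConcept} (h : NonEmp S B₁)
    (h' : ReflTransGen (BStep S.spec.ontology) B₁ B₂) : NonEmp S B₂ := by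
  obtain ⟨B₀, h₀, h⟩ := h
  exact ⟨B₀, h₀, h.trans (ReflTransGen.mono (fun _ _ => .step) _ _ h')⟩

theorem NonEmp.flip {R : BasicRole} (h : NonEmp S (.some R)) : NonEmp S (.some R.flip) := by
  obtain ⟨B₀, h₀, h⟩ := h
  exact ⟨B₀, h₀, h.tail (.flip R)⟩

/-- At a successor, `∃R` is non-empty because the parent belongs to it; hence the concept for the
inverse role, which generates the type of the successor, is non-empty too. -/
theorem Valid.nonEmp {t : Tm} (ht : Valid S t) {B : BasicConcept} (h : Typ S B t) :
    NonEmp S B := by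
  induction t generalizing B with
  | const c =>
    obtain ⟨B₀, h₀, h⟩ := h
    exact NonEmp.steps ⟨B₀, .inr ⟨_, h₀⟩, .refl⟩ h
  | null m c z =>
    obtain ⟨B₀, h₀, h⟩ := h
    exact NonEmp.steps ⟨B₀, .inr ⟨_, h₀⟩, .refl⟩ h
  | child R t ih =>
    obtain ⟨_, rfl, h⟩ := h
    exact NonEmp.steps (ih ht.1 ht.2).flip h
  | root B₀ =>
    obtain ⟨_, rfl, h⟩ := h
    exact NonEmp.steps ht h

theorem Valid.typ_top {t : Tm} (ht : Valid S t) : Typ S (.atomic .top) t := by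
  cases t with
  | const c =>
    obtain ⟨B, h⟩ := ht
    exact ⟨B, h, .single (.top B)⟩
  | null m c z =>
    obtain ⟨B, h⟩ := ht
    exact ⟨B, h, .single (.top B)⟩
  | child R t => exact ⟨_, rfl, .single (.top _)⟩
  | root B₀ => exact ⟨_, rfl, .single (.top _)⟩

theorem RBase.flip {R : BasicRole} {t u : Tm} (h : RBase S R t u) : RBase S R.flip u t := by
  rcases h with h | h | h
  · exact .inl h.flip
  · exact .inr (.inr (by rw [BasicRole.flip_flip]; exact h))
  · exact .inr (.inl h)

theorem Rol.flip {R : BasicRole} {t u : Tm} (h : Rol S R t u) : Rol S R.flip u t := by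
  obtain ⟨R₀, h₀, h⟩ := h
  exact ⟨R₀.flip, h₀.flip, RSub.flip h⟩

theorem Typ.steps {B₁ B₂ : BasicConcept} {t : Tm} (h : Typ S B₁ t)
    (h' : ReflTransGen (BStep S.spec.ontology) B₁ B₂) : Typ S B₂ t := by
  obtain ⟨B₀, h₀, h⟩ := h
  exact ⟨B₀, h₀, h.trans h'⟩

/-- A role seed is also a concept seed; validity of a successor includes that its parent has the
existential concept; and a successor has the inverse one by definition of its base. -/
theorem Rol.typ {R : BasicRole} {t u : Tm} (hu : Valid S u) (h : Rol S R t u) :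
    Typ S (.some R) t := by
  obtain ⟨R₀, h₀, h⟩ := h
  refine Typ.steps ?_ (RSub.some h)
  rcases h₀ with h₀ | rfl | rfl
  · exact (SeedConcept.role h₀).typ
  · exact hu.2
  · exact ⟨_, by rw [Base, BasicRole.flip_flip], .refl⟩

/-- The ontology is violated in the canonical model. -/
def Violation (S : System) : Prop :=
  NonEmp S (.atomic .bot) ∨
  (∃ B₁ B₂ t, .conceptDisj B₁ B₂ ∈ S.spec.ontology ∧ Valid S t ∧ Typ S B₁ t ∧ Typ S B₂ t) ∨
  (∃ R₁ R₂ t u, .roleDisj R₁ R₂ ∈ S.spec.ontology ∧ Valid S t ∧ Valid S u ∧ Rol S R₁ t u ∧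
    Rol S R₂ t u)

/-! ### The canonical interpretation is a model if there is no violation -/

theorem valid_root_top : Valid S (.root (.atomic .top)) :=
  ⟨_, .inl rfl, .refl⟩

open Classical in
/-- The canonical model. -/
noncomputable def canonical (S : System) : Interpretation where
  Domain := {t // Valid S t}
  nonempty := ⟨⟨_, valid_root_top⟩⟩
  concept A := {t | Typ S (.atomic (.name A)) t.1}
  role P := {p | Rol S (.atomic P) p.1.1 p.2.1}
  -- Constants outside the database occur neither in the tuples that trigger the mapping nor in
  -- answers, so any element may interpret them.
  const c := if h : c ∈ Database.dom S.database then ⟨.const c, (SeedConcept.dom h).valid⟩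
    else ⟨_, valid_root_top⟩

theorem canonical_role {R : BasicRole} {t u : (canonical S).Domain} :
    (t, u) ∈ (canonical S).basicRole R ↔ Rol S R t.1 u.1 := by
  cases R with
  | atomic P => exact Iff.rfl
  | inv P => exact ⟨fun h => h.flip, fun h => h.flip⟩

/-- An element with `∃R` in its type always has the successor `child R t` as a witness. The absence
of violations is needed for `⊥` only. -/
theorem canonical_concept (hv : ¬ Violation S) {B : BasicConcept} {t : (canonical S).Domain} :
    t ∈ (canonical S).basicConcept B ↔ Typ S B t.1 := by
  cases B with
  | atomic A =>
    cases A with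
    | top => exact ⟨fun _ => t.2.typ_top, fun _ => trivial⟩
    | bot => exact ⟨fun h => h.elim, fun h => (hv (.inl (t.2.nonEmp h))).elim⟩
    | name A => exact Iff.rfl
  | some R =>
    constructor
    · rintro ⟨u, h⟩
      exact (canonical_role.1 h).typ u.2
    · intro h
      exact ⟨⟨.child R t.1, t.2, h⟩, canonical_role.2 ⟨R, .inr (.inl rfl), .refl⟩⟩

/-- Target lists may repeat variables. Since the tuple arises from an assignment, repeated variables
carry the same constant, and looking up the first entry is correct. -/
theorem lookup_zip_map {ts : List Var} {h : Var → Const} {v : Var} :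
    (ts.zip (ts.map h)).lookup v = if v ∈ ts then some (h v) else none := by
  induction ts with
  | nil => simp
  | cons t ts ih =>
    rw [List.map_cons, List.zip_cons_cons, List.lookup_cons]
    by_cases e : v = t
    · simp [e]
    · rw [beq_false_of_ne e, ih]
      simp [e]

open Classical in
/-- The element of the canonical model given by a term. -/
noncomputable def element (S : System) (t : Tm) : (canonical S).Domain :=
  if h : Valid S t then ⟨t, h⟩ else ⟨_, valid_root_top⟩

theorem element_val {t : Tm} (h : Valid S t) : (element S t).1 = t :=
  congrArg Subtype.val (dif_pos h)

theorem canonical_const {c : Const} (h : c ∈ Database.dom S.database) :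
    ((canonical S).const c).1 = .const c :=
  congrArg Subtype.val (dif_pos h)

theorem canonical_satMapping (hv : ¬ Violation S) :
    (canonical S).SatMapping S.database S.spec.mapping := by
  intro m hm c hc
  have hi : Instance S m c := ⟨hm, hc⟩
  obtain ⟨hdom, k, hk, -⟩ := hc
  have hk : m.target.map k = c := hk
  refine ⟨fun v => element S (headTerm m c v), ?_, ?_⟩
  · change m.target.map _ = _
    nth_rewrite 2 [← hk]
    rw [List.map_map]
    refine List.map_congr_left fun v hv => ?_
    have hd : k v ∈ Database.dom S.database := hdom _ (by
      rw [← hk]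
      exact List.mem_map_of_mem hv)
    have ht : headTerm m c v = .const (k v) := by
      rw [headTerm, ← hk, lookup_zip_map, if_pos hv]
    apply Subtype.ext
    rw [ht, element_val (SeedConcept.dom hd).valid]
    exact (canonical_const hd).symm
  · intro α hα
    cases α with
    | concept A v =>
      have hs := SeedConcept.concept hi hα
      refine (canonical_concept hv (B := .atomic A)).2 ?_
      rw [element_val hs.valid]
      exact hs.typ
    | role P v w =>
      have hs := SeedRole.atomic hi hα
      refine (canonical_role (R := .atomic P)).2 ?_
      rw [element_val (SeedConcept.role hs).valid, element_val (SeedConcept.role hs.flip).valid]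
      exact ⟨_, .inl hs, .refl⟩

/-- Types and roles are closed under the positive inclusions by construction, and a failing
disjointness assertion would be a violation. -/
theorem canonical_isModel (hv : ¬ Violation S) : (canonical S).IsModel S := by
  refine ⟨?_, canonical_satMapping hv⟩
  rintro (⟨B₁, B₂⟩ | ⟨R₁, R₂⟩ | ⟨B₁, B₂⟩ | ⟨R₁, R₂⟩) ha
  · intro t ht
    exact (canonical_concept hv).2 (((canonical_concept hv).1 ht).steps (.single (.incl ha)))
  · rintro ⟨t, u⟩ h
    obtain ⟨R₀, h₀, h⟩ := canonical_role.1 h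
    exact canonical_role.2 ⟨R₀, h₀, h.tail (.inl ha)⟩
  · refine Set.eq_empty_of_forall_notMem fun t ⟨h₁, h₂⟩ => hv (.inr (.inl ?_))
    exact ⟨B₁, B₂, t.1, ha, t.2, (canonical_concept hv).1 h₁, (canonical_concept hv).1 h₂⟩
  · refine Set.eq_empty_of_forall_notMem fun ⟨t, u⟩ ⟨h₁, h₂⟩ => hv (.inr (.inr ?_))
    exact ⟨R₁, R₂, t.1, u.1, ha, t.2, u.2, canonical_role.1 h₁, canonical_role.1 h₂⟩

/-! #### Violations near the roots -/

theorem Rol.child_right {R R₀ : BasicRole} {t u : Tm} (h : Rol S R t (.child R₀ u)) :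
    (t = u ∧ ReflTransGen (RStep S.spec.ontology) R₀ R) ∨ ∃ R₁, t = .child R₁ (.child R₀ u) := by
  obtain ⟨R', h₀, h⟩ := h
  rcases h₀ with h₀ | h₀ | h₀
  · exact h₀.isGround.2.elim
  · cases h₀
    exact .inl ⟨rfl, h⟩
  · exact .inr ⟨_, h₀⟩

/-- A violation that involves no deep terms. -/
theorem Violation.shallow (h : Violation S) : NonEmp S (.atomic .bot) ∨
    (∃ B₁ B₂ t, .conceptDisj B₁ B₂ ∈ S.spec.ontology ∧ Valid S t ∧ (∀ R u, t ≠ .child R u) ∧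
      Typ S B₁ t ∧ Typ S B₂ t) ∨
    (∃ R₁ R₂ R₁' R₂' t u, .roleDisj R₁ R₂ ∈ S.spec.ontology ∧ SeedRole S R₁' t u ∧
      SeedRole S R₂' t u ∧ ReflTransGen (RStep S.spec.ontology) R₁' R₁ ∧
      ReflTransGen (RStep S.spec.ontology) R₂' R₂) ∨
    ∃ R₁ R₂ R, .roleDisj R₁ R₂ ∈ S.spec.ontology ∧ NonEmp S (.some R) ∧
      ((ReflTransGen (RStep S.spec.ontology) R R₁ ∧ ReflTransGen (RStep S.spec.ontology) R R₂) ∨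
      (ReflTransGen (RStep S.spec.ontology) R R₁.flip ∧
        ReflTransGen (RStep S.spec.ontology) R R₂.flip)) := by
  rcases h with h | ⟨B₁, B₂, t, ha, ht, h₁, h₂⟩ | ⟨R₁, R₂, t, u, ha, ht, hu, h₁, h₂⟩
  · exact .inl h
  · refine .inr (.inl ?_)
    cases t with
    | child R t =>
      -- The successor has the same type as the representative of the range of its role, which takes
      -- its place.
      exact ⟨B₁, B₂, .root (.some R.flip), ha, (ht.1.nonEmp ht.2).flip, by simp, h₁, h₂⟩
    | const c => exact ⟨B₁, B₂, _, ha, ht, by simp, h₁, h₂⟩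
    | null m c z => exact ⟨B₁, B₂, _, ha, ht, by simp, h₁, h₂⟩
    | root B => exact ⟨B₁, B₂, _, ha, ht, by simp, h₁, h₂⟩
  · refine .inr (.inr ?_)
    obtain ⟨R₁', h₁', s₁⟩ := id h₁
    obtain ⟨R₂', h₂', s₂⟩ := id h₂
    rcases h₁' with h₁' | rfl | rfl
    · rcases h₂' with h₂' | rfl | rfl
      · exact .inl ⟨R₁, R₂, R₁', R₂', t, u, ha, h₁', h₂', s₁, s₂⟩
      · exact h₁'.isGround.2.elim
      · exact h₁'.isGround.1.elim
    -- Both roles stem from the single edge to a successor, so one role implies both. What matters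
    -- is only that this role is non-empty.
    · refine .inr ⟨R₁, R₂, R₁', ha, ht.nonEmp hu.2, .inl ⟨s₁, ?_⟩⟩
      rcases h₂.child_right with ⟨-, h⟩ | ⟨R, h⟩
      · exact h
      -- The edge cannot also arise in the opposite direction, since a term is not a proper subterm
      -- of itself.
      · have := congrArg sizeOf h
        simp at this
        omega
    · refine .inr ⟨R₁, R₂, R₁'.flip, ha, hu.nonEmp ht.2, .inr ⟨RSub.flip s₁, ?_⟩⟩
      rcases h₂.flip.child_right with ⟨-, h⟩ | ⟨R, h⟩
      · exact h
      · have := congrArg sizeOf h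
        simp at this
        omega

/-! #### Matches of queries at small depth -/

/-- The number of successor steps in a term. -/
def Tm.depth : Tm → ℕ
  | .child _ t => t.depth + 1
  | _ => 0

/-- The term with the part below level `k` cut off. -/
def Tm.cut (k : ℕ) : Tm → Tm
  | .child R t => if t.depth < k then .child R t else if t.depth = k then .root (.some R.flip)
      else .child R (t.cut k)
  | t => t

theorem Tm.cut_of_depth_le {k : ℕ} {t : Tm} (h : t.depth ≤ k) : t.cut k = t := by
  cases t with
  | child R t => rw [Tm.cut, if_pos (show t.depth < k from h)]
  | _ => rfl

theorem Tm.depth_cut_le (k : ℕ) (t : Tm) : (t.cut k).depth ≤ t.depth := by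
  induction t with
  | child R t ih =>
    rw [Tm.cut]
    split_ifs
    · exact le_rfl
    · exact Nat.zero_le _
    · exact Nat.succ_le_succ ih
  | _ => exact le_rfl

theorem Tm.depth_cut_lt {k : ℕ} {t : Tm} (h : k < t.depth) : (t.cut k).depth < t.depth := by
  induction t with
  | child R t ih =>
    rw [Tm.depth] at h
    rw [Tm.cut]
    split_ifs with h₁ h₂
    · omega
    · exact Nat.succ_pos _
    · exact Nat.succ_lt_succ (ih (by omega))
  | _ => simp [Tm.depth] at h

/-- The root that replaces a successor is the representative of the range of its last role and
generates the same type. In all other cases the outermost symbol is unchanged. -/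
theorem base_cut {k : ℕ} {t : Tm} {B : BasicConcept} : Base S (t.cut k) B ↔ Base S t B := by
  cases t with
  | child R t =>
    rw [Tm.cut]
    split_ifs <;> exact Iff.rfl
  | _ => exact Iff.rfl

theorem Typ.cut {k : ℕ} {t : Tm} {B : BasicConcept} (h : Typ S B t) : Typ S B (t.cut k) := by
  obtain ⟨B₀, h₀, h⟩ := h
  exact ⟨B₀, base_cut.2 h₀, h⟩

/-- The new root is admissible because the roles used in a valid term, and so their inverses, are
non-empty; successors above it stay valid because cutting preserves types. -/
theorem Valid.cut {k : ℕ} {t : Tm} (h : Valid S t) : Valid S (t.cut k) := by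
  induction t with
  | child R t ih =>
    rw [Tm.cut]
    split_ifs
    · exact h
    · exact (h.1.nonEmp h.2).flip
    · exact ⟨ih h.1, h.2.cut⟩
  | _ => exact h

theorem Tm.IsGround.depth {t : Tm} (h : t.IsGround) : t.depth = 0 := by
  cases t <;> first | rfl | exact h.elim

theorem cut_child {k : ℕ} {R : BasicRole} {t : Tm} (h : t.depth ≠ k) :
    (Tm.child R t).cut k = .child R (t.cut k) := by
  rw [Tm.cut]
  split_ifs with h'
  · rw [Tm.cut_of_depth_le h'.le]
  · rfl

/-- Cutting separates only terms of depth `k` from their successors. An edge without an end of depth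
`k` lies on one side of the cut and is kept. -/
theorem Rol.cut {k : ℕ} {t u : Tm} {R : BasicRole} (h : Rol S R t u) (ht : t.depth ≠ k)
    (hu : u.depth ≠ k) : Rol S R (t.cut k) (u.cut k) := by
  obtain ⟨R₀, h₀, h⟩ := h
  refine ⟨R₀, ?_, h⟩
  rcases h₀ with h₀ | rfl | rfl
  · rw [Tm.cut_of_depth_le (by simp [h₀.isGround.1.depth]),
      Tm.cut_of_depth_le (by simp [h₀.isGround.2.depth])]
    exact .inl h₀
  · exact .inr (.inl (cut_child ht))
  · exact .inr (.inr (cut_child hu))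

def OntologyAtom.vars : OntologyAtom → List Var
  | .concept _ v => [v]
  | .role _ v w => [v, w]

/-- The atom holds in the canonical model under the assignment of terms to variables. -/
def Holds (S : System) (h : Var → Tm) : OntologyAtom → Prop
  | .concept A v => Typ S (.atomic A) (h v)
  | .role P v w => Rol S (.atomic P) (h v) (h w)

theorem Holds.cut {k : ℕ} {h : Var → Tm} {α : OntologyAtom} (hα : Holds S h α)
    (hk : ∀ v ∈ α.vars, (h v).depth ≠ k) : Holds S (fun v => (h v).cut k) α := by
  cases α with
  | concept A v => exact Typ.cut hα
  | role P v w =>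
    exact Rol.cut hα (hk v (by simp [OntologyAtom.vars])) (hk w (by simp [OntologyAtom.vars]))

/-- A match can be chosen with depth less than the number of variables. -/
theorem exists_shallow_match (b : List OntologyAtom) (vs : List Var)
    (hvs : ∀ α ∈ b, ∀ v ∈ α.vars, v ∈ vs) (h : Var → Tm) (hval : ∀ v, Valid S (h v))
    (hb : ∀ α ∈ b, Holds S h α) :
    ∃ h' : Var → Tm, (∀ v, Valid S (h' v)) ∧ (∀ α ∈ b, Holds S h' α) ∧
      (∀ v ∈ vs, (h' v).depth < vs.length) ∧ ∀ v c, h v = .const c → h' v = .const c := by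
  induction hn : (vs.map fun v => (h v).depth).sum using Nat.strong_induction_on generalizing h with
  | _ n ih =>
  subst hn
  by_cases hd : ∀ v ∈ vs, (h v).depth < vs.length
  · exact ⟨h, hval, hb, hd, fun _ _ => id⟩
  push Not at hd
  obtain ⟨v, hv, hd⟩ := hd
  -- Pigeonhole: the levels up to the depth of `h v` outnumber the variables, so one of them is not
  -- the depth of any value.
  obtain ⟨k, hk, hkv⟩ : ∃ k ∈ Finset.range ((h v).depth + 1),
      k ∉ (vs.map fun v => (h v).depth).toFinset := by
    refine Finset.exists_mem_notMem_of_card_lt_card ?_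
    refine (List.toFinset_card_le _).trans_lt ?_
    simp
    omega
  have hkv : ∀ w ∈ vs, (h w).depth ≠ k := by simpa using hkv
  have hlt : k < (h v).depth := by
    have := hkv v hv
    have := Finset.mem_range.1 hk
    omega
  -- Cutting at the unoccupied level keeps all atoms, increases no depth and lowers that of `h v`,
  -- so the sum of the depths decreases.
  obtain ⟨h', h1, h2, h3, h4⟩ := ih _ (List.sum_lt_sum _ _ (fun w _ => Tm.depth_cut_le k (h w))
    ⟨v, hv, Tm.depth_cut_lt hlt⟩) (fun v => (h v).cut k) (fun v => (hval v).cut)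
    (fun α hα => (hb α hα).cut fun v hv => hkv v (hvs α hα v hv)) rfl
  refine ⟨h', h1, h2, h3, fun v c e => h4 v c ?_⟩
  rw [e]
  rfl

/-- The variables of a query. -/
def CQ.vars (q : CQ OntologyAtom) : List Var :=
  q.target ++ q.body.flatMap OntologyAtom.vars

/-- Certain answers of a system without violations have shallow matches in the canonical
model. -/
theorem exists_match (hv : ¬ Violation S) {q : UCQ} {c : List Const}
    (hc : c ∈ certainAnswers q S) : ∃ d ∈ q.disjuncts, ∃ h : Var → Tm,
      d.target.map h = c.map .const ∧ (∀ v, Valid S (h v)) ∧ (∀ α ∈ d.body, Holds S h α) ∧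
      ∀ v ∈ d.vars, (h v).depth < d.vars.length := by
  obtain ⟨-, hdom, h⟩ := hc
  obtain ⟨d, hd, h, ht, hb⟩ := h _ (canonical_isModel hv)
  have ht' : d.target.map (fun v => (h v).1) = c.map .const := by
    have := congrArg (List.map fun t : (canonical S).Domain => t.1) ht
    rw [List.map_map, List.map_map] at this
    exact this.trans (List.map_congr_left fun a ha => canonical_const (hdom a ha))
  obtain ⟨h', h1, h2, h3, h4⟩ := exists_shallow_match (S := S) d.body d.vars (fun α hα v hv =>
    List.mem_append_right _ (List.mem_flatMap.2 ⟨α, hα, hv⟩)) (fun v => (h v).1)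
    (fun v => (h v).2) (fun α hα => by
      have := hb α hα
      cases α with
      | concept A v => exact (canonical_concept hv (B := .atomic A)).1 this
      | role P v w => exact this)
  refine ⟨d, hd, h', ?_, h1, h2, h3⟩
  rw [← ht']
  refine List.map_congr_left fun v hv => ?_
  -- The values of target variables are constants, which survive the passage to the shallow match.
  have : (h v).1 ∈ c.map Tm.const := by
    rw [← ht']
    exact List.mem_map.2 ⟨v, hv, rfl⟩
  obtain ⟨a, -, ha⟩ := List.mem_map.1 this
  rw [← ha]
  exact h4 v a ha.symm

end OBDM

/-! ### Completeness of the clauses: codes, lists and assignments -/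

namespace OBDM

open Clause

/-- The fact has a derivation with at most `k` steps in which all words have length at most
`ℓ`. -/
def Derivable (ℓ k : ℕ) (f : Horn.Fact Pr Sym) : Prop :=
  ∃ n ≤ k, Horn.Ders clauses ℓ n [f]

theorem Derivable.mono {ℓ k k' : ℕ} {f : Horn.Fact Pr Sym} (h : Derivable ℓ k f) (hk : k ≤ k') :
    Derivable ℓ k' f := by
  obtain ⟨n, hn, h⟩ := h
  exact ⟨n, hn.trans hk, h⟩

/-- All words of the list are short. -/
def Bounded (ℓ : ℕ) : List (List Sym) → Prop
  | [] => True
  | w :: ws => w.length ≤ ℓ ∧ Bounded ℓ ws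

/-- The substitution given by a list of words. -/
def sub (l : List (List Sym)) (i : Fin 10) : List Sym :=
  l.getD i []

theorem Bounded.sub {ℓ : ℕ} {l : List (List Sym)} (h : Bounded ℓ l) (i : Fin 10) :
    (sub l i).length ≤ ℓ := by
  have : ∀ n, (l.getD n []).length ≤ ℓ := by
    induction l with
    | nil => simp
    | cons w ws ih =>
      rintro (_ | n)
      · simpa using h.1
      · simpa using ih h.2 n
  exact this i

/-- All facts of the list are derivable in `c` steps each. -/
def AllDerivable (ℓ c : ℕ) : List (Horn.Fact Pr Sym) → Prop
  | [] => True
  | f :: fs => Derivable ℓ c f ∧ AllDerivable ℓ c fs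

/-- The last fact of the list is derivable in `k` steps, and the others in `c` steps each. -/
def AllDerivableLast (ℓ c k : ℕ) : List (Horn.Fact Pr Sym) → Prop
  | [] => True
  | [f] => Derivable ℓ k f
  | f :: g :: fs => Derivable ℓ c f ∧ AllDerivableLast ℓ c k (g :: fs)

theorem AllDerivable.ders {ℓ c : ℕ} {fs : List (Horn.Fact Pr Sym)} (h : AllDerivable ℓ c fs) :
    ∃ n ≤ fs.length * c, Horn.Ders clauses ℓ n fs := by
  induction fs with
  | nil => exact ⟨0, Nat.zero_le _, .nil⟩
  | cons f fs ih =>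
    obtain ⟨⟨m, hm, hf⟩, h⟩ := h
    obtain ⟨n, hn, h⟩ := ih h
    exact ⟨m + n, by rw [List.length_cons, add_mul]; omega, hf.append h⟩

theorem AllDerivableLast.ders {ℓ c k : ℕ} {fs : List (Horn.Fact Pr Sym)}
    (h : AllDerivableLast ℓ c k fs) :
    ∃ n ≤ fs.length * c + k, Horn.Ders clauses ℓ n fs := by
  induction fs with
  | nil => exact ⟨0, Nat.zero_le _, .nil⟩
  | cons f fs ih =>
    cases fs with
    | nil =>
      obtain ⟨m, hm, hf⟩ := h
      exact ⟨m, by omega, hf⟩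
    | cons g fs =>
      obtain ⟨⟨m, hm, hf⟩, h⟩ := h
      obtain ⟨n, hn, h⟩ := ih h
      exact ⟨m + n, by rw [List.length_cons, add_mul]; omega, hf.append h⟩

variable {ℓ : ℕ}

theorem Derivable.of_rule {r : HRule} (hr : r ∈ clauses) (l : List (List Sym)) (hl : Bounded ℓ l)
    {c k : ℕ} (h : AllDerivable ℓ c (r.body.map (Horn.Atom.inst (sub l))))
    (hk : r.body.length * c + 1 ≤ k) : Derivable ℓ k (r.head.inst (sub l)) := by
  obtain ⟨n, hn, h⟩ := h.ders
  rw [List.length_map] at hn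
  exact ⟨n + 1, by omega, .cons hr _ hl.sub (by simpa using h)⟩

theorem Derivable.of_rec {r : HRule} (hr : r ∈ clauses) (l : List (List Sym)) (hl : Bounded ℓ l)
    {c k k' : ℕ} (h : AllDerivableLast ℓ c k (r.body.map (Horn.Atom.inst (sub l))))
    (hk : r.body.length * c + k + 1 ≤ k') : Derivable ℓ k' (r.head.inst (sub l)) := by
  obtain ⟨n, hn, h⟩ := h.ders
  rw [List.length_map] at hn
  exact ⟨n + 1, by omega, .cons hr _ hl.sub (by simpa using h)⟩

/-- Bodies of clauses have bounded length, and the base `ℓ + 16` exceeds the bound. An application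
of a clause thus raises the exponent by one. -/
theorem step_le (ℓ j : ℕ) {b : ℕ} (hb : b ≤ 14) : b * (ℓ + 16) ^ j + 1 ≤ (ℓ + 16) ^ (j + 1) := by
  have h : 1 ≤ (ℓ + 16) ^ j := Nat.one_le_pow _ _ (by omega)
  rw [pow_succ]
  nlinarith

/-- A recursion along a list of at most `ℓ` entries also raises the exponent by one only. Costs are
therefore tracked by exponents alone. -/
theorem list_le {ℓ n : ℕ} (j : ℕ) (hn : n ≤ ℓ) :
    n * (ℓ + 16) ^ j + (ℓ + 16) ^ j ≤ (ℓ + 16) ^ (j + 1) := by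
  have h : 1 ≤ (ℓ + 16) ^ j := Nat.one_le_pow _ _ (by omega)
  rw [pow_succ]
  nlinarith

/-- A fact is derivable at degree `j` if it is so in `(ℓ + 16) ^ j` steps. -/
abbrev Deg (ℓ j : ℕ) (f : Horn.Fact Pr Sym) : Prop :=
  Derivable ℓ ((ℓ + 16) ^ j) f

theorem pow_le_pow_of_le (ℓ : ℕ) {i j : ℕ} (h : i ≤ j) : (ℓ + 16) ^ i ≤ (ℓ + 16) ^ j :=
  Nat.pow_le_pow_right (by omega) h

theorem Deg.le {i j : ℕ} {f : Horn.Fact Pr Sym} (h : Deg ℓ i f) (hij : i ≤ j) : Deg ℓ j f :=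
  h.mono (pow_le_pow_of_le ℓ hij)

theorem Deg.of_rule {r : HRule} (hr : r ∈ clauses) (l : List (List Sym)) (hl : Bounded ℓ l)
    {j : ℕ} (h : AllDerivable ℓ ((ℓ + 16) ^ j) (r.body.map (Horn.Atom.inst (sub l))))
    (hb : Nat.ble r.body.length 14 = true := by rfl) : Deg ℓ (j + 1) (r.head.inst (sub l)) :=
  Derivable.of_rule hr l hl h (step_le ℓ j (Nat.le_of_ble_eq_true hb))

theorem Deg.of_rec {r : HRule} (hr : r ∈ clauses) (l : List (List Sym)) (hl : Bounded ℓ l)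
    {j k : ℕ} (h : AllDerivableLast ℓ ((ℓ + 16) ^ j) k (r.body.map (Horn.Atom.inst (sub l))))
    (hb : Nat.ble r.body.length 14 = true := by rfl) :
    Derivable ℓ (k + (ℓ + 16) ^ (j + 1)) (r.head.inst (sub l)) :=
  Derivable.of_rec hr l hl h (by have := step_le ℓ j (Nat.le_of_ble_eq_true hb); omega)

/-! #### Codes -/

/-- The maximum is attained by `.input`, where five parts follow the ontology. -/
theorem length_langs_le {Ms : List NT} {N : NT} {a : Sym} {Ns : List NT} (h : prod N a = some Ns)
    (hM : Ms <:+ Ns) : Ms.length ≤ 5 := by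
  refine hM.length_le.trans ?_
  cases N <;> cases a <;> simp [prod] at h <;> subst h <;> simp

theorem seq_mem {Ms : List NT} {N : NT} {a : Sym} {Ns : List NT} (h : prod N a = some Ns)
    (hM : Ms <:+ Ns) {r : HRule} (hr : r ∈ seqClauses Ms) : r ∈ clauses := by
  refine letter_mem (N := N) (a := a) ?_
  rw [letterClauses, h]
  simp only [List.mem_cons, List.mem_flatMap, List.mem_tails]
  exact .inr (.inr ⟨Ms, hM, hr⟩)

/-- The parse is followed letter by letter. A letter costs one step for its production, and at most
six for splitting the rest into at most five parts, hence the factor 7. -/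
theorem code_derivable {N : NT} {X : List Sym} (hX : X ∈ lang N) (hl : X.length ≤ ℓ) :
    Derivable ℓ (7 * X.length) (.code N, [X]) := by
  induction hn : X.length using Nat.strong_induction_on generalizing N X with
  | _ n ih =>
  subst hn
  rw [lang_eq_expand] at hX
  obtain ⟨a, Ns, Y, hp, hY, rfl⟩ := hX
  rw [List.length_cons] at hl
  have key : ∀ Ms, Ms <:+ Ns → ∀ Z ∈ langs Ms, Z.length ≤ Y.length →
      Derivable ℓ (7 * Z.length + Ms.length + 1) (.codes Ms, [Z]) := by
    intro Ms
    induction Ms with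
    | nil =>
      rintro hM _ rfl -
      exact Derivable.of_rule (r := codesNil) (seq_mem hp hM (by simp [seqClauses])) [] trivial
        (c := 0) trivial (by simp)
    | cons M Ms ihM =>
      rintro hM _ ⟨X₁, hX₁, X₂, hX₂, rfl⟩ hZ
      rw [List.length_append] at hZ
      obtain ⟨m, hm, h₁⟩ := ih X₁.length (by simp; omega) hX₁ (by omega) rfl
      obtain ⟨n, hn, h₂⟩ := ihM ((List.suffix_cons M Ms).trans hM) X₂ hX₂ (by omega)
      refine ⟨m + n + 1, by simp; omega, Horn.Ders.cons (r := codesCons M Ms)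
        (seq_mem hp hM (by simp [seqClauses])) (sub [X₁, X₂])
        (Bounded.sub ⟨by omega, by omega, trivial⟩) (h₁.append h₂)⟩
  obtain ⟨n, hn, h⟩ := key Ns List.suffix_rfl Y hY le_rfl
  have := length_langs_le hp List.suffix_rfl
  refine ⟨n + 1, by simp; omega, Horn.Ders.cons (r := codeProd N a Ns)
    (letter_mem (N := N) (a := a) (by simp [letterClauses, hp])) (sub [Y])
    (Bounded.sub ⟨by omega, trivial⟩) h⟩

theorem code_deg {N : NT} (X : List Sym) (hX : X ∈ lang N) (hl : X.length ≤ ℓ) :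
    Deg ℓ 2 (.code N, [X]) :=
  (code_derivable hX hl).mono (by nlinarith)

theorem code_name (v : Name) (h : (encodeName v).length ≤ ℓ) :
    Deg ℓ 2 (.code .name, [encodeName v]) :=
  code_deg _ ⟨v, rfl⟩ h

/-- The deterministic parse is followed up to the place where it fails. The additional step is for a
word that ends too early. -/
theorem bad_derivable {N : NT} {X : List Sym} (hX : ∀ Y ∈ lang N, ∀ t, X ≠ Y ++ t)
    (hl : X.length ≤ ℓ) : Derivable ℓ (7 * X.length + 1) (.bad N, [X]) := by
  induction hn : X.length using Nat.strong_induction_on generalizing N X with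
  | _ n ih =>
  subst hn
  cases X with
  | nil =>
    exact Derivable.of_rule (r := badNil N) (category_mem (N := N) (by simp [categoryClauses])) []
      trivial (c := 0) trivial (by simp [badNil])
  | cons a Y =>
  rw [List.length_cons] at hl
  cases hp : prod N a with
  | none =>
    exact Derivable.of_rule (r := badNone N a)
      (letter_mem (N := N) (a := a) (by simp [letterClauses, hp])) [Y] ⟨by omega, trivial⟩ (c := 0)
      trivial (by simp [badNone])
  | some Ns =>
  have key : ∀ Ms, Ms <:+ Ns → ∀ Z : List Sym, Z.length ≤ Y.length →
      (∀ V ∈ langs Ms, ∀ t, Z ≠ V ++ t) →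
      Derivable ℓ (7 * Z.length + Ms.length + 1) (.bads Ms, [Z]) := by
    intro Ms
    induction Ms with
    | nil =>
      intro hM Z _ hZ
      exact absurd rfl (hZ [] rfl Z)
    | cons M Ms ihM =>
      intro hM Z hlen hZ
      -- Either the parse fails within the first part, or that part is split off and the failure
      -- lies in the rest.
      by_cases hb : ∀ V ∈ lang M, ∀ t, Z ≠ V ++ t
      · obtain ⟨m, hm, h₁⟩ := ih Z.length (by simp; omega) hb (by omega) rfl
        exact ⟨m + 1, by simp; omega, Horn.Ders.cons (r := badsHead M Ms)
          (seq_mem hp hM (by simp [seqClauses])) (sub [Z])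
          (Bounded.sub ⟨by omega, trivial⟩) h₁⟩
      · push Not at hb
        obtain ⟨V, hV, t, rfl⟩ := hb
        rw [List.length_append] at hlen
        obtain ⟨m, hm, h₁⟩ := code_derivable hV (ℓ := ℓ) (by omega)
        obtain ⟨n, hn, h₂⟩ := ihM ((List.suffix_cons M Ms).trans hM) t (by omega)
          (fun U hU s e => hZ (V ++ U) ⟨V, hV, U, hU, rfl⟩ s (by rw [e, List.append_assoc]))
        exact ⟨m + n + 1, by simp; omega, Horn.Ders.cons (r := badsTail M Ms)
          (seq_mem hp hM (by simp [seqClauses])) (sub [V, t])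
          (Bounded.sub ⟨by omega, by omega, trivial⟩) (h₁.append h₂)⟩
  obtain ⟨n, hn, h⟩ := key Ns List.suffix_rfl Y le_rfl (fun V hV t e => hX (a :: V)
    (by rw [lang_eq_expand]; exact ⟨a, Ns, V, hp, hV, rfl⟩) t (by rw [e]; rfl))
  have := length_langs_le hp List.suffix_rfl
  exact ⟨n + 1, by simp; omega, Horn.Ders.cons (r := badProd N a Ns)
    (letter_mem (N := N) (a := a) (by simp [letterClauses, hp])) (sub [Y])
    (Bounded.sub ⟨by omega, trivial⟩) h⟩

theorem bad_deg {N : NT} {X : List Sym} (hX : ∀ Y ∈ lang N, ∀ t, X ≠ Y ++ t)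
    (hl : X.length ≤ ℓ) : Deg ℓ 2 (.bad N, [X]) :=
  (bad_derivable hX hl).mono (by nlinarith)

/-! #### Words and lists -/

theorem neq_derivable (X Y : List Sym) (h : X ≠ Y) (hX : X.length ≤ ℓ) (hY : Y.length ≤ ℓ) :
    Derivable ℓ (X.length + 1) (.neq, [X, Y]) := by
  induction X generalizing Y with
  | nil =>
    cases Y with
    | nil => exact absurd rfl h
    | cons b Y =>
      exact Derivable.of_rule (r := neqNilLeft b) (sym_mem (a := b) (by simp [symClauses])) [Y]
        ⟨by simp at hY; omega, trivial⟩ (c := 0) trivial (by simp)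
  | cons a X ih =>
    cases Y with
    | nil =>
      exact Derivable.of_rule (r := neqNilRight a) (sym_mem (a := a) (by simp [symClauses])) [X]
        ⟨by simp at hX; omega, trivial⟩ (c := 0) trivial (by simp)
    | cons b Y =>
      rw [List.length_cons] at hX hY
      by_cases hab : b = a
      · subst hab
        exact Derivable.of_rule (r := neqSame b) (sym_mem (a := b) (by simp [symClauses])) [X, Y]
          ⟨by omega, by omega, trivial⟩
          ⟨ih Y (fun e => h (congrArg (b :: ·) e)) (by omega) (by omega), trivial⟩ (by simp [neqSame])
      · exact Derivable.of_rule (r := neqDiff a b) (sym_mem (a := a) (by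
          simp only [symClauses, List.mem_cons, List.mem_map, List.mem_filter]
          exact .inr (.inr (.inr (.inr ⟨b, ⟨mem_allSyms b, by simpa using hab⟩, rfl⟩))))) [X, Y]
          ⟨by omega, by omega, trivial⟩ (c := 0) trivial (by simp)

theorem neq_deg (X Y : List Sym) (h : X ≠ Y) (hX : X.length ≤ ℓ) (hY : Y.length ≤ ℓ) :
    Deg ℓ 2 (.neq, [X, Y]) :=
  (neq_derivable X Y h hX hY).mono (by nlinarith)

theorem length_le_encodeList {α : Type} (f : α → List Sym) (l : List α) :
    l.length + 1 ≤ (encodeList f l).length := by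
  induction l with
  | nil => simp [encodeList]
  | cons a l ih =>
    simp [encodeList]
    omega

theorem length_mem_encodeList {α : Type} (f : α → List Sym) {l : List α} {a : α} (h : a ∈ l) :
    (f a).length + 2 ≤ (encodeList f l).length := by
  induction l with
  | nil => simp at h
  | cons b l ih =>
    simp only [encodeList, List.length_cons, List.length_append]
    rcases List.mem_cons.1 h with rfl | h
    · have := length_le_encodeList f l
      omega
    · have := ih h
      omega

/-- A bound for a recursion along a list. -/
theorem Deg.of_list {j n : ℕ} {f : Horn.Fact Pr Sym}
    (h : Derivable ℓ (n * (ℓ + 16) ^ j + (ℓ + 16) ^ j) f) (hn : n ≤ ℓ) : Deg ℓ (j + 1) f :=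
  h.mono (list_le j hn)

theorem Deg.base {j n : ℕ} {f : Horn.Fact Pr Sym} (h : Deg ℓ j f) :
    Derivable ℓ (n * (ℓ + 16) ^ j + (ℓ + 16) ^ j) f :=
  h.mono (by omega)

theorem step_mul {ℓ n j k : ℕ} {f : Horn.Fact Pr Sym}
    (h : Derivable ℓ (n * (ℓ + 16) ^ j + k + (ℓ + 16) ^ j) f) :
    Derivable ℓ ((n + 1) * (ℓ + 16) ^ j + k) f :=
  h.mono (by rw [add_mul, one_mul]; omega)

/-- A skipped entry costs degree 3, and summing over at most `ℓ` entries gives degree 4. The other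
lemmas on lists follow the same pattern. -/
theorem mem_deg {N : NT} {α : Type} {f : α → List Sym} (hN : ∀ a, f a ∈ lang N) {a : α}
    {l : List α} (h : a ∈ l) (hl : (encodeList f l).length ≤ ℓ) :
    Deg ℓ 4 (.mem N, [f a, encodeList f l]) := by
  have hlen := length_le_encodeList f l
  refine Deg.of_list (n := l.length) (j := 3) ?_ (by omega)
  induction l with
  | nil => simp at h
  | cons b l ih =>
    have hl' := hl
    simp only [encodeList, List.length_cons, List.length_append] at hl'
    have hfa := length_mem_encodeList f h
    by_cases hab : a ∈ l
    · refine step_mul ?_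
      exact Deg.of_rec (r := memTail N) (j := 2)
        (category_mem (N := N) (by simp [categoryClauses])) [f a, f b, encodeList f l]
        ⟨by omega, by omega, by omega, trivial⟩
        ⟨code_deg (f b) (hN b) (by omega), ih hab (by omega) (length_le_encodeList f l)⟩
    · obtain rfl : a = b := (List.mem_cons.1 h).resolve_right hab
      exact (Deg.of_rule (r := memHead N) (j := 2)
        (category_mem (N := N) (by simp [categoryClauses])) [f a, encodeList f l]
        ⟨by omega, by omega, trivial⟩ ⟨code_deg (f a) (hN a) (by omega), trivial⟩).base

theorem notin_deg {N : NT} {α : Type} {f : α → List Sym} (hN : ∀ a, f a ∈ lang N) {X : List Sym}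
    {l : List α} (h : ∀ a ∈ l, X ≠ f a) (hX : X.length ≤ ℓ) (hl : (encodeList f l).length ≤ ℓ) :
    Deg ℓ 4 (.notin N, [X, encodeList f l]) := by
  have hlen := length_le_encodeList f l
  refine Deg.of_list (n := l.length) (j := 3) ?_ (by omega)
  clear hlen
  induction l with
  | nil =>
    exact (Deg.of_rule (r := notinNil N) (j := 2)
      (category_mem (N := N) (by simp [categoryClauses])) [X] ⟨hX, trivial⟩ trivial).base
  | cons b l ih =>
    have hl' := hl
    simp only [encodeList, List.length_cons, List.length_append] at hl'
    refine step_mul ?_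
    exact Deg.of_rec (r := notinCons N) (j := 2)
      (category_mem (N := N) (by simp [categoryClauses])) [X, f b, encodeList f l]
      ⟨by omega, by omega, by omega, trivial⟩
      ⟨code_deg (f b) (hN b) (by omega), neq_deg X (f b) (h b (by simp)) (by omega) (by omega),
        ih (fun a ha => h a (by simp [ha])) (by omega)⟩

theorem len_deg {l : List Name} (hl : (encodeList encodeName l).length ≤ ℓ) :
    Deg ℓ 4 (.len, [encodeList encodeName l, encodeNat l.length]) := by
  have hlen := length_le_encodeList encodeName l
  refine Deg.of_list (n := l.length) (j := 3) ?_ (by omega)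
  clear hlen
  induction l with
  | nil =>
    exact (Deg.of_rule (r := lenNil) (j := 2) (basic_mem (by simp [basicClauses])) [] trivial
      trivial).base
  | cons b l ih =>
    have hl' := hl
    simp only [encodeList, List.length_cons, List.length_append] at hl'
    have hlen := length_le_encodeList encodeName l
    refine step_mul ?_
    exact Deg.of_rec (r := lenCons) (j := 2) (basic_mem (by simp [basicClauses]))
      [encodeName b, encodeList encodeName l, encodeNat l.length]
      ⟨by omega, by omega, by simp [encodeNat]; omega, trivial⟩
      ⟨code_name b (by omega), ih (by omega)⟩

/-! #### Assignments -/

theorem lk_deg {hl : List (Name × Tm)} {v : Var} {t : Tm} (h : hl.lookup v = some t)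
    (hH : (encodeList encodeEntry hl).length ≤ ℓ) :
    Deg ℓ 4 (.lk, [encodeName v, encodeTm t, encodeList encodeEntry hl]) := by
  have hlen := length_le_encodeList encodeEntry hl
  refine Deg.of_list (n := hl.length) (j := 3) ?_ (by omega)
  clear hlen
  have hvt : (encodeEntry (v, t)).length + 2 ≤ (encodeList encodeEntry hl).length := by
    obtain ⟨l₁, l₂, rfl, -⟩ := List.lookup_eq_some_iff.1 h
    exact length_mem_encodeList encodeEntry (by simp)
  simp only [encodeEntry, List.length_append] at hvt
  have hv : (encodeName v).length ≤ ℓ := by omega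
  have ht : (encodeTm t).length ≤ ℓ := by omega
  clear hvt
  induction hl with
  | nil => simp at h
  | cons e l ih =>
    obtain ⟨u, z⟩ := e
    have hl' := hH
    simp only [encodeList, encodeEntry, List.length_cons, List.length_append] at hl'
    have happ : encodeList encodeEntry ((u, z) :: l) =
      .item :: (encodeName u ++ (encodeTm z ++ encodeList encodeEntry l)) := by
      simp [encodeList, encodeEntry]
    rw [happ]
    by_cases e : v = u
    · subst e
      obtain rfl : z = t := by simpa using h
      exact (Deg.of_rule (r := lkHead) (j := 2) (basic_mem (by simp [basicClauses]))
        [encodeName v, encodeTm z, encodeList encodeEntry l] ⟨by omega, by omega, by omega, trivial⟩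
        ⟨code_name v hv, code_deg (encodeTm z) ⟨z, rfl⟩ ht, trivial⟩).base
    · rw [List.lookup_cons, beq_false_of_ne e] at h
      refine step_mul ?_
      exact Deg.of_rec (r := lkTail) (j := 2) (basic_mem (by simp [basicClauses]))
        [encodeName v, encodeTm t, encodeName u, encodeTm z, encodeList encodeEntry l]
        ⟨by omega, by omega, by omega, by omega, by omega, trivial⟩
        ⟨code_name u (by omega), code_deg (encodeTm z) ⟨z, rfl⟩ (by omega),
          neq_deg (encodeName v) (encodeName u) (fun h => e (prefixCode_name.injective h)) hv (by omega), ih h (by omega)⟩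

theorem tgt_deg {hl : List (Name × Tm)} {ts : List Var} {cs : List Const}
    (h : ts.map (fun v => hl.lookup v) = cs.map fun c => some (Tm.const c))
    (hH : (encodeList encodeEntry hl).length ≤ ℓ) (hts : (encodeList encodeName ts).length ≤ ℓ)
    (hcs : (encodeList encodeName cs).length ≤ ℓ) :
    Deg ℓ 6 (.tgt, [encodeList encodeName ts, encodeList encodeEntry hl,
      encodeList encodeName cs]) := by
  have hlen := length_le_encodeList encodeName ts
  refine Deg.of_list (n := ts.length) (j := 5) ?_ (by omega)
  clear hlen
  induction ts generalizing cs with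
  | nil =>
    obtain rfl : cs = [] := by simpa using h.symm
    exact (Deg.of_rule (r := tgtNil) (j := 4) (basic_mem (by simp [basicClauses]))
      [encodeList encodeEntry hl] ⟨hH, trivial⟩ trivial).base
  | cons v ts ih =>
    cases cs with
    | nil => simp at h
    | cons c cs =>
    rw [List.map_cons, List.map_cons] at h
    obtain ⟨h₁, h₂⟩ := List.cons.inj h
    simp only [encodeList, List.length_cons, List.length_append] at hts hcs
    refine step_mul ?_
    exact Deg.of_rec (r := tgtCons) (j := 4) (basic_mem (by simp [basicClauses]))
      [encodeName v, encodeList encodeName ts, encodeList encodeEntry hl, encodeName c,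
        encodeList encodeName cs]
      ⟨by omega, by omega, by omega, by omega, by omega, trivial⟩
      ⟨(code_name v (by omega)).le (by omega), (code_name c (by omega)).le (by omega),
        lk_deg h₁ hH, ih h₂ (by omega) (by omega)⟩

/-- The entries of an assignment. -/
def entries (vs : List Var) (h : Var → Tm) : List (Name × Tm) :=
  vs.map fun v => (v, h v)

theorem lookup_entries {vs : List Var} {h : Var → Tm} {v : Var} (hv : v ∈ vs) :
    (entries vs h).lookup v = some (h v) := by
  induction vs with
  | nil => simp at hv
  | cons u vs ih =>
    rw [entries, List.map_cons, List.lookup_cons]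
    by_cases e : v = u
    · simp [e]
    · rw [beq_false_of_ne e]
      exact ih ((List.mem_cons.1 hv).resolve_left e)

theorem length_encodeList_le {α : Type} {f : α → List Sym} {l : List α} {b : ℕ}
    (h : ∀ a ∈ l, (f a).length ≤ b) : (encodeList f l).length ≤ l.length * (b + 1) + 1 := by
  induction l with
  | nil => simp [encodeList]
  | cons a l ih =>
    have h₁ := h a (by simp)
    have h₂ := ih fun a ha => h a (by simp [ha])
    simp only [encodeList, List.length_cons, List.length_append, add_mul]
    omega

theorem pair_deg {ts : List Var} {cs : List Const} {v : Var} {c : Const}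
    (h : (v, c) ∈ ts.zip cs) (hts : (encodeList encodeName ts).length ≤ ℓ)
    (hcs : (encodeList encodeName cs).length ≤ ℓ) :
    Deg ℓ 4 (.pair, [encodeName v, encodeName c, encodeList encodeName ts,
      encodeList encodeName cs]) := by
  have hlen := length_le_encodeList encodeName ts
  refine Deg.of_list (n := ts.length) (j := 3) ?_ (by omega)
  clear hlen
  have hv : (encodeName v).length ≤ ℓ := by
    have := length_mem_encodeList encodeName (List.of_mem_zip h).1
    omega
  have hc : (encodeName c).length ≤ ℓ := by
    have := length_mem_encodeList encodeName (List.of_mem_zip h).2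
    omega
  induction ts generalizing cs with
  | nil => simp at h
  | cons u ts ih =>
    cases cs with
    | nil => simp at h
    | cons z cs =>
    simp only [encodeList, List.length_cons, List.length_append] at hts hcs
    by_cases e : (v, c) = (u, z)
    · obtain ⟨rfl, rfl⟩ := Prod.mk.inj e
      exact (Deg.of_rule (r := pairHead) (j := 2) (basic_mem (by simp [basicClauses]))
        [encodeName v, encodeName c, encodeList encodeName ts, encodeList encodeName cs]
        ⟨by omega, by omega, by omega, by omega, trivial⟩
        ⟨code_name v hv, code_name c hc, trivial⟩).base
    · rw [List.zip_cons_cons, List.mem_cons] at h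
      refine step_mul ?_
      exact Deg.of_rec (r := pairTail) (j := 2) (basic_mem (by simp [basicClauses]))
        [encodeName v, encodeName c, encodeName u, encodeList encodeName ts, encodeName z,
          encodeList encodeName cs]
        ⟨by omega, by omega, by omega, by omega, by omega, by omega, trivial⟩
        ⟨code_name u (by omega), code_name z (by omega),
          ih (h.resolve_left e) (by omega) (by omega)⟩

end OBDM

/-! ### Completeness of the clauses: the input and the instances of the mapping -/

namespace OBDM

open Clause

variable {ℓ : ℕ}

/-- The parts of the word that presents an input. -/
def Input.fields (x : Input) : List (List Sym) :=
  [encodeList encodeAssertion x.system.spec.ontology,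
    encodeList encodeSchemaEntry x.system.spec.schema,
    encodeList encodeGLAV x.system.spec.mapping,
    encodeList encodeRelAtom x.system.database,
    encodeList (encodeList encodeName) x.dataset,
    encodeNat x.query.arity, encodeList encodeCQ x.query.disjuncts]

theorem Input.length_encode (x : Input) : x.encode.length =
    (encodeList encodeAssertion x.system.spec.ontology).length +
    ((encodeList encodeSchemaEntry x.system.spec.schema).length +
    ((encodeList encodeGLAV x.system.spec.mapping).length +
    ((encodeList encodeRelAtom x.system.database).length +
    ((encodeList (encodeList encodeName) x.dataset).length +
    ((encodeNat x.query.arity).length + (encodeList encodeCQ x.query.disjuncts).length))))) := by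
  simp [encode_eq]

theorem Input.fields_bounded {x : Input} (h : x.encode.length ≤ ℓ) : Bounded ℓ x.fields := by
  have := x.length_encode
  exact ⟨by omega, by omega, by omega, by omega, by omega, by omega, by omega, trivial⟩

theorem fields_deg {x : Input} (h : x.encode.length ≤ ℓ) : Deg ℓ 3 (.flds, x.fields) := by
  have := x.length_encode
  exact Deg.of_rule (r := Clause.fields) (j := 2) (basic_mem (by simp [basicClauses])) x.fields
    (x.fields_bounded h)
    ⟨code_deg (N := .asrs) (encodeList encodeAssertion x.system.spec.ontology) ⟨_, rfl⟩ (by omega),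
      code_deg (N := .schs) (encodeList encodeSchemaEntry x.system.spec.schema) ⟨_, rfl⟩
        (by omega),
      code_deg (N := .glavs) (encodeList encodeGLAV x.system.spec.mapping) ⟨_, rfl⟩ (by omega),
      code_deg (N := .rels) (encodeList encodeRelAtom x.system.database) ⟨_, rfl⟩ (by omega),
      code_deg (N := .tuples) (encodeList (encodeList encodeName) x.dataset) ⟨_, rfl⟩ (by omega),
      code_deg (N := .nat) (encodeNat x.query.arity) ⟨_, rfl⟩ (by omega),
      code_deg (N := .cqs) (encodeList encodeCQ x.query.disjuncts) ⟨_, rfl⟩ (by omega), trivial⟩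

theorem inO_deg {x : Input} (h : x.encode.length ≤ ℓ) {a : Assertion}
    (ha : a ∈ x.system.spec.ontology) : Deg ℓ 5 (.inO, [encodeAssertion a, x.encode]) := by
  have hx := x.length_encode
  have hm := length_mem_encodeList encodeAssertion ha
  rw [encode_eq]
  exact Deg.of_rule (r := inOnt) (j := 4) (basic_mem (by simp [basicClauses]))
    (encodeAssertion a :: x.fields) ⟨by omega, x.fields_bounded h⟩
    ⟨(fields_deg h).le (by omega), mem_deg (N := .asr) (fun a => ⟨a, rfl⟩) ha (by omega), trivial⟩

theorem inS_deg {x : Input} (h : x.encode.length ≤ ℓ) {a : Name × ℕ}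
    (ha : a ∈ x.system.spec.schema) : Deg ℓ 5 (.inS, [encodeSchemaEntry a, x.encode]) := by
  have hx := x.length_encode
  have hm := length_mem_encodeList encodeSchemaEntry ha
  rw [encode_eq]
  exact Deg.of_rule (r := inSch) (j := 4) (basic_mem (by simp [basicClauses]))
    (encodeSchemaEntry a :: x.fields) ⟨by omega, x.fields_bounded h⟩
    ⟨(fields_deg h).le (by omega), mem_deg (N := .sch) (fun a => ⟨a, rfl⟩) ha (by omega), trivial⟩

theorem inM_deg {x : Input} (h : x.encode.length ≤ ℓ) {a : GLAVAssertion}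
    (ha : a ∈ x.system.spec.mapping) : Deg ℓ 5 (.inM, [encodeGLAV a, x.encode]) := by
  have hx := x.length_encode
  have hm := length_mem_encodeList encodeGLAV ha
  rw [encode_eq]
  exact Deg.of_rule (r := inMap) (j := 4) (basic_mem (by simp [basicClauses]))
    (encodeGLAV a :: x.fields) ⟨by omega, x.fields_bounded h⟩
    ⟨(fields_deg h).le (by omega), mem_deg (N := .glav) (fun a => ⟨a, rfl⟩) ha (by omega), trivial⟩

theorem inD_deg {x : Input} (h : x.encode.length ≤ ℓ) {a : Fact}
    (ha : a ∈ x.system.database) : Deg ℓ 5 (.inD, [encodeRelAtom a, x.encode]) := by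
  have hx := x.length_encode
  have hm := length_mem_encodeList encodeRelAtom ha
  rw [encode_eq]
  exact Deg.of_rule (r := inDat) (j := 4) (basic_mem (by simp [basicClauses]))
    (encodeRelAtom a :: x.fields) ⟨by omega, x.fields_bounded h⟩
    ⟨(fields_deg h).le (by omega), mem_deg (N := .rel) (fun a => ⟨a, rfl⟩) ha (by omega), trivial⟩

theorem inL_deg {x : Input} (h : x.encode.length ≤ ℓ) {a : List Const}
    (ha : a ∈ x.dataset) : Deg ℓ 5 (.inL, [encodeList encodeName a, x.encode]) := by
  have hx := x.length_encode
  have hm := length_mem_encodeList (encodeList encodeName) ha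
  rw [encode_eq]
  exact Deg.of_rule (r := inLam) (j := 4) (basic_mem (by simp [basicClauses]))
    (encodeList encodeName a :: x.fields) ⟨by omega, x.fields_bounded h⟩
    ⟨(fields_deg h).le (by omega), mem_deg (N := .names) (fun a => ⟨a, rfl⟩) ha (by omega),
      trivial⟩

theorem inQ_deg {x : Input} (h : x.encode.length ≤ ℓ) {a : CQ OntologyAtom}
    (ha : a ∈ x.query.disjuncts) : Deg ℓ 5 (.inQ, [encodeCQ a, x.encode]) := by
  have hx := x.length_encode
  have hm := length_mem_encodeList encodeCQ ha
  rw [encode_eq]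
  exact Deg.of_rule (r := inQue) (j := 4) (basic_mem (by simp [basicClauses]))
    (encodeCQ a :: x.fields) ⟨by omega, x.fields_bounded h⟩
    ⟨(fields_deg h).le (by omega), mem_deg (N := .cq) (fun a => ⟨a, rfl⟩) ha (by omega), trivial⟩

theorem arity_deg {x : Input} (h : x.encode.length ≤ ℓ) :
    Deg ℓ 4 (.arity, [encodeNat x.query.arity, x.encode]) := by
  have hx := x.length_encode
  rw [encode_eq]
  exact Deg.of_rule (r := isArity) (j := 3) (basic_mem (by simp [basicClauses]))
    [encodeNat x.query.arity, encodeList encodeAssertion x.system.spec.ontology,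
      encodeList encodeSchemaEntry x.system.spec.schema,
      encodeList encodeGLAV x.system.spec.mapping,
      encodeList encodeRelAtom x.system.database,
      encodeList (encodeList encodeName) x.dataset, encodeList encodeCQ x.query.disjuncts]
    ⟨by omega, by omega, by omega, by omega, by omega, by omega, by omega, trivial⟩
    ⟨fields_deg h, trivial⟩

theorem notS_deg {x : Input} (h : x.encode.length ≤ ℓ) {E : List Sym} (hE : E.length ≤ ℓ)
    (ha : ∀ a ∈ x.system.spec.schema, E ≠ encodeSchemaEntry a) :
    Deg ℓ 5 (.notS, [E, x.encode]) := by
  have hx := x.length_encode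
  rw [encode_eq]
  exact Deg.of_rule (r := notSch) (j := 4) (basic_mem (by simp [basicClauses]))
    (E :: x.fields) ⟨by omega, x.fields_bounded h⟩
    ⟨(fields_deg h).le (by omega), notin_deg (N := .sch) (fun a => ⟨a, rfl⟩) ha hE (by omega),
      trivial⟩

theorem notL_deg {x : Input} (h : x.encode.length ≤ ℓ) {E : List Sym} (hE : E.length ≤ ℓ)
    (ha : ∀ a ∈ x.dataset, E ≠ encodeList encodeName a) : Deg ℓ 5 (.notL, [E, x.encode]) := by
  have hx := x.length_encode
  rw [encode_eq]
  exact Deg.of_rule (r := notLam) (j := 4) (basic_mem (by simp [basicClauses]))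
    (E :: x.fields) ⟨by omega, x.fields_bounded h⟩
    ⟨(fields_deg h).le (by omega), notin_deg (N := .names) (fun a => ⟨a, rfl⟩) ha hE (by omega),
      trivial⟩

/-! #### Constants of the database -/

theorem length_relAtom {x : Input} {a : Fact} (ha : a ∈ x.system.database) :
    (encodeName a.pred).length + (encodeList encodeName a.args).length ≤ x.encode.length := by
  have hx := x.length_encode
  have hm := length_mem_encodeList encodeRelAtom ha
  rw [encodeRelAtom, List.length_append] at hm
  omega

theorem length_dom {x : Input} {c : Const} (hc : c ∈ Database.dom x.system.database) :
    (encodeName c).length + 2 ≤ x.encode.length := by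
  obtain ⟨a, ha, hc⟩ := hc
  have h₁ := length_relAtom ha
  have h₂ := length_mem_encodeList encodeName hc
  omega

theorem dom_deg {x : Input} (h : x.encode.length ≤ ℓ) {c : Const}
    (hc : c ∈ Database.dom x.system.database) : Deg ℓ 6 (.dom, [encodeName c, x.encode]) := by
  have h₀ := length_dom hc
  obtain ⟨a, ha, hc⟩ := hc
  have h₁ := length_relAtom ha
  exact Deg.of_rule (r := domFact) (j := 5) (basic_mem (by simp [basicClauses]))
    [encodeName c, x.encode, encodeName a.pred, encodeList encodeName a.args]
    ⟨by omega, by omega, by omega, by omega, trivial⟩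
    ⟨inD_deg h ha, (code_name a.pred (by omega)).le (by omega),
      (mem_deg (N := .name) (fun a => ⟨a, rfl⟩) hc (by omega)).le (by omega), trivial⟩

theorem domall_deg {x : Input} (h : x.encode.length ≤ ℓ) {cs : List Const}
    (hcs : ∀ c ∈ cs, c ∈ Database.dom x.system.database)
    (hl : (encodeList encodeName cs).length ≤ ℓ) :
    Deg ℓ 8 (.domall, [encodeList encodeName cs, x.encode]) := by
  have hlen := length_le_encodeList encodeName cs
  refine Deg.of_list (n := cs.length) (j := 7) ?_ (by omega)
  clear hlen
  induction cs with
  | nil =>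
    exact (Deg.of_rule (r := domallNil) (j := 6) (basic_mem (by simp [basicClauses])) [x.encode]
      ⟨h, trivial⟩ trivial).base
  | cons c cs ih =>
    simp only [encodeList, List.length_cons, List.length_append] at hl
    refine step_mul ?_
    exact Deg.of_rec (r := domallCons) (j := 6) (basic_mem (by simp [basicClauses]))
      [encodeName c, encodeList encodeName cs, x.encode] ⟨by omega, by omega, by omega, trivial⟩
      ⟨dom_deg h (hcs c (by simp)), ih (fun c hc => hcs c (by simp [hc])) (by omega)⟩

theorem outside_deg {X : List Sym} (hX : X.length ≤ ℓ) {d : Database}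
    (hd : ∀ c ∈ Database.dom d, X ≠ encodeName c) (hl : (encodeList encodeRelAtom d).length ≤ ℓ) :
    Deg ℓ 6 (.outside, [X, encodeList encodeRelAtom d]) := by
  have hlen := length_le_encodeList encodeRelAtom d
  refine Deg.of_list (n := d.length) (j := 5) ?_ (by omega)
  clear hlen
  induction d with
  | nil =>
    exact (Deg.of_rule (r := outsideNil) (j := 4) (basic_mem (by simp [basicClauses])) [X]
      ⟨hX, trivial⟩ trivial).base
  | cons a d ih =>
    have happ : encodeList encodeRelAtom (a :: d) = .item :: (encodeName a.pred ++
      (encodeList encodeName a.args ++ encodeList encodeRelAtom d)) := by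
      simp [encodeList, encodeRelAtom]
    rw [happ] at hl ⊢
    simp only [List.length_cons, List.length_append] at hl
    refine step_mul ?_
    exact Deg.of_rec (r := outsideCons) (j := 4) (basic_mem (by simp [basicClauses]))
      [X, encodeName a.pred, encodeList encodeName a.args, encodeList encodeRelAtom d]
      ⟨by omega, by omega, by omega, by omega, trivial⟩
      ⟨(code_name a.pred (by omega)).le (by omega),
        (code_deg (N := .names) (encodeList encodeName a.args) ⟨_, rfl⟩ (by omega)).le (by omega),
        notin_deg (N := .name) (fun a => ⟨a, rfl⟩) (fun c hc => hd c ⟨a, by simp, hc⟩) hX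
          (by omega),
        ih (fun c ⟨b, hb, hc⟩ => hd c ⟨b, by simp [hb], hc⟩) (by omega)⟩

theorem notdom_deg {x : Input} (h : x.encode.length ≤ ℓ) {X : List Sym} (hX : X.length ≤ ℓ)
    (hc : ∀ c ∈ Database.dom x.system.database, X ≠ encodeName c) :
    Deg ℓ 7 (.notdom, [X, x.encode]) := by
  have hx := x.length_encode
  rw [encode_eq]
  exact Deg.of_rule (r := notDom) (j := 6) (basic_mem (by simp [basicClauses]))
    (X :: x.fields) ⟨by omega, x.fields_bounded h⟩
    ⟨(fields_deg h).le (by omega), outside_deg hX hc (by omega), trivial⟩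

/-! #### Instances of the mapping -/

/-- The words of length `ℓ` are long enough for everything that concerns an input of length
`w`. -/
def Large (w ℓ : ℕ) : Prop :=
  20 * (w + 1) ^ 3 ≤ ℓ

theorem Large.square {w ℓ : ℕ} (h : Large w ℓ) : 20 * ((w + 1) * (w + 1)) ≤ ℓ := by
  refine le_trans ?_ h
  have : 1 ≤ w + 1 := by omega
  nlinarith [Nat.mul_le_mul_left ((w + 1) * (w + 1)) this, pow_succ (w + 1) 2, sq (w + 1)]

theorem Large.le {w ℓ : ℕ} (h : Large w ℓ) : 20 * (w + 1) ≤ ℓ := by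
  have := h.square
  nlinarith

theorem length_glav {x : Input} {m : GLAVAssertion} (hm : m ∈ x.system.spec.mapping) :
    (encodeList encodeName m.target).length + ((encodeList encodeRelAtom m.sourceBody).length +
      (encodeList encodeOntologyAtom m.ontologyBody).length) + 2 ≤ x.encode.length := by
  have hx := x.length_encode
  have hm := length_mem_encodeList encodeGLAV hm
  rw [encodeGLAV, List.length_append, List.length_append] at hm
  omega

theorem length_flatMap_args (b : List SourceAtom) :
    (b.flatMap RelAtom.args).length ≤ (encodeList encodeRelAtom b).length := by
  induction b with
  | nil => simp
  | cons a b ih =>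
    have := length_le_encodeList encodeName a.args
    simp only [List.flatMap_cons, List.length_append, encodeList, List.length_cons, encodeRelAtom]
    omega

/-- The length of a tuple for which a mapping assertion is triggered. -/
theorem length_tuple {x : Input} {m : GLAVAssertion} {c : List Const}
    (h : Instance x.system m c) :
    (encodeList encodeName c).length ≤ x.encode.length * (x.encode.length + 1) + 1 := by
  obtain ⟨hm, hdom, k, hk, -⟩ := h
  have h₁ := length_encodeList_le (f := encodeName) (l := c) (b := x.encode.length)
    fun a ha => by have := length_dom (hdom a ha); omega
  have h₂ := length_glav hm
  have h₃ := length_le_encodeList encodeName m.target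
  have h₄ : c.length = m.target.length := by rw [← hk]; simp [GLAVAssertion.sourceQuery]
  rw [h₄] at h₁
  refine h₁.trans ?_
  gcongr
  omega

theorem src_deg {x : Input} (h : x.encode.length ≤ ℓ) {vs : List Var} {k : Var → Const}
    (hH : (encodeList encodeEntry (entries vs fun v => .const (k v))).length ≤ ℓ)
    {b : List SourceAtom} (hb : ∀ α ∈ b, α.map k ∈ x.system.database)
    (hvs : ∀ α ∈ b, ∀ v ∈ α.args, v ∈ vs) (hl : (encodeList encodeRelAtom b).length ≤ ℓ) :
    Deg ℓ 8 (.src, [encodeList encodeRelAtom b,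
      encodeList encodeEntry (entries vs fun v => .const (k v)), x.encode]) := by
  have hlen := length_le_encodeList encodeRelAtom b
  refine Deg.of_list (n := b.length) (j := 7) ?_ (by omega)
  clear hlen
  induction b with
  | nil =>
    exact (Deg.of_rule (r := srcNil) (j := 6) (basic_mem (by simp [basicClauses]))
      [encodeList encodeEntry (entries vs fun v => .const (k v)), x.encode]
      ⟨hH, h, trivial⟩ trivial).base
  | cons a b ih =>
    have happ : encodeList encodeRelAtom (a :: b) = .item :: (encodeName a.pred ++
      (encodeList encodeName a.args ++ encodeList encodeRelAtom b)) := by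
      simp [encodeList, encodeRelAtom]
    rw [happ] at hl ⊢
    simp only [List.length_cons, List.length_append] at hl
    have ha := hb a (by simp)
    have hC := length_relAtom ha
    simp only [RelAtom.map] at hC
    refine step_mul ?_
    refine Deg.of_rec (r := srcCons) (j := 6) (basic_mem (by simp [basicClauses]))
      [encodeName a.pred, encodeList encodeName a.args, encodeList encodeRelAtom b,
        encodeList encodeEntry (entries vs fun v => .const (k v)), x.encode,
        encodeList encodeName (a.args.map k)]
      ⟨by omega, by omega, by omega, by omega, by omega, by omega, trivial⟩
      ⟨(code_name a.pred (by omega)).le (by omega),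
        (code_deg (N := .names) (encodeList encodeName a.args) ⟨_, rfl⟩ (by omega)).le (by omega),
        tgt_deg ?_ hH (by omega) (by omega), (inD_deg h ha).le (by omega),
        ih (fun α hα => hb α (by simp [hα])) (fun α hα => hvs α (by simp [hα])) (by omega)⟩
    rw [List.map_map]
    exact List.map_congr_left fun v hv => lookup_entries (hvs a (by simp) v hv)

/-- The assignment to be guessed lists only the variables of the source query, with values in the
database, so the length of its code is quadratic in that of the input. -/
theorem inst_deg {x : Input} (hL : Large x.encode.length ℓ) {m : GLAVAssertion} {c : List Const}
    (h : Instance x.system m c) : Deg ℓ 9 (.inst, [encodeList encodeName m.target,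
      encodeList encodeRelAtom m.sourceBody, encodeList encodeOntologyAtom m.ontologyBody,
      encodeList encodeName c, x.encode]) := by
  have hc := length_tuple h
  obtain ⟨hm, hdom, k, hk, hb⟩ := h
  have hk : m.target.map k = c := hk
  have hb : ∀ α ∈ m.sourceBody, α.map k ∈ x.system.database := hb
  have hlen := length_glav hm
  have h₁ := hL.le
  have h₂ := hL.square
  set vs := m.target ++ m.sourceBody.flatMap RelAtom.args with hvs
  have hin : ∀ v ∈ vs, (encodeName v).length ≤ x.encode.length ∧
      k v ∈ Database.dom x.system.database := by
    intro v hv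
    rcases List.mem_append.1 hv with hv | hv
    · have := length_mem_encodeList encodeName hv
      exact ⟨by omega, hdom _ (by rw [← hk]; exact List.mem_map_of_mem hv)⟩
    · obtain ⟨α, hα, hv⟩ := List.mem_flatMap.1 hv
      have h₃ := length_mem_encodeList encodeName hv
      have h₄ := length_mem_encodeList encodeRelAtom hα
      rw [encodeRelAtom, List.length_append] at h₄
      exact ⟨by omega, _, hb α hα, List.mem_map_of_mem hv⟩
  have hH : (encodeList encodeEntry (entries vs fun v => .const (k v))).length ≤ ℓ := by
    refine (length_encodeList_le (b := 2 * x.encode.length) ?_).trans ?_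
    · intro e he
      obtain ⟨v, hv, rfl⟩ := List.mem_map.1 he
      have := length_dom (hin v hv).2
      have := (hin v hv).1
      simp only [encodeEntry, encodeTm, List.length_append, List.length_cons]
      omega
    · have h₃ := length_le_encodeList encodeName m.target
      have h₄ := length_flatMap_args m.sourceBody
      have h₅ : vs.length ≤ x.encode.length := by
        rw [hvs, List.length_append]
        omega
      rw [entries, List.length_map]
      have := Nat.mul_le_mul_right (2 * x.encode.length + 1) h₅
      nlinarith
  have hcl : (encodeList encodeName c).length ≤ ℓ := by nlinarith
  refine Deg.of_rule (r := mapInst) (j := 8) (basic_mem (by simp [basicClauses]))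
    [encodeList encodeName m.target, encodeList encodeRelAtom m.sourceBody,
      encodeList encodeOntologyAtom m.ontologyBody, encodeList encodeName c, x.encode,
      encodeList encodeEntry (entries vs fun v => .const (k v))]
    ⟨by omega, by omega, by omega, by omega, by omega, by omega, trivial⟩
    ⟨(inM_deg (by omega) hm).le (by omega),
      (code_deg (N := .names) (encodeList encodeName m.target) ⟨_, rfl⟩ (by omega)).le (by omega),
      (code_deg (N := .rels) (encodeList encodeRelAtom m.sourceBody) ⟨_, rfl⟩ (by omega)).le
        (by omega),
      (code_deg (N := .ents) (encodeList encodeEntry (entries vs fun v => .const (k v))) ⟨_, rfl⟩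
        hH).le (by omega),
      (tgt_deg ?_ hH (by omega) hcl).le (by omega),
      src_deg (by omega) hH hb (fun α hα v hv =>
        List.mem_append_right _ (List.mem_flatMap.2 ⟨α, hα, hv⟩)) (by omega),
      domall_deg (by omega) hdom hcl, trivial⟩
  rw [← hk, List.map_map]
  exact List.map_congr_left fun v hv => lookup_entries (List.mem_append_left _ hv)

/-- A null carries its mapping assertion and its tuple, hence the quadratic bound. Tuples contain
constants only, so names of nulls are not nested. -/
theorem length_headTerm {x : Input} {m : GLAVAssertion} {c : List Const}
    (h : Instance x.system m c) {v : Var} (hv : (encodeName v).length ≤ x.encode.length) :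
    (encodeTm (headTerm m c v)).length ≤ 3 * ((x.encode.length + 1) * (x.encode.length + 1)) := by
  have hc := length_tuple h
  have hlen := length_glav h.1
  rw [headTerm]
  split
  · next a ha =>
    have : a ∈ c := by
      obtain ⟨l₁, l₂, e, -⟩ := List.lookup_eq_some_iff.1 ha
      have : (v, a) ∈ m.target.zip c := by rw [e]; simp
      exact (List.of_mem_zip this).2
    have := length_dom (h.2.1 a this)
    simp only [encodeTm, List.length_cons]
    nlinarith
  · simp only [encodeTm, List.length_cons, List.length_append, encodeGLAV]
    nlinarith

theorem val_deg {x : Input} (hL : Large x.encode.length ℓ) {m : GLAVAssertion} {c : List Const}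
    (h : Instance x.system m c) {v : Var} (hv : (encodeName v).length ≤ x.encode.length) :
    Deg ℓ 5 (.val, [encodeName v, encodeTm (headTerm m c v), encodeList encodeName m.target,
      encodeList encodeRelAtom m.sourceBody, encodeList encodeOntologyAtom m.ontologyBody,
      encodeList encodeName c]) := by
  have hc := length_tuple h
  have hlen := length_glav h.1
  have h₁ := hL.le
  have hcl : (encodeList encodeName c).length ≤ ℓ := by
    have := hL.square
    nlinarith
  obtain ⟨hm, hdom, k, hk, hb⟩ := h
  have hk : m.target.map k = c := hk
  by_cases hvt : v ∈ m.target
  · have ht : headTerm m c v = .const (k v) := by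
      rw [headTerm, ← hk, lookup_zip_map, if_pos hvt]
    have hkc : k v ∈ c := by
      rw [← hk]
      exact List.mem_map_of_mem hvt
    have hkv := length_dom (hdom _ hkc)
    have hz : (v, k v) ∈ m.target.zip c := by
      have := lookup_zip_map (ts := m.target) (h := k) (v := v)
      rw [if_pos hvt, hk] at this
      obtain ⟨l₁, l₂, e, -⟩ := List.lookup_eq_some_iff.1 this
      rw [e]
      simp
    rw [ht]
    exact Deg.of_rule (r := valConst) (j := 4) (basic_mem (by simp [basicClauses]))
      [encodeName v, encodeName (k v), encodeList encodeName m.target,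
        encodeList encodeRelAtom m.sourceBody, encodeList encodeOntologyAtom m.ontologyBody,
        encodeList encodeName c]
      ⟨by omega, by omega, by omega, by omega, by omega, by omega, trivial⟩
      ⟨pair_deg hz (by omega) hcl, trivial⟩
  · have ht : headTerm m c v = .null m c v := by
      rw [headTerm, ← hk, lookup_zip_map, if_neg hvt]
    have ht' : encodeTm (.null m c v) = .one :: (encodeList encodeName m.target ++
        (encodeList encodeRelAtom m.sourceBody ++ (encodeList encodeOntologyAtom m.ontologyBody ++
        (encodeList encodeName c ++ encodeName v)))) := by
      simp [encodeTm, encodeGLAV]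
    rw [ht, ht']
    exact Deg.of_rule (r := valNull) (j := 4) (basic_mem (by simp [basicClauses]))
      [encodeName v, encodeList encodeName m.target,
        encodeList encodeRelAtom m.sourceBody, encodeList encodeOntologyAtom m.ontologyBody,
        encodeList encodeName c]
      ⟨by omega, by omega, by omega, by omega, by omega, trivial⟩
      ⟨notin_deg (N := .name) (X := encodeName v) (fun a => ⟨a, rfl⟩)
        (fun u hu e => hvt (prefixCode_name.injective e ▸ hu)) (by omega) (by omega), trivial⟩

theorem length_ontologyAtom {x : Input} {m : GLAVAssertion} (hm : m ∈ x.system.spec.mapping)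
    {α : OntologyAtom} (hα : α ∈ m.ontologyBody) :
    (encodeOntologyAtom α).length + 4 ≤ x.encode.length := by
  have h₁ := length_glav hm
  have h₂ := length_mem_encodeList encodeOntologyAtom hα
  omega

theorem seedRole_atomic_deg {x : Input} (hL : Large x.encode.length ℓ) {m : GLAVAssertion}
    {c : List Const} (h : Instance x.system m c) {P : Name} {v w : Var}
    (hα : .role P v w ∈ m.ontologyBody) : Deg ℓ 10 (.role, [encodeBasicRole (.atomic P),
      encodeTm (headTerm m c v), encodeTm (headTerm m c w), x.encode]) := by
  have hs := length_ontologyAtom h.1 hα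
  simp only [encodeOntologyAtom, List.length_cons, List.length_append] at hs
  have hm := length_glav h.1
  have hc := length_tuple h
  have h₁ := hL.le
  have h₂ := hL.square
  have hv := length_headTerm h (v := v) (by omega)
  have hw := length_headTerm h (v := w) (by omega)
  have hcl : (encodeList encodeName c).length ≤ ℓ := by nlinarith
  exact Deg.of_rule (r := roleMap) (j := 9) (basic_mem (by simp [basicClauses]))
    [encodeName P, encodeTm (headTerm m c v), encodeTm (headTerm m c w), x.encode,
      encodeList encodeName m.target, encodeList encodeRelAtom m.sourceBody,
      encodeList encodeOntologyAtom m.ontologyBody, encodeList encodeName c, encodeName v,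
      encodeName w]
    ⟨by omega, by omega, by omega, by omega, by omega, by omega, by omega, by omega, by omega,
      by omega, trivial⟩
    ⟨inst_deg hL h, (mem_deg (N := .oa) (fun a => ⟨a, rfl⟩) hα (by omega)).le (by omega),
      (code_name P (by omega)).le (by omega), (code_name v (by omega)).le (by omega),
      (code_name w (by omega)).le (by omega), (val_deg hL h (by omega)).le (by omega),
      (val_deg hL h (by omega)).le (by omega), trivial⟩

theorem seedRole_length {x : Input} {R : BasicRole} {t u : Tm} (h : SeedRole x.system R t u) :
    (encodeBasicRole R).length + 4 ≤ x.encode.length ∧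
      (encodeTm t).length ≤ 3 * ((x.encode.length + 1) * (x.encode.length + 1)) ∧
      (encodeTm u).length ≤ 3 * ((x.encode.length + 1) * (x.encode.length + 1)) := by
  cases h with
  | atomic hi hα =>
    have hs := length_ontologyAtom hi.1 hα
    simp only [encodeOntologyAtom, List.length_cons, List.length_append] at hs
    exact ⟨by simp only [encodeBasicRole, List.length_cons]; omega, length_headTerm hi (by omega),
      length_headTerm hi (by omega)⟩
  | inv hi hα =>
    have hs := length_ontologyAtom hi.1 hα
    simp only [encodeOntologyAtom, List.length_cons, List.length_append] at hs
    exact ⟨by simp only [encodeBasicRole, List.length_cons]; omega, length_headTerm hi (by omega),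
      length_headTerm hi (by omega)⟩

theorem seedConcept_length {x : Input} {B : BasicConcept} {t : Tm}
    (h : SeedConcept x.system B t) : (encodeBasicConcept B).length + 3 ≤ x.encode.length ∧
      (encodeTm t).length ≤ 3 * ((x.encode.length + 1) * (x.encode.length + 1)) := by
  cases h with
  | dom hc =>
    have := length_dom hc
    refine ⟨?_, ?_⟩
    · have hx := x.length_encode
      have h₁ := length_le_encodeList encodeAssertion x.system.spec.ontology
      have h₂ := length_le_encodeList encodeSchemaEntry x.system.spec.schema
      have h₃ := length_le_encodeList encodeGLAV x.system.spec.mapping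
      have h₄ := length_le_encodeList encodeRelAtom x.system.database
      have h₅ := length_le_encodeList (encodeList encodeName) x.dataset
      simp only [encodeBasicConcept, encodeAtomicConcept, List.length_cons, List.length_nil]
      omega
    · simp only [encodeTm, List.length_cons]
      nlinarith
  | concept hi hα =>
    have hs := length_ontologyAtom hi.1 hα
    simp only [encodeOntologyAtom, List.length_cons, List.length_append] at hs
    exact ⟨by simp only [encodeBasicConcept, List.length_cons]; omega,
      length_headTerm hi (by omega)⟩
  | role hr =>
    have := seedRole_length hr
    exact ⟨by simp only [encodeBasicConcept, List.length_cons]; omega, this.2.1⟩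

theorem role_flip_derivable {x : Input} (h : x.encode.length ≤ ℓ) {R : BasicRole} {t u : Tm}
    (hR : (encodeBasicRole R).length ≤ ℓ) (ht : (encodeTm t).length ≤ ℓ)
    (hu : (encodeTm u).length ≤ ℓ) {k : ℕ}
    (hk : Derivable ℓ k (.role, [encodeBasicRole R, encodeTm t, encodeTm u, x.encode])) :
    Derivable ℓ (k + 1) (.role, [encodeBasicRole R.flip, encodeTm u, encodeTm t, x.encode]) := by
  cases R with
  | atomic P =>
    simp only [encodeBasicRole, List.length_cons] at hR
    exact Derivable.of_rule (r := roleInv) (basic_mem (by simp [basicClauses]))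
      [encodeName P, encodeTm u, encodeTm t, x.encode]
      ⟨by omega, by omega, by omega, by omega, trivial⟩ ⟨hk, trivial⟩ (by simp [roleInv])
  | inv P =>
    simp only [encodeBasicRole, List.length_cons] at hR
    exact Derivable.of_rule (r := roleUninv) (basic_mem (by simp [basicClauses]))
      [encodeName P, encodeTm u, encodeTm t, x.encode]
      ⟨by omega, by omega, by omega, by omega, trivial⟩ ⟨hk, trivial⟩ (by simp [roleUninv])

theorem Deg.succ {j : ℕ} {f : Horn.Fact Pr Sym} (h : Derivable ℓ ((ℓ + 16) ^ j + 1) f) :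
    Deg ℓ (j + 1) f :=
  h.mono (by have := step_le ℓ j (b := 1) (by omega); omega)

theorem seedRole_deg {x : Input} (hL : Large x.encode.length ℓ) {R : BasicRole} {t u : Tm}
    (h : SeedRole x.system R t u) :
    Deg ℓ 11 (.role, [encodeBasicRole R, encodeTm t, encodeTm u, x.encode]) := by
  have h₁ := hL.le
  have h₂ := hL.square
  have h₃ := seedRole_length h
  cases h with
  | atomic hi hα => exact (seedRole_atomic_deg hL hi hα).le (by omega)
  | inv hi hα =>
    exact Deg.succ (role_flip_derivable (by omega) (R := .atomic _)
      (by have := h₃.1; simp only [encodeBasicRole, List.length_cons] at this ⊢; omega)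
      (by omega) (by omega) (seedRole_atomic_deg hL hi hα))

theorem some_derivable {x : Input} (h : x.encode.length ≤ ℓ) {R : BasicRole} {t u : Tm}
    (hR : (encodeBasicRole R).length ≤ ℓ) (ht : (encodeTm t).length ≤ ℓ)
    (hu : (encodeTm u).length ≤ ℓ) {k : ℕ}
    (hk : Derivable ℓ k (.role, [encodeBasicRole R, encodeTm t, encodeTm u, x.encode])) :
    Derivable ℓ (k + 1) (.conc, [encodeBasicConcept (.some R), encodeTm t, x.encode]) :=
  Derivable.of_rule (r := concSome) (basic_mem (by simp [basicClauses]))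
    [encodeBasicRole R, encodeTm t, x.encode, encodeTm u] ⟨hR, ht, h, hu, trivial⟩ ⟨hk, trivial⟩
    (by simp [concSome])

theorem seedConcept_deg {x : Input} (hL : Large x.encode.length ℓ) {B : BasicConcept} {t : Tm}
    (h : SeedConcept x.system B t) :
    Deg ℓ 12 (.conc, [encodeBasicConcept B, encodeTm t, x.encode]) := by
  have h₁ := hL.le
  have h₂ := hL.square
  have h₃ := seedConcept_length h
  cases h with
  | dom hc =>
    have := length_dom hc
    exact (Deg.of_rule (r := concDom) (j := 6) (basic_mem (by simp [basicClauses]))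
      [encodeName _, x.encode] ⟨by omega, by omega, trivial⟩
      ⟨dom_deg (by omega) hc, trivial⟩).le (by omega)
  | @concept m c A v hi hα =>
    have hs := length_ontologyAtom hi.1 hα
    simp only [encodeOntologyAtom, List.length_cons, List.length_append] at hs
    have hm := length_glav hi.1
    have hc := length_tuple hi
    have hcl : (encodeList encodeName c).length ≤ ℓ := by nlinarith
    exact (Deg.of_rule (r := concMap) (j := 9) (basic_mem (by simp [basicClauses]))
      [encodeAtomicConcept A, encodeTm (headTerm m c v), x.encode, encodeList encodeName m.target,
        encodeList encodeRelAtom m.sourceBody, encodeList encodeOntologyAtom m.ontologyBody,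
        encodeList encodeName c, encodeName v]
      ⟨by omega, by omega, by omega, by omega, by omega, by omega, by omega, by omega, trivial⟩
      ⟨inst_deg hL hi, (mem_deg (N := .oa) (fun a => ⟨a, rfl⟩) hα (by omega)).le (by omega),
        (code_deg (N := .ac) (encodeAtomicConcept A) ⟨_, rfl⟩ (by omega)).le (by omega),
        (code_name v (by omega)).le (by omega), (val_deg hL hi (by omega)).le (by omega),
        trivial⟩).le (by omega)
  | role hr =>
    have := seedRole_length hr
    exact Deg.succ (some_derivable (by omega) (by omega) (by omega) (by omega)
      (seedRole_deg hL hr))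

end OBDM

/-! ### Completeness of the clauses: the canonical model -/

namespace OBDM

open Clause Relation

variable {ℓ : ℕ}

/-! #### Paths without repetitions -/

/-- Whenever a path returns to its starting point, everything before the return is discarded. -/
theorem reflTransGen_avoid {α : Type} {r : α → α → Prop} {a b : α} (h : ReflTransGen r a b) :
    ReflTransGen (fun x y => r x y ∧ y ≠ a) a b := by
  induction h with
  | refl => exact .refl
  | @tail y z _ hyz ih =>
    by_cases e : z = a
    · rw [e]
    · exact ih.tail ⟨hyz, e⟩

/-- What is propagated along the steps of a relation at the cost of `s` per step is propagated to
all reachable elements at a cost bounded by the number of the possible elements. -/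
theorem propagate {α : Type} {r : α → α → Prop} {P : ℕ → α → Prop} {s : ℕ}
    (hP : ∀ k x y, r x y → P k x → P (k + s) y) (F : List α) {a b : α} (h : ReflTransGen r a b)
    (hF : ∀ x y, ReflTransGen r a x → r x y → y ∈ F) {k : ℕ} (hk : P k a) :
    ∃ n ≤ F.length, P (k + n * s) b := by
  classical
  induction hn : F.length generalizing F r a k with
  | zero =>
    obtain rfl := List.eq_nil_of_length_eq_zero hn
    rcases h.cases_head with rfl | ⟨c, hac, -⟩
    · exact ⟨0, le_rfl, by simpa using hk⟩
    · simpa using hF _ _ .refl hac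
  | succ n ih =>
    rcases h.cases_head with rfl | ⟨c, hac, hcb⟩
    · exact ⟨0, Nat.zero_le _, by simpa using hk⟩
    have hc := hF _ _ .refl hac
    -- The rest of the path never returns to `c`, which can therefore be removed from the list of
    -- possible elements.
    obtain ⟨m, hm, h'⟩ := ih (fun k x y hxy => hP k x y hxy.1) (F.erase c) (reflTransGen_avoid hcb)
      (fun x y hx hxy => (List.mem_erase_of_ne hxy.2).2 (hF x y
        (.head hac (ReflTransGen.mono (fun _ _ h => h.1) _ _ hx)) hxy.1))
      (hP k _ _ hac hk) (by rw [List.length_erase_of_mem hc, hn]; rfl)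
    refine ⟨m + 1, by omega, ?_⟩
    rw [add_mul, one_mul, add_comm (m * s), ← add_assoc]
    exact h'

/-- The inverse role in an existential concept. -/
def BasicConcept.flip : BasicConcept → BasicConcept
  | .some R => .some R.flip
  | B => B

/-- The concepts on the right of an inclusion. -/
def Assertion.conceptNodes : Assertion → List BasicConcept
  | .conceptIncl _ B => [B, B.flip]
  | .roleIncl _ R => [.some R, .some R.flip]
  | _ => []

/-- The roles on the right of an inclusion. -/
def Assertion.roleNodes : Assertion → List BasicRole
  | .roleIncl _ R => [R, R.flip]
  | _ => []

/-- The concepts that can be reached from a given one. -/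
def conceptNodes (O : Ontology) (B : BasicConcept) : List BasicConcept :=
  .atomic .top :: B :: B.flip :: O.flatMap Assertion.conceptNodes

theorem conceptNodes_flip {O : Ontology} {B B' : BasicConcept} (h : B' ∈ conceptNodes O B) :
    B'.flip ∈ conceptNodes O B := by
  have hf : ∀ B : BasicConcept, B.flip.flip = B := by
    rintro (A | R)
    · rfl
    · exact congrArg _ R.flip_flip
  simp only [conceptNodes, List.mem_cons, List.mem_flatMap] at h ⊢
  rcases h with rfl | rfl | rfl | ⟨a, ha, h⟩
  · exact .inl rfl
  · exact .inr (.inr (.inl rfl))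
  · exact .inr (.inl (hf B))
  · refine .inr (.inr (.inr ⟨a, ha, ?_⟩))
    cases a with
    | conceptIncl B₁ B₂ =>
      simp only [Assertion.conceptNodes, List.mem_cons, List.not_mem_nil, or_false] at h ⊢
      rcases h with rfl | rfl
      · exact .inr rfl
      · exact .inl (hf _)
    | roleIncl R₁ R₂ =>
      simp only [Assertion.conceptNodes, List.mem_cons, List.not_mem_nil, or_false] at h ⊢
      rcases h with rfl | rfl
      · exact .inr rfl
      · exact .inl (hf (.some R₂))
    | conceptDisj => simp [Assertion.conceptNodes] at h
    | roleDisj => simp [Assertion.conceptNodes] at h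

theorem conceptNodes_step {O : Ontology} {B B₁ B₂ : BasicConcept} (h₁ : B₁ ∈ conceptNodes O B)
    (h : NStep O B₁ B₂) : B₂ ∈ conceptNodes O B := by
  cases h with
  | flip R => exact conceptNodes_flip h₁
  | step h =>
    simp only [conceptNodes, List.mem_cons, List.mem_flatMap]
    cases h with
    | top => exact .inl rfl
    | incl h => exact .inr (.inr (.inr ⟨_, h, by simp [Assertion.conceptNodes]⟩))
    | some h =>
      refine .inr (.inr (.inr ?_))
      rcases h with h | h
      · exact ⟨_, h, by simp [Assertion.conceptNodes]⟩
      · exact ⟨_, h, by simp [Assertion.conceptNodes, BasicRole.flip_flip]⟩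

/-- Steps lead to `⊤`, to right-hand sides of inclusions, or invert a role. The reachable concepts
are thus linearly many in the size of the ontology. -/
theorem conceptNodes_reach {O : Ontology} {B B' : BasicConcept}
    (h : ReflTransGen (NStep O) B B') : B' ∈ conceptNodes O B := by
  induction h with
  | refl => simp [conceptNodes]
  | tail _ h ih => exact conceptNodes_step ih h

theorem length_flatMap_le {α β : Type} (f : α → List β) (n : ℕ) (hf : ∀ a, (f a).length ≤ n)
    (l : List α) : (l.flatMap f).length ≤ n * l.length := by
  induction l with
  | nil => simp
  | cons a l ih =>
    have := hf a
    simp only [List.flatMap_cons, List.length_append, List.length_cons, mul_add]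
    omega

theorem length_conceptNodes (O : Ontology) (B : BasicConcept) :
    (conceptNodes O B).length ≤ 2 * O.length + 3 := by
  have := length_flatMap_le Assertion.conceptNodes 2
    (by rintro (_ | _ | _ | _) <;> simp [Assertion.conceptNodes]) O
  simp only [conceptNodes, List.length_cons]
  omega

theorem roleNodes_step {O : Ontology} {R₁ R₂ : BasicRole} (h : RStep O R₁ R₂) :
    R₂ ∈ O.flatMap Assertion.roleNodes := by
  rw [List.mem_flatMap]
  rcases h with h | h
  · exact ⟨_, h, by simp [Assertion.roleNodes]⟩
  · exact ⟨_, h, by simp [Assertion.roleNodes, BasicRole.flip_flip]⟩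

theorem length_roleNodes (O : Ontology) : (O.flatMap Assertion.roleNodes).length ≤ 2 * O.length :=
  length_flatMap_le Assertion.roleNodes 2
    (by rintro (_ | _ | _ | _) <;> simp [Assertion.roleNodes]) O

/-! #### Lengths -/

theorem length_flip (R : BasicRole) : (encodeBasicRole R.flip).length = (encodeBasicRole R).length := by
  cases R <;> rfl

theorem length_ontology (x : Input) : x.system.spec.ontology.length + 7 ≤ x.encode.length := by
  have hx := x.length_encode
  have h₁ := length_le_encodeList encodeAssertion x.system.spec.ontology
  have h₂ := length_le_encodeList encodeSchemaEntry x.system.spec.schema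
  have h₃ := length_le_encodeList encodeGLAV x.system.spec.mapping
  have h₄ := length_le_encodeList encodeRelAtom x.system.database
  have h₅ := length_le_encodeList (encodeList encodeName) x.dataset
  have h₆ := length_le_encodeList encodeCQ x.query.disjuncts
  have h₇ : 1 ≤ (encodeNat x.query.arity).length := by simp [encodeNat]
  omega

theorem length_assertion {x : Input} {a : Assertion} (ha : a ∈ x.system.spec.ontology) :
    (encodeAssertion a).length ≤ x.encode.length := by
  have hx := x.length_encode
  have := length_mem_encodeList encodeAssertion ha
  omega

theorem length_rstep {x : Input} {R₁ R₂ : BasicRole} (h : RStep x.system.spec.ontology R₁ R₂) :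
    (encodeBasicRole R₂).length + 1 ≤ x.encode.length := by
  rcases h with h | h
  · have := length_assertion h
    simp only [encodeAssertion, List.length_cons, List.length_append] at this
    omega
  · have := length_assertion h
    simp only [encodeAssertion, List.length_cons, List.length_append, length_flip] at this
    omega

theorem length_bstep {x : Input} {B₁ B₂ : BasicConcept}
    (h : BStep x.system.spec.ontology B₁ B₂) :
    (encodeBasicConcept B₂).length ≤ x.encode.length := by
  cases h with
  | incl h =>
    have := length_assertion h
    simp only [encodeAssertion, List.length_cons, List.length_append] at this
    omega
  | top =>
    have := length_ontology x
    simp only [encodeBasicConcept, encodeAtomicConcept, List.length_cons, List.length_nil]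
    omega
  | some h =>
    have := length_rstep h
    simp only [encodeBasicConcept, List.length_cons]
    omega

theorem length_nstep {x : Input} {B₁ B₂ : BasicConcept}
    (h : NStep x.system.spec.ontology B₁ B₂)
    (h₁ : (encodeBasicConcept B₁).length ≤ x.encode.length) :
    (encodeBasicConcept B₂).length ≤ x.encode.length := by
  cases h with
  | step h => exact length_bstep h
  | flip R =>
    simp only [encodeBasicConcept, List.length_cons, length_flip] at h₁ ⊢
    exact h₁

theorem length_start {x : Input} {B : BasicConcept} (h : Start x.system B) :
    (encodeBasicConcept B).length ≤ x.encode.length := by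
  rcases h with rfl | ⟨t, h⟩
  · exact length_bstep (.top (.atomic .top))
  · have := (seedConcept_length h).1
    omega

/-- Up to inversion of a role, a non-empty concept is `⊤` or is built from names that the input
already contains. -/
theorem length_nonEmp {x : Input} {B : BasicConcept} (h : NonEmp x.system B) :
    (encodeBasicConcept B).length ≤ x.encode.length := by
  obtain ⟨B₀, h₀, h⟩ := h
  induction h with
  | refl => exact length_start h₀
  | tail _ h ih => exact length_nstep h ih

theorem length_nonEmp_some {x : Input} {R : BasicRole} (h : NonEmp x.system (.some R)) :
    (encodeBasicRole R).length + 1 ≤ x.encode.length := by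
  have := length_nonEmp h
  simpa only [encodeBasicConcept, List.length_cons] using this

/-- Each successor step adds the code of one role. That role is non-empty, hence its code is shorter
than that of the input. -/
theorem length_valid {x : Input} {t : Tm} (h : Valid x.system t) : (encodeTm t).length ≤
    3 * ((x.encode.length + 1) * (x.encode.length + 1)) + t.depth * (x.encode.length + 1) := by
  induction t with
  | const c =>
    obtain ⟨B, h⟩ := h
    exact (seedConcept_length h).2.trans (Nat.le_add_right _ _)
  | null m c z =>
    obtain ⟨B, h⟩ := h
    exact (seedConcept_length h).2.trans (Nat.le_add_right _ _)
  | child R t ih =>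
    have h₁ := ih h.1
    have h₂ := length_nonEmp_some (h.1.nonEmp h.2)
    simp only [encodeTm, List.length_cons, List.length_append, Tm.depth, add_mul, one_mul] at h₁ ⊢
    omega
  | root B =>
    have := length_nonEmp h
    simp only [encodeTm, List.length_cons]
    nlinarith

theorem depth_le (t : Tm) : t.depth ≤ (encodeTm t).length := by
  induction t with
  | child R t ih =>
    simp only [encodeTm, List.length_cons, List.length_append, Tm.depth]
    omega
  | _ => exact Nat.zero_le _

/-! #### Derivations along the ontology -/

theorem pow_mul_le (ℓ j : ℕ) : 16 * (ℓ + 16) ^ j ≤ (ℓ + 16) ^ (j + 1) := by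
  rw [pow_succ, mul_comm]
  exact Nat.mul_le_mul_left _ (by omega)

theorem one_le_pow (ℓ j : ℕ) : 1 ≤ (ℓ + 16) ^ j :=
  Nat.one_le_pow _ _ (by omega)

theorem roleIncl_derivable {x : Input} (h : x.encode.length ≤ ℓ) {R₁ R₂ : BasicRole}
    (ha : .roleIncl R₁ R₂ ∈ x.system.spec.ontology) {t u : Tm} (ht : (encodeTm t).length ≤ ℓ)
    (hu : (encodeTm u).length ≤ ℓ) {k : ℕ}
    (hk : Derivable ℓ k (.role, [encodeBasicRole R₁, encodeTm t, encodeTm u, x.encode])) :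
    Derivable ℓ (k + (ℓ + 16) ^ 6)
      (.role, [encodeBasicRole R₂, encodeTm t, encodeTm u, x.encode]) := by
  have hl := length_assertion ha
  simp only [encodeAssertion, List.length_cons, List.length_append] at hl
  exact Deg.of_rec (r := roleIncl) (j := 5) (basic_mem (by simp [basicClauses]))
    [encodeBasicRole R₂, encodeTm t, encodeTm u, x.encode, encodeBasicRole R₁]
    ⟨by omega, by omega, by omega, by omega, by omega, trivial⟩
    ⟨inO_deg h ha,
      (code_deg (N := .role) (encodeBasicRole R₁) ⟨_, rfl⟩ (by omega)).le (by omega), hk⟩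

/-- The clauses apply inclusions only as they are written. For the inverted form the pair is
flipped, the inclusion applied, and the pair flipped back. -/
theorem rstep_derivable {x : Input} (h : x.encode.length ≤ ℓ) {R₁ R₂ : BasicRole}
    (ha : RStep x.system.spec.ontology R₁ R₂) (hR : (encodeBasicRole R₁).length ≤ ℓ) {t u : Tm}
    (ht : (encodeTm t).length ≤ ℓ) (hu : (encodeTm u).length ≤ ℓ) {k : ℕ}
    (hk : Derivable ℓ k (.role, [encodeBasicRole R₁, encodeTm t, encodeTm u, x.encode])) :
    Derivable ℓ (k + (ℓ + 16) ^ 7)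
      (.role, [encodeBasicRole R₂, encodeTm t, encodeTm u, x.encode]) := by
  have h₁ : 16 * (ℓ + 16) ^ 6 ≤ (ℓ + 16) ^ 7 := pow_mul_le ℓ 6
  have h₂ := one_le_pow ℓ 6
  rcases id ha with ha' | ha'
  · exact (roleIncl_derivable h ha' ht hu hk).mono (by omega)
  · have h₃ := roleIncl_derivable h ha' hu ht (role_flip_derivable h hR ht hu hk)
    have h₄ := role_flip_derivable h
      (by have := length_rstep ha; rw [length_flip]; omega) hu ht h₃
    rw [BasicRole.flip_flip] at h₄
    exact h₄.mono (by omega)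

/-- A derivation along a path without repetitions has at most as many stages as there are possible
roles, which is linear in the ontology. -/
theorem rsub_derivable {x : Input} (hL : Large x.encode.length ℓ) {R₁ R₂ : BasicRole}
    (ha : ReflTransGen (RStep x.system.spec.ontology) R₁ R₂)
    (hR : (encodeBasicRole R₁).length ≤ ℓ) {t u : Tm} (ht : (encodeTm t).length ≤ ℓ)
    (hu : (encodeTm u).length ≤ ℓ) {k : ℕ}
    (hk : Derivable ℓ k (.role, [encodeBasicRole R₁, encodeTm t, encodeTm u, x.encode])) :
    Derivable ℓ (k + (ℓ + 16) ^ 8)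
      (.role, [encodeBasicRole R₂, encodeTm t, encodeTm u, x.encode]) := by
  have h := hL.le
  obtain ⟨n, hn, -, h'⟩ := propagate (P := fun k R => (encodeBasicRole R).length ≤ ℓ ∧
      Derivable ℓ k (.role, [encodeBasicRole R, encodeTm t, encodeTm u, x.encode]))
    (fun k R₁ R₂ h₁₂ hk => ⟨by have := length_rstep h₁₂; omega,
      rstep_derivable (by omega) h₁₂ hk.1 ht hu hk.2⟩)
    (x.system.spec.ontology.flatMap Assertion.roleNodes) ha (fun _ _ _ h => roleNodes_step h)
    ⟨hR, hk⟩
  have h₁ := length_roleNodes x.system.spec.ontology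
  have h₂ := length_ontology x
  have h₃ : n * (ℓ + 16) ^ 7 + (ℓ + 16) ^ 7 ≤ (ℓ + 16) ^ 8 :=
    list_le 7 (by omega)
  exact h'.mono (by omega)

theorem child_derivable {x : Input} (h : x.encode.length ≤ ℓ) {R : BasicRole} {t : Tm}
    (ht : (encodeTm (.child R t)).length ≤ ℓ) {k : ℕ}
    (hk : Derivable ℓ k (.conc, [encodeBasicConcept (.some R), encodeTm t, x.encode])) :
    Derivable ℓ (k + 1)
      (.role, [encodeBasicRole R, encodeTm t, encodeTm (.child R t), x.encode]) := by
  simp only [encodeTm, List.length_cons, List.length_append] at ht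
  exact Derivable.of_rule (r := roleChild) (basic_mem (by simp [basicClauses]))
    [encodeBasicRole R, encodeTm t, x.encode] ⟨by omega, by omega, by omega, trivial⟩
    ⟨hk, trivial⟩ (by simp [roleChild])

/-- No clause passes directly from `∃R₁` to `∃R₂` by a role inclusion. The derivation goes through
the successor `child R₁ t`: it applies the inclusion to this edge and projects back to `t`. -/
theorem bstep_derivable {x : Input} (h : x.encode.length ≤ ℓ) {B₁ B₂ : BasicConcept}
    (ha : BStep x.system.spec.ontology B₁ B₂)
    (hB : (encodeBasicConcept B₁).length ≤ x.encode.length) {t : Tm}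
    (ht : (encodeTm t).length + x.encode.length + 1 ≤ ℓ) {k : ℕ}
    (hk : Derivable ℓ k (.conc, [encodeBasicConcept B₁, encodeTm t, x.encode])) :
    Derivable ℓ (k + (ℓ + 16) ^ 8) (.conc, [encodeBasicConcept B₂, encodeTm t, x.encode]) := by
  have h₆ : 16 * (ℓ + 16) ^ 6 ≤ (ℓ + 16) ^ 7 := pow_mul_le ℓ 6
  have h₇ : 16 * (ℓ + 16) ^ 7 ≤ (ℓ + 16) ^ 8 := pow_mul_le ℓ 7
  have h₁ := one_le_pow ℓ 7
  cases ha with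
  | incl ha =>
    have hl := length_assertion ha
    simp only [encodeAssertion, List.length_cons, List.length_append] at hl
    exact (Deg.of_rec (r := concIncl) (j := 5) (basic_mem (by simp [basicClauses]))
      [encodeBasicConcept B₂, encodeTm t, x.encode, encodeBasicConcept B₁]
      ⟨by omega, by omega, by omega, by omega, trivial⟩
      ⟨inO_deg h ha,
        (code_deg (N := .bc) (encodeBasicConcept B₁) ⟨_, rfl⟩ (by omega)).le (by omega), hk⟩).mono
      (show k + (ℓ + 16) ^ 6 ≤ _ by omega)
  | top =>
    exact (Derivable.of_rule (k := k + 1) (r := concTop) (basic_mem (by simp [basicClauses]))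
      [encodeTm t, x.encode, encodeBasicConcept B₁] ⟨by omega, by omega, by omega, trivial⟩
      ⟨hk, trivial⟩ (by simp [concTop])).mono (by omega)
  | @some R₁ R₂ ha =>
    have hR := length_rstep ha
    simp only [encodeBasicConcept, List.length_cons] at hB
    have hc : (encodeTm (.child R₁ t)).length ≤ ℓ := by
      simp only [encodeTm, List.length_cons, List.length_append]
      omega
    have h₂ := child_derivable h hc hk
    have h₃ := rstep_derivable h ha (by omega) (by omega) hc h₂
    exact (some_derivable h (by omega) (by omega) hc h₃).mono (by omega)

theorem bsub_derivable {x : Input} (hL : Large x.encode.length ℓ) {B₁ B₂ : BasicConcept}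
    (ha : ReflTransGen (BStep x.system.spec.ontology) B₁ B₂)
    (hB : (encodeBasicConcept B₁).length ≤ x.encode.length) {t : Tm}
    (ht : (encodeTm t).length + x.encode.length + 1 ≤ ℓ) {k : ℕ}
    (hk : Derivable ℓ k (.conc, [encodeBasicConcept B₁, encodeTm t, x.encode])) :
    Derivable ℓ (k + (ℓ + 16) ^ 9) (.conc, [encodeBasicConcept B₂, encodeTm t, x.encode]) := by
  have h := hL.le
  obtain ⟨n, hn, -, h'⟩ := propagate
    (P := fun k B => (encodeBasicConcept B).length ≤ x.encode.length ∧
      Derivable ℓ k (.conc, [encodeBasicConcept B, encodeTm t, x.encode]))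
    (fun k B₁ B₂ h₁₂ hk => ⟨length_bstep h₁₂,
      bstep_derivable (by omega) h₁₂ hk.1 ht hk.2⟩)
    (conceptNodes x.system.spec.ontology B₁) ha (fun _ _ hr hs => conceptNodes_step
      (conceptNodes_reach (ReflTransGen.mono (fun _ _ => .step) _ _ hr)) (.step hs)) ⟨hB, hk⟩
  have h₁ := length_conceptNodes x.system.spec.ontology B₁
  have h₂ := length_ontology x
  have h₃ : n * (ℓ + 16) ^ 8 + (ℓ + 16) ^ 8 ≤ (ℓ + 16) ^ 9 :=
    list_le 8 (by omega)
  exact h'.mono (by omega)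

theorem root_derivable {x : Input} (h : x.encode.length ≤ ℓ) {B : BasicConcept}
    (hB : (encodeBasicConcept B).length ≤ ℓ) {t : Tm} (ht : (encodeTm t).length ≤ ℓ) {k : ℕ}
    (hk : Derivable ℓ k (.conc, [encodeBasicConcept B, encodeTm t, x.encode])) :
    Derivable ℓ (k + 1) (.conc, [encodeBasicConcept B, encodeTm (.root B), x.encode]) :=
  Derivable.of_rule (r := concRoot) (basic_mem (by simp [basicClauses]))
    [encodeBasicConcept B, x.encode, encodeTm t] ⟨hB, h, ht, trivial⟩ ⟨hk, trivial⟩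
    (by simp [concRoot])

/-- A successor belongs to the range of its role. -/
theorem range_derivable {x : Input} (h : x.encode.length ≤ ℓ) {R : BasicRole} {t : Tm}
    (ht : (encodeTm (.child R t)).length ≤ ℓ) {k : ℕ}
    (hk : Derivable ℓ k (.conc, [encodeBasicConcept (.some R), encodeTm t, x.encode])) :
    Derivable ℓ (k + 3)
      (.conc, [encodeBasicConcept (.some R.flip), encodeTm (.child R t), x.encode]) := by
  have ht' := ht
  simp only [encodeTm, List.length_cons, List.length_append] at ht'
  exact some_derivable h (by rw [length_flip]; omega) ht (by omega)
    (role_flip_derivable h (by omega) (by omega) ht (child_derivable h ht hk))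

/-- Each step ends by passing to the representative of the new concept, so terms do not grow along a
chain of such steps. -/
theorem nstep_derivable {x : Input} (hL : Large x.encode.length ℓ) {B₁ B₂ : BasicConcept}
    (ha : NStep x.system.spec.ontology B₁ B₂)
    (hB : (encodeBasicConcept B₁).length ≤ x.encode.length) {k : ℕ}
    (hk : Derivable ℓ k (.conc, [encodeBasicConcept B₁, encodeTm (.root B₁), x.encode])) :
    Derivable ℓ (k + (ℓ + 16) ^ 9)
      (.conc, [encodeBasicConcept B₂, encodeTm (.root B₂), x.encode]) := by
  have h := hL.le
  have h₈ : 16 * (ℓ + 16) ^ 8 ≤ (ℓ + 16) ^ 9 := pow_mul_le ℓ 8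
  have h₁ := one_le_pow ℓ 8
  have hB₂ := length_nstep ha hB
  have hr : (encodeTm (.root B₁)).length = (encodeBasicConcept B₁).length + 1 := rfl
  cases ha with
  | step ha =>
    exact (root_derivable (by omega) (by omega) (by omega)
      (bstep_derivable (by omega) ha hB (by omega) hk)).mono (by omega)
  | flip R =>
    have hR : (encodeBasicConcept (.some R)).length = (encodeBasicRole R).length + 1 := rfl
    have hc : (encodeTm (.child R (.root (.some R)))).length ≤ ℓ := by
      rw [encodeTm, List.length_cons, List.length_append]
      omega
    exact (root_derivable (by omega) (by omega) hc (range_derivable (by omega) hc hk)).mono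
      (by omega)

theorem nonEmp_deg {x : Input} (hL : Large x.encode.length ℓ) {B : BasicConcept}
    (h : NonEmp x.system B) :
    Deg ℓ 13 (.conc, [encodeBasicConcept B, encodeTm (.root B), x.encode]) := by
  obtain ⟨B₀, h₀, h⟩ := h
  have hl := hL.le
  have hB₀ := length_start h₀
  have hk : Derivable ℓ ((ℓ + 16) ^ 12 + 1)
      (.conc, [encodeBasicConcept B₀, encodeTm (.root B₀), x.encode]) := by
    rcases h₀ with rfl | ⟨t, h₀⟩
    · exact Derivable.of_rule (r := concRootTop) (basic_mem (by simp [basicClauses])) [x.encode]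
        ⟨by omega, trivial⟩ (c := 0) trivial (by simp)
    · have h₁ := (seedConcept_length h₀).2
      have h₂ := hL.square
      exact root_derivable (by omega) (by omega) (by omega) (seedConcept_deg hL h₀)
  obtain ⟨n, hn, -, h'⟩ := propagate
    (P := fun k B => (encodeBasicConcept B).length ≤ x.encode.length ∧
      Derivable ℓ k (.conc, [encodeBasicConcept B, encodeTm (.root B), x.encode]))
    (fun k B₁ B₂ h₁₂ hk => ⟨length_nstep h₁₂ hk.1, nstep_derivable hL h₁₂ hk.1 hk.2⟩)
    (conceptNodes x.system.spec.ontology B₀) h (fun _ _ hr hs => conceptNodes_step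
      (conceptNodes_reach hr) hs) ⟨hB₀, hk⟩
  have h₁ := length_conceptNodes x.system.spec.ontology B₀
  have h₂ := length_ontology x
  have h₃ : n * (ℓ + 16) ^ 9 + (ℓ + 16) ^ 9 ≤ (ℓ + 16) ^ 10 :=
    list_le 9 (by omega)
  have h₄ := pow_le_pow_of_le ℓ (show 10 ≤ 12 by omega)
  have h₅ : 16 * (ℓ + 16) ^ 12 ≤ (ℓ + 16) ^ 13 := pow_mul_le ℓ 12
  have h₆ := one_le_pow ℓ 12
  exact h'.mono (by omega)

/-- The derivation climbs up the term, starting from the seeds or a representative. Each level adds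
a fixed cost, as the premise for a successor is used once. -/
theorem typ_derivable {x : Input} (hL : Large x.encode.length ℓ) {t : Tm}
    (hv : Valid x.system t) (ht : (encodeTm t).length + x.encode.length + 1 ≤ ℓ)
    {B : BasicConcept} (h : Typ x.system B t) :
    Derivable ℓ ((ℓ + 16) ^ 13 + (t.depth + 1) * (ℓ + 16) ^ 10)
      (.conc, [encodeBasicConcept B, encodeTm t, x.encode]) := by
  have hl := hL.le
  have h₉ : 16 * (ℓ + 16) ^ 9 ≤ (ℓ + 16) ^ 10 := pow_mul_le ℓ 9
  have h₁ := one_le_pow ℓ 9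
  have h₁₂ : 16 * (ℓ + 16) ^ 12 ≤ (ℓ + 16) ^ 13 := pow_mul_le ℓ 12
  induction t generalizing B with
  | const c =>
    obtain ⟨B₀, h₀, h⟩ := h
    have h₃ := (seedConcept_length h₀).1
    exact (bsub_derivable hL h (by omega) ht (seedConcept_deg hL h₀)).mono (by simp only [Tm.depth]; omega)
  | null m c z =>
    obtain ⟨B₀, h₀, h⟩ := h
    have h₃ := (seedConcept_length h₀).1
    exact (bsub_derivable hL h (by omega) ht (seedConcept_deg hL h₀)).mono (by simp only [Tm.depth]; omega)
  | root B₀ =>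
    obtain ⟨_, rfl, h⟩ := h
    exact (bsub_derivable hL h (length_nonEmp hv) ht (nonEmp_deg hL hv)).mono
      (by simp only [Tm.depth]; omega)
  | child R t ih =>
    obtain ⟨_, rfl, h⟩ := h
    have ht' := ht
    simp only [encodeTm, List.length_cons, List.length_append] at ht'
    have h₂ := ih hv.1 (by omega) hv.2
    have h₃ := range_derivable (by omega) (by omega) h₂
    refine (bsub_derivable hL h (length_nonEmp (hv.1.nonEmp hv.2).flip) ht h₃).mono ?_
    simp only [Tm.depth, add_mul, one_mul]
    omega

theorem typ_deg {x : Input} (hL : Large x.encode.length ℓ) {t : Tm} (hv : Valid x.system t)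
    (ht : (encodeTm t).length + x.encode.length + 1 ≤ ℓ) {B : BasicConcept}
    (h : Typ x.system B t) : Deg ℓ 14 (.conc, [encodeBasicConcept B, encodeTm t, x.encode]) := by
  have hd := depth_le t
  have h₁ : t.depth * (ℓ + 16) ^ 10 + (ℓ + 16) ^ 10 ≤ (ℓ + 16) ^ 11 :=
    list_le 10 (by omega)
  have h₂ := pow_le_pow_of_le ℓ (show 11 ≤ 13 by omega)
  have h₃ : 16 * (ℓ + 16) ^ 13 ≤ (ℓ + 16) ^ 14 := pow_mul_le ℓ 13
  refine (typ_derivable hL hv ht h).mono ?_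
  rw [add_mul, one_mul]
  omega

/-- The generating role comes from a seed or from an edge to a successor, in either direction; it is
then propagated along the role inclusions. -/
theorem rol_deg {x : Input} (hL : Large x.encode.length ℓ) {t u : Tm} (ht : Valid x.system t)
    (hu : Valid x.system u) (hlt : (encodeTm t).length + x.encode.length + 1 ≤ ℓ)
    (hlu : (encodeTm u).length + x.encode.length + 1 ≤ ℓ) {R : BasicRole}
    (h : Rol x.system R t u) :
    Deg ℓ 15 (.role, [encodeBasicRole R, encodeTm t, encodeTm u, x.encode]) := by
  have hl := hL.le
  have h₁ : 16 * (ℓ + 16) ^ 14 ≤ (ℓ + 16) ^ 15 := pow_mul_le ℓ 14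
  have h₂ := pow_le_pow_of_le ℓ (show 8 ≤ 14 by omega)
  have h₃ := pow_le_pow_of_le ℓ (show 11 ≤ 14 by omega)
  have h₄ := one_le_pow ℓ 14
  obtain ⟨R₀, h₀, h⟩ := h
  have key : (encodeBasicRole R₀).length ≤ ℓ ∧ Derivable ℓ ((ℓ + 16) ^ 14 + 2)
      (.role, [encodeBasicRole R₀, encodeTm t, encodeTm u, x.encode]) := by
    rcases h₀ with h₀ | rfl | rfl
    · have := (seedRole_length h₀).1
      exact ⟨by omega, (seedRole_deg hL h₀).mono (by omega)⟩
    · have := length_nonEmp_some (ht.nonEmp hu.2)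
      exact ⟨by omega, (child_derivable (by omega) (by omega) (typ_deg hL ht hlt hu.2)).mono
        (by omega)⟩
    · have hR := length_nonEmp_some (hu.nonEmp ht.2)
      have h₅ := child_derivable (by omega) (by omega) (typ_deg hL hu hlu ht.2)
      have h₆ := role_flip_derivable (by omega) (by omega) (by omega) (by omega) h₅
      rw [BasicRole.flip_flip] at h₆
      rw [length_flip] at hR
      exact ⟨by omega, h₆⟩
  exact (rsub_derivable hL h key.1 (by omega) (by omega) key.2).mono (by omega)

/-! #### Violations and answers -/

/-- A violation might lie arbitrarily deep in the model, but its shallow form involves only terms of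
depth at most one, and these are short. -/
theorem incons_deg {x : Input} (hL : Large x.encode.length ℓ) (h : Violation x.system) :
    Deg ℓ 16 (.incons, [x.encode]) := by
  have hl := hL.le
  have hq := hL.square
  have hone : x.encode.length + 1 ≤ (x.encode.length + 1) * (x.encode.length + 1) :=
    Nat.le_mul_self _
  have roles : ∀ {R₁ R₂ : BasicRole} {t u : Tm}, .roleDisj R₁ R₂ ∈ x.system.spec.ontology →
      Valid x.system t → Valid x.system u → t.depth ≤ 1 → u.depth ≤ 1 → Rol x.system R₁ t u →
      Rol x.system R₂ t u → Deg ℓ 16 (.incons, [x.encode]) := by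
    intro R₁ R₂ t u ha ht hu hdt hdu h₁ h₂
    have hlt := length_valid ht
    have hlu := length_valid hu
    have hdt := Nat.mul_le_mul_right (x.encode.length + 1) hdt
    have hdu := Nat.mul_le_mul_right (x.encode.length + 1) hdu
    have hla := length_assertion ha
    simp only [encodeAssertion, List.length_cons, List.length_append] at hla
    exact Deg.of_rule (r := inconsRole) (j := 15) (basic_mem (by simp [basicClauses]))
      [x.encode, encodeBasicRole R₁, encodeBasicRole R₂, encodeTm t, encodeTm u]
      ⟨by omega, by omega, by omega, by omega, by omega, trivial⟩
      ⟨(inO_deg (by omega) ha).le (by omega),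
        (code_deg (N := .role) (encodeBasicRole R₁) ⟨_, rfl⟩ (by omega)).le (by omega),
        rol_deg hL ht hu (by omega) (by omega) h₁, rol_deg hL ht hu (by omega) (by omega) h₂,
        trivial⟩
  rcases h.shallow with h | ⟨B₁, B₂, t, ha, ht, hc, h₁, h₂⟩ |
    ⟨R₁, R₂, R₁', R₂', t, u, ha, h₁', h₂', h₁, h₂⟩ | ⟨R₁, R₂, R, ha, hR, h⟩
  · have := length_nonEmp h
    have hr : (encodeTm (.root (.atomic .bot))).length = 3 := rfl
    exact (Deg.of_rule (r := inconsBot) (j := 13) (basic_mem (by simp [basicClauses]))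
      [x.encode, encodeTm (.root (.atomic .bot))] ⟨by omega, by omega, trivial⟩
      ⟨nonEmp_deg hL h, trivial⟩).le (by omega)
  · have hlt := length_valid ht
    have hd : t.depth = 0 := by
      cases t with
      | child R t => exact absurd rfl (hc R t)
      | _ => rfl
    rw [hd, zero_mul] at hlt
    have hla := length_assertion ha
    simp only [encodeAssertion, List.length_cons, List.length_append] at hla
    exact (Deg.of_rule (r := inconsConc) (j := 14) (basic_mem (by simp [basicClauses]))
      [x.encode, encodeBasicConcept B₁, encodeBasicConcept B₂, encodeTm t]
      ⟨by omega, by omega, by omega, by omega, trivial⟩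
      ⟨(inO_deg (by omega) ha).le (by omega),
        (code_deg (N := .bc) (encodeBasicConcept B₁) ⟨_, rfl⟩ (by omega)).le (by omega),
        typ_deg hL ht (by omega) h₁, typ_deg hL ht (by omega) h₂, trivial⟩).le (by omega)
  · exact roles ha (SeedConcept.role h₁').valid (SeedConcept.role h₁'.flip).valid
      (by simp [h₁'.isGround.1.depth]) (by simp [h₁'.isGround.2.depth]) ⟨R₁', .inl h₁', h₁⟩
      ⟨R₂', .inl h₂', h₂⟩
  -- A violation at an edge to a successor is reproduced at the representative of the domain of the
  -- role.
  · have hv : Valid x.system (.root (.some R)) := hR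
    have hv' : Valid x.system (.child R (.root (.some R))) := ⟨hv, _, rfl, .refl⟩
    have hrol : ∀ {R'}, ReflTransGen (RStep x.system.spec.ontology) R R' →
        Rol x.system R' (.root (.some R)) (.child R (.root (.some R))) :=
      fun h => ⟨R, .inr (.inl rfl), h⟩
    rcases h with ⟨h₁, h₂⟩ | ⟨h₁, h₂⟩
    · exact roles ha hv hv' (by simp [Tm.depth]) (by simp [Tm.depth]) (hrol h₁) (hrol h₂)
    · have h₁ := (hrol h₁).flip
      have h₂ := (hrol h₂).flip
      rw [BasicRole.flip_flip] at h₁ h₂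
      exact roles ha hv' hv (by simp [Tm.depth]) (by simp [Tm.depth]) h₁ h₂

theorem sat_deg {x : Input} (hL : Large x.encode.length ℓ) {vs : List Var} {h : Var → Tm}
    (hH : (encodeList encodeEntry (entries vs h)).length ≤ ℓ)
    (hv : ∀ v ∈ vs, Valid x.system (h v) ∧ (encodeTm (h v)).length + x.encode.length + 1 ≤ ℓ)
    {b : List OntologyAtom} (hb : ∀ α ∈ b, Holds x.system h α)
    (hvs : ∀ α ∈ b, ∀ v ∈ α.vars, v ∈ vs) (hl : (encodeList encodeOntologyAtom b).length ≤ ℓ) :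
    Deg ℓ 17 (.sat, [encodeList encodeOntologyAtom b, encodeList encodeEntry (entries vs h),
      x.encode]) := by
  have hle := hL.le
  have hlen := length_le_encodeList encodeOntologyAtom b
  refine Deg.of_list (n := b.length) (j := 16) ?_ (by omega)
  clear hlen
  induction b with
  | nil =>
    exact (Deg.of_rule (r := satNil) (j := 15) (basic_mem (by simp [basicClauses]))
      [encodeList encodeEntry (entries vs h), x.encode] ⟨hH, by omega, trivial⟩ trivial).base
  | cons α b ih =>
    have hα := hb α (by simp)
    have hαv := hvs α (by simp)
    have hl' := hl
    simp only [encodeList, List.length_cons, List.length_append] at hl'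
    have hrec := ih (fun α hα => hb α (by simp [hα])) (fun α hα => hvs α (by simp [hα])) (by omega)
    refine step_mul ?_
    cases α with
    | concept A v =>
      have happ : encodeList encodeOntologyAtom (.concept A v :: b) = .item :: .zero ::
          (encodeAtomicConcept A ++ (encodeName v ++ encodeList encodeOntologyAtom b)) := by
        simp [encodeList, encodeOntologyAtom]
      rw [happ]
      simp only [encodeOntologyAtom, List.length_cons, List.length_append] at hl'
      have hv' := hαv v (by simp [OntologyAtom.vars])
      have hvt := hv v hv'
      exact Deg.of_rec (r := satConcept) (j := 15) (basic_mem (by simp [basicClauses]))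
        [encodeAtomicConcept A, encodeName v, encodeList encodeOntologyAtom b,
          encodeList encodeEntry (entries vs h), x.encode, encodeTm (h v)]
        ⟨by omega, by omega, by omega, by omega, by omega, by omega, trivial⟩
        ⟨(code_deg (N := .ac) (encodeAtomicConcept A) ⟨_, rfl⟩ (by omega)).le (by omega),
          (code_name v (by omega)).le (by omega), (lk_deg (lookup_entries hv') hH).le (by omega),
          (typ_deg hL hvt.1 hvt.2 hα).le (by omega), hrec⟩
    | role P v w =>
      have happ : encodeList encodeOntologyAtom (.role P v w :: b) = .item :: .one ::
          (encodeName P ++ (encodeName v ++ (encodeName w ++ encodeList encodeOntologyAtom b))) := by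
        simp [encodeList, encodeOntologyAtom]
      rw [happ]
      simp only [encodeOntologyAtom, List.length_cons, List.length_append] at hl'
      have hv' := hαv v (by simp [OntologyAtom.vars])
      have hw' := hαv w (by simp [OntologyAtom.vars])
      have hvt := hv v hv'
      have hwt := hv w hw'
      exact Deg.of_rec (r := satRole) (j := 15) (basic_mem (by simp [basicClauses]))
        [encodeName P, encodeName v, encodeName w, encodeList encodeOntologyAtom b,
          encodeList encodeEntry (entries vs h), x.encode, encodeTm (h v), encodeTm (h w)]
        ⟨by omega, by omega, by omega, by omega, by omega, by omega, by omega, by omega, trivial⟩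
        ⟨(code_name P (by omega)).le (by omega), (code_name v (by omega)).le (by omega),
          (code_name w (by omega)).le (by omega), (lk_deg (lookup_entries hv') hH).le (by omega),
          (lk_deg (lookup_entries hw') hH).le (by omega),
          rol_deg hL hvt.1 hwt.1 hvt.2 hwt.2 hα, hrec⟩

theorem length_vars (d : CQ OntologyAtom) : d.vars.length ≤ (encodeCQ d).length ∧
    ∀ v ∈ d.vars, (encodeName v).length ≤ (encodeCQ d).length := by
  have hb : ∀ b : List OntologyAtom,
      (b.flatMap OntologyAtom.vars).length ≤ (encodeList encodeOntologyAtom b).length := by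
    intro b
    induction b with
    | nil => simp
    | cons α b ih =>
      have : α.vars.length ≤ (encodeOntologyAtom α).length := by
        cases α <;> simp [OntologyAtom.vars, encodeOntologyAtom, encodeName] <;> omega
      simp only [List.flatMap_cons, List.length_append, encodeList, List.length_cons]
      omega
  constructor
  · have h₁ := length_le_encodeList encodeName d.target
    have h₂ := hb d.body
    simp only [CQ.vars, encodeCQ, List.length_append]
    omega
  · intro v hv
    simp only [encodeCQ, List.length_append]
    rcases List.mem_append.1 hv with hv | hv
    · have := length_mem_encodeList encodeName hv
      omega
    · obtain ⟨α, hα, hv⟩ := List.mem_flatMap.1 hv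
      have h₁ := length_mem_encodeList encodeOntologyAtom hα
      have h₂ : (encodeName v).length ≤ (encodeOntologyAtom α).length := by
        cases α with
        | concept A u =>
          obtain rfl : v = u := by simpa [OntologyAtom.vars] using hv
          simp only [encodeOntologyAtom, List.length_cons, List.length_append]
          omega
        | role P u w =>
          simp only [encodeOntologyAtom, List.length_cons, List.length_append]
          rcases (by simpa [OntologyAtom.vars] using hv : v = u ∨ v = w) with rfl | rfl <;> omega
      omega

/-- Violations make the system derivably inconsistent. Otherwise the canonical model is a model, so
a certain answer has a shallow match in it, and its terms are short enough to be guessed. -/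
theorem cert_deg {x : Input} (hL : Large x.encode.length ℓ) {c : List Const}
    (hc : c ∈ certainAnswers x.query x.system) (hcl : (encodeList encodeName c).length ≤ ℓ) :
    Deg ℓ 18 (.cert, [encodeList encodeName c, x.encode]) := by
  have hl := hL.le
  have hq := hL.square
  by_cases hv : Violation x.system
  · exact (Deg.of_rule (r := certIncons) (j := 16) (basic_mem (by simp [basicClauses]))
      [encodeList encodeName c, x.encode] ⟨hcl, by omega, trivial⟩
      ⟨incons_deg hL hv, trivial⟩).le (by omega)
  obtain ⟨d, hd, h, ht, hval, hb, hdep⟩ := exists_match hv hc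
  have hx := x.length_encode
  have hdl := length_mem_encodeList encodeCQ hd
  obtain ⟨hvl, hvn⟩ := length_vars d
  have hle : d.vars.length ≤ x.encode.length := by omega
  have hterm : ∀ v ∈ d.vars, (encodeTm (h v)).length ≤
      4 * ((x.encode.length + 1) * (x.encode.length + 1)) := by
    intro v hv
    have h₁ := length_valid (hval v)
    have h₂ := hdep v hv
    have h₃ := Nat.mul_le_mul_right (x.encode.length + 1)
      (show (h v).depth ≤ x.encode.length + 1 by omega)
    omega
  have hone : x.encode.length + 1 ≤ (x.encode.length + 1) * (x.encode.length + 1) :=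
    Nat.le_mul_self _
  have hH : (encodeList encodeEntry (entries d.vars h)).length ≤ ℓ := by
    refine (length_encodeList_le
      (b := 5 * ((x.encode.length + 1) * (x.encode.length + 1))) ?_).trans ?_
    · intro e he
      obtain ⟨v, hv, rfl⟩ := List.mem_map.1 he
      have h₁ := hterm v hv
      have h₂ := hvn v hv
      simp only [encodeEntry, List.length_append]
      omega
    · rw [entries, List.length_map]
      -- The cube in `Large` is needed here: a match has linearly many entries, each of quadratic
      -- length.
      refine le_trans ?_ hL
      have := Nat.mul_le_mul_right (5 * ((x.encode.length + 1) * (x.encode.length + 1)) + 1) hle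
      have h₃ : (x.encode.length + 1) ^ 3 =
        (x.encode.length + 1) * (x.encode.length + 1) * (x.encode.length + 1) := by ring
      rw [h₃]
      nlinarith
  have hdc : (encodeCQ d).length = (encodeList encodeName d.target).length +
      (encodeList encodeOntologyAtom d.body).length := by simp [encodeCQ]
  refine Deg.of_rule (r := certAnswer) (j := 17) (basic_mem (by simp [basicClauses]))
    [encodeList encodeName c, x.encode, encodeList encodeName d.target,
      encodeList encodeOntologyAtom d.body, encodeList encodeEntry (entries d.vars h)]
    ⟨by omega, by omega, by omega, by omega, by omega, trivial⟩
    ⟨(inQ_deg (by omega) hd).le (by omega),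
      (code_deg (N := .names) (encodeList encodeName d.target) ⟨_, rfl⟩ (by omega)).le (by omega),
      (code_deg (N := .ents) (encodeList encodeEntry (entries d.vars h)) ⟨_, rfl⟩ hH).le
        (by omega),
      (tgt_deg ?_ hH (by omega) hcl).le (by omega),
      sat_deg hL hH (fun v hv => ⟨hval v, by have := hterm v hv; omega⟩) hb
        (fun α hα v hv => List.mem_append_right _ (List.mem_flatMap.2 ⟨α, hα, hv⟩)) (by omega),
      trivial⟩
  have := congrArg (List.map some) ht
  rw [List.map_map, List.map_map] at this
  exact (List.map_congr_left fun v hv => lookup_entries (List.mem_append_left _ hv)).trans this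

/-! #### Words outside the language -/

/-- Each condition of well-formedness fails through a concrete witness, such as a fact, an atom, a
disjunct or a tuple, to which one of the clauses for `top` can point. -/
theorem top_deg_of_not_wellFormed {x : Input} (h : x.encode.length ≤ ℓ) (hx : ¬ x.WellFormed) :
    Deg ℓ 9 (.top, [x.encode]) := by
  have hlen := x.length_encode
  have not_over : ∀ {a : RelAtom Name}, ¬ a.IsOver x.system.spec.schema →
      (encodeName a.pred).length + a.args.length + 1 ≤ ℓ →
      Deg ℓ 5 (.notS, [encodeName a.pred ++ encodeNat a.args.length, x.encode]) := by
    intro a ha hl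
    refine notS_deg h (by simp [encodeNat]; omega) fun e he hE => ha ?_
    obtain rfl : (a.pred, a.args.length) = e := prefixCode_schemaEntry.injective hE
    exact he
  by_cases h₁ : Schema.WellFormed x.system.spec.schema
  swap
  · simp only [Schema.WellFormed, not_forall] at h₁
    obtain ⟨s, m, n, hm, hn, hmn⟩ := h₁
    have hm' := length_mem_encodeList encodeSchemaEntry hm
    have hn' := length_mem_encodeList encodeSchemaEntry hn
    simp only [encodeSchemaEntry, List.length_append] at hm' hn'
    exact (Deg.of_rule (r := topSchema) (j := 5) (basic_mem (by simp [basicClauses]))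
      [x.encode, encodeName s, encodeNat m, encodeNat n]
      ⟨by omega, by omega, by omega, by omega, trivial⟩
      ⟨inS_deg h hm, inS_deg h hn, (code_name s (by omega)).le (by omega),
        (neq_deg (encodeNat m) (encodeNat n) (fun e => hmn (prefixCode_nat.injective e)) (by omega)
          (by omega)).le (by omega), trivial⟩).le (by omega)
  by_cases h₂ : ∀ α ∈ x.system.database, α.IsOver x.system.spec.schema
  swap
  · push Not at h₂
    obtain ⟨a, ha, hS⟩ := h₂
    have hl := length_relAtom ha
    have hl' := length_le_encodeList encodeName a.args
    exact (Deg.of_rule (r := topFact) (j := 5) (basic_mem (by simp [basicClauses]))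
      [x.encode, encodeName a.pred, encodeList encodeName a.args, encodeNat a.args.length]
      ⟨by omega, by omega, by omega, by simp [encodeNat]; omega, trivial⟩
      ⟨inD_deg h ha, (code_name a.pred (by omega)).le (by omega),
        (len_deg (l := a.args) (by omega)).le (by omega), not_over hS (by omega),
        trivial⟩).le (by omega)
  by_cases h₃ : ∀ m ∈ x.system.spec.mapping, ∀ α ∈ m.sourceBody, α.IsOver x.system.spec.schema
  swap
  · push Not at h₃
    obtain ⟨m, hm, a, ha, hS⟩ := h₃
    have hlm := length_glav hm
    have hla := length_mem_encodeList encodeRelAtom ha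
    simp only [encodeRelAtom, List.length_append] at hla
    have hl' := length_le_encodeList encodeName a.args
    exact (Deg.of_rule (r := topMapping) (j := 5) (basic_mem (by simp [basicClauses]))
      [x.encode, encodeList encodeName m.target, encodeList encodeRelAtom m.sourceBody,
        encodeList encodeOntologyAtom m.ontologyBody, encodeName a.pred,
        encodeList encodeName a.args, encodeNat a.args.length]
      ⟨by omega, by omega, by omega, by omega, by omega, by omega, by simp [encodeNat]; omega,
        trivial⟩
      ⟨inM_deg h hm,
        (code_deg (N := .names) (encodeList encodeName m.target) ⟨_, rfl⟩ (by omega)).le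
          (by omega),
        (code_deg (N := .rels) (encodeList encodeRelAtom m.sourceBody) ⟨_, rfl⟩ (by omega)).le
          (by omega),
        (mem_deg (N := .rel) (fun a => ⟨a, rfl⟩) ha (by omega)).le (by omega),
        (code_name a.pred (by omega)).le (by omega),
        (len_deg (l := a.args) (by omega)).le (by omega), not_over hS (by omega),
        trivial⟩).le (by omega)
  have neq_nat : ∀ {m n : ℕ}, m ≠ n → m + 1 ≤ ℓ → n + 1 ≤ ℓ →
      Deg ℓ 5 (.neq, [encodeNat m, encodeNat n]) := fun {m n} hmn hm hn =>
    (neq_deg (encodeNat m) (encodeNat n) (fun e => hmn (prefixCode_nat.injective e))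
      (by simpa [encodeNat] using hm) (by simpa [encodeNat] using hn)).le (by omega)
  have har : (encodeNat x.query.arity).length = x.query.arity + 1 := by simp [encodeNat]
  by_cases h₄ : x.query.WellFormed
  swap
  · simp only [UCQ.WellFormed, not_forall] at h₄
    obtain ⟨d, hd, hn⟩ := h₄
    have hdl := length_mem_encodeList encodeCQ hd
    simp only [encodeCQ, List.length_append] at hdl
    have hl' := length_le_encodeList encodeName d.target
    exact (Deg.of_rule (r := topArity) (j := 5) (basic_mem (by simp [basicClauses]))
      [x.encode, encodeList encodeName d.target, encodeList encodeOntologyAtom d.body,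
        encodeNat d.target.length, encodeNat x.query.arity]
      ⟨by omega, by omega, by omega, by simp [encodeNat]; omega, by omega, trivial⟩
      ⟨inQ_deg h hd,
        (code_deg (N := .names) (encodeList encodeName d.target) ⟨_, rfl⟩ (by omega)).le
          (by omega),
        (len_deg (l := d.target) (by omega)).le (by omega),
        neq_nat hn (by omega) (by omega), (arity_deg h).le (by omega), trivial⟩).le (by omega)
  have h₅ : ¬ IsDataset x.system.database x.query.arity x.dataset :=
    fun h₅ => hx ⟨⟨h₁, h₂, h₃⟩, h₄, h₅⟩
  simp only [IsDataset, not_forall] at h₅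
  obtain ⟨c, hc, hn⟩ := h₅
  have hcl := length_mem_encodeList (encodeList encodeName) hc
  have hl' := length_le_encodeList encodeName c
  by_cases hca : c.length = x.query.arity
  · have hn : ∃ a ∈ c, a ∉ Database.dom x.system.database := by
      by_contra! hall
      exact hn ⟨hca, hall⟩
    obtain ⟨a, ha, hd⟩ := hn
    have hal := length_mem_encodeList encodeName ha
    exact (Deg.of_rule (r := topOutside) (j := 7) (basic_mem (by simp [basicClauses]))
      [x.encode, encodeList encodeName c, encodeName a] ⟨by omega, by omega, by omega, trivial⟩
      ⟨(inL_deg h hc).le (by omega),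
        (mem_deg (N := .name) (fun a => ⟨a, rfl⟩) ha (by omega)).le (by omega),
        notdom_deg (X := encodeName a) h (by omega)
          (fun b hb e => hd (prefixCode_name.injective e ▸ hb)), trivial⟩).le (by omega)
  · exact (Deg.of_rule (r := topLength) (j := 5) (basic_mem (by simp [basicClauses]))
      [x.encode, encodeList encodeName c, encodeNat c.length, encodeNat x.query.arity]
      ⟨by omega, by omega, by simp [encodeNat]; omega, by omega, trivial⟩
      ⟨inL_deg h hc, (len_deg (l := c) (by omega)).le (by omega),
        neq_nat hca (by omega) (by omega), (arity_deg h).le (by omega), trivial⟩).le (by omega)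

/-- The cases are: no prefix codes an input, a proper prefix does, the input is ill-formed, or some
certain answer is missing from the dataset. -/
theorem top_deg {W : List Sym} (hL : Large W.length ℓ) (hW : W ∉ soundVQDEF) :
    Deg ℓ 19 (.top, [W]) := by
  have hl := hL.le
  by_cases hb : ∀ Y ∈ lang .input, ∀ t, W ≠ Y ++ t
  · exact (Deg.of_rule (r := topBad) (j := 2) (basic_mem (by simp [basicClauses])) [W]
      ⟨by omega, trivial⟩ ⟨bad_deg (X := W) hb (by omega), trivial⟩).le (by omega)
  push Not at hb
  obtain ⟨_, ⟨x, rfl⟩, t, rfl⟩ := hb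
  cases t with
  | cons a t =>
    simp only [List.length_append, List.length_cons] at hl
    exact (Deg.of_rule (r := topTrail a) (j := 2) (sym_mem (a := a) (by simp [symClauses]))
      [x.encode, t] ⟨by omega, by omega, trivial⟩
      ⟨code_deg (N := .input) x.encode ⟨x, rfl⟩ (by omega), trivial⟩).le (by omega)
  | nil =>
  rw [List.append_nil] at hL hW hl ⊢
  by_cases hwf : x.WellFormed
  swap
  · exact (top_deg_of_not_wellFormed (by omega) hwf).le (by omega)
  obtain ⟨c, hc, hn⟩ : ∃ c ∈ certainAnswers x.query x.system, c ∉ x.dataset := by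
    by_contra! h
    exact hW ⟨x, hwf, rfl, h⟩
  have hx := x.length_encode
  have har : (encodeNat x.query.arity).length = x.query.arity + 1 := by simp [encodeNat]
  -- The arity is written in unary and the entries come from the database, so the code of the tuple
  -- has quadratic length.
  have hcl : (encodeList encodeName c).length ≤ ℓ := by
    have h₁ := length_encodeList_le (f := encodeName) (l := c) (b := x.encode.length)
      fun a ha => by have := length_dom (hc.2.1 a ha); omega
    have h₂ := Nat.mul_le_mul_right (x.encode.length + 1)
      (show c.length ≤ x.encode.length by rw [hc.1]; omega)
    have h₃ := hL.square
    nlinarith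
  have hlen := len_deg hcl
  rw [hc.1] at hlen
  exact Deg.of_rule (r := topCert) (j := 18) (basic_mem (by simp [basicClauses]))
    [x.encode, encodeList encodeName c, encodeNat x.query.arity]
    ⟨by omega, by omega, by omega, trivial⟩
    ⟨(domall_deg (by omega) hc.2.1 hcl).le (by omega), hlen.le (by omega),
      (arity_deg (by omega)).le (by omega),
      (notL_deg (by omega) hcl fun a ha e =>
        hn ((prefixCode_list prefixCode_name).injective e ▸ ha)).le (by omega),
      cert_deg hL hc hcl, trivial⟩

end OBDM

theorem mainTheorem7 : Complexity.InCoNP OBDM.soundVQDEF := by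
  refine Horn.inNP OBDM.clauses OBDM.Pr.top _
    -- The same polynomial has to bound the number of steps and the lengths of words. With `ℓ = 20 *
    -- (w + 1) ^ 3` it is `(ℓ + 16) ^ 19`, which is at least `ℓ`.
    ((20 * (Polynomial.X + 1) ^ 3 + 16) ^ 19) (fun x ℓ n h => OBDM.clauses_sound h) ?_
  intro W hW
  obtain ⟨n, hn, h⟩ := OBDM.top_deg (ℓ := 20 * (W.length + 1) ^ 3) le_rfl hW
  have hp : ((20 * (Polynomial.X + 1) ^ 3 + 16) ^ 19 : Polynomial ℕ).eval W.length =
      (20 * (W.length + 1) ^ 3 + 16) ^ 19 := by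
    simp
  rw [hp]
  refine ⟨n, hn, h.mono ?_⟩
  exact (Nat.le_add_right _ 16).trans (Nat.le_self_pow (by omega) _)
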